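/- Let $p$ be a prime number, $L$ a finite extension of $\mathbb{Q}_p$ with ring of integers $\mathcal O$, uniformizer $\varpi$ and residue field $k$. Let $R$ be a complete local noetherian commutative $\mathcal O$-algebra with residue field $k$, let $K$ be a compact $p$-adic analytic group, and let $N$ be a compact $R[[K]]$-module that is finitely generated over $R[[K]]$. Let $V$ be a continuous representation of $K$ on a finite dimensional $L$-vector space and let $\Theta$ be a $K$-invariant $\mathcal O$-lattice in $V$. Write $\Theta^d=\mathrm{Hom}_{\mathcal O}(\Theta,\mathcal O)$ and let ${}^\vee=\mathrm{Hom}_{\mathcal O}(\cdot,L/\mathcal O)$ be the Pontryagin dual. Put $$M(\Theta)=\mathrm{Hom}_{\mathcal O}\bigl(\mathrm{Hom}^{\mathrm{cont}}_{\mathcal O[[K]]}(N,\Theta^d),\mathcal O\bigr),\qquad M(\sigma)=\bigl(\mathrm{Hom}^{\mathrm{cont}}_{\mathcal O[[K]]}(N,\sigma^\vee)\bigr)^\vee$$ for a smooth irreducible $k$-representation $\sigma$ of $K$; both are $R$-modules through the action of $R$ on $N$. For a finitely generated $R[1/p]$-module $\mathrm m$ let $\Pi(\mathrm m)=\mathrm{Hom}^{\mathrm{cont}}_{\mathcal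 O}(\mathrm m^0\otimes_R N,L)$, where $\mathrm m^0\subset\mathrm m$ is any finitely generated $R$-submodule with $\mathrm m^0[1/p]=\mathrm m$; it is a representation of $K$. For an $R$-module $M$ that is finitely generated of dimension at most $e$ let $z_e(M)=\sum_{\mathfrak p}\ell_{R_{\mathfrak p}}(M_{\mathfrak p})\,\mathfrak p$, the sum being over the $\mathfrak p\in\mathrm{Spec}\,R$ with $\dim R/\mathfrak p=e$, in the free abelian group on these primes. Let $d$ be the Krull dimension of $M(\Theta)$ and let $\mathfrak a$ be the annihilator of $M(\Theta)$ in $R$. Suppose that (a) $N$ is projective in the category of compact $\mathcal O[[K]]$-modules; (b) $R/\mathfrak a$ is equidimensional and all its associated primes are minimal; (c) there is a dense subset $\Sigma$ of the support of $M(\Theta)$, consisting of maximal ideals of $R[1/p]$, such that for all $\mathfrak n\in\Sigma$, with residue field $\kappa(\mathfrak n)$, $$\dim_{\kappa(\mathfrak n)}\mathrm{Hom}_K(V,\Pi(\kappa(\mathfrak n)))=1\quad\text{and}\quad \dim_{\kappa(\mathfrak n)}\mathrm{Hom}_K(V,\Pi(R_{\mathfrak n}/\mathfrak n^2))\le d,$$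 where $R_{\mathfrak n}/\mathfrak n^2$ is a $\kappa(\mathfrak n)$-algebra through the unique $\mathcal O$-algebra section of $R_{\mathfrak n}/\mathfrak n^2\to\kappa(\mathfrak n)$. Then $R/\mathfrak a$ is reduced of dimension $d$. Moreover, for each $\sigma$ let $m_\sigma$ be the multiplicity with which $\sigma$ occurs as a subquotient of $\Theta/\varpi\Theta$; then $m_\sigma\neq 0$ for only finitely many isomorphism classes of $\sigma$, the module $R/(\varpi,\mathfrak a)$ and, whenever $m_\sigma\ne 0$, the module $M(\sigma)$ are finitely generated over $R$ of dimension at most $d-1$, and $$z_{d-1}(R/(\varpi,\mathfrak a))=\sum_\sigma m_\sigma\, z_{d-1}(M(\sigma)),$$ where the sum is over the isomorphism classes of smooth irreducible $k$-representations $\sigma$ of $K$. (If $M(\Theta)=0$, then $d=-\infty$, and the identity reads $0=0$.) -/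

import Mathlib

open scoped TensorProduct NormedField Valued MonoidAlgebra Manifold ContDiff

universe u

noncomputable section

namespace BreuilMezard

/-! ## The completed group algebra -/

section CompletedGroupAlgebra

variable (A K : Type u) [CommRing A] [IsLocalRing A] [Group K] [TopologicalSpace K]

/-- The group algebra `(A/𝔪ⁿ)[K/U]`, for `U` an open normal subgroup of `K`. -/
abbrev Level (n : ℕ) (U : OpenNormalSubgroup K) : Type u :=
  MonoidAlgebra (A ⧸ IsLocalRing.maximalIdeal A ^ n) (K ⧸ (U : Subgroup K))

/-- The projection `(A/𝔪ⁿ)[K/W] → (A/𝔪ᵐ)[K/U]`, for `m ≤ n` and `W ≤ U`. -/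
def levelMap {m n : ℕ} (hmn : m ≤ n) {U W : OpenNormalSubgroup K}
    (hWU : (W : Subgroup K) ≤ (U : Subgroup K)) : Level A K n W →ₐ[A] Level A K m U :=
  (MonoidAlgebra.mapAlgHom _ (Ideal.Quotient.factorₐ A (Ideal.pow_le_pow_right hmn))).comp
    (MonoidAlgebra.mapDomainAlgHom A _
      (QuotientGroup.map (W : Subgroup K) (U : Subgroup K) (MonoidHom.id K) hWU))

/-- The projective limit of the rings `(A/𝔪ⁿ)[K/U]`, inside their product. -/
def completedSubalgebra :
    Subalgebra A (∀ i : ℕ × OpenNormalSubgroup K, Level A K i.1 i.2) where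
  carrier := {x | ∀ (m n : ℕ) (hmn : m ≤ n) (U W : OpenNormalSubgroup K)
    (hWU : (W : Subgroup K) ≤ (U : Subgroup K)), levelMap A K hmn hWU (x (n, W)) = x (m, U)}
  mul_mem' hx hy m n hmn U W hWU := by
    simp only [Pi.mul_apply, map_mul, hx m n hmn U W hWU, hy m n hmn U W hWU]
  add_mem' hx hy m n hmn U W hWU := by
    simp only [Pi.add_apply, map_add, hx m n hmn U W hWU, hy m n hmn U W hWU]
  algebraMap_mem' a m n hmn U W hWU := by
    simp only [Pi.algebraMap_apply, AlgHom.commutes]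

/-- The completed group algebra `A⟦K⟧ = lim (A/𝔪ⁿ)[K/U]`. -/
def CompletedGroupAlgebra : Type u := completedSubalgebra A K

instance : Ring (CompletedGroupAlgebra A K) := inferInstanceAs (Ring (completedSubalgebra A K))

instance : Algebra A (CompletedGroupAlgebra A K) :=
  inferInstanceAs (Algebra A (completedSubalgebra A K))

/-- The projective limit topology, each `(A/𝔪ⁿ)[K/U]` being discrete. -/
instance : TopologicalSpace (CompletedGroupAlgebra A K) :=
  TopologicalSpace.induced (fun x : completedSubalgebra A K => x.1)
    (@Pi.topologicalSpace _ _ fun _ => ⊥)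

/-- The group elements inside `A⟦K⟧`. -/
def CompletedGroupAlgebra.of : K →* CompletedGroupAlgebra A K where
  toFun g := (⟨fun _ => MonoidAlgebra.of _ _ (QuotientGroup.mk g), by
    intro m n hmn U W hWU
    simp only [levelMap, AlgHom.comp_apply, MonoidAlgebra.of_apply]
    simp
    rfl⟩ : completedSubalgebra A K)
  map_one' := by
    apply Subtype.ext
    funext i
    exact map_one (MonoidAlgebra.of (A ⧸ IsLocalRing.maximalIdeal A ^ i.1)
      (K ⧸ (i.2 : Subgroup K)))
  map_mul' g h := by
    apply Subtype.ext
    funext i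
    exact map_mul (MonoidAlgebra.of (A ⧸ IsLocalRing.maximalIdeal A ^ i.1)
      (K ⧸ (i.2 : Subgroup K)))
      (QuotientGroup.mk g) (QuotientGroup.mk h)

end CompletedGroupAlgebra

/-! ## Representations -/

/-- Smooth representations: the stabilizer of every vector is open. -/
def IsSmooth {A K X : Type*} [Semiring A] [Group K] [TopologicalSpace K] [AddCommMonoid X]
    [Module A X] (ρ : Representation A K X) : Prop :=
  ∀ x : X, ∃ U : OpenSubgroup K, ∀ g ∈ U, ρ g x = x

/-- The multiplicity with which the irreducible representation `σ` occurs as a subquotient of `ρ`: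
the number of factors isomorphic to `σ` in a composition series of `ρ`
(the same for all composition series, by Jordan–Hölder). -/
def jhMultiplicity {A K X Y : Type*} [CommRing A] [Group K] [AddCommGroup X] [Module A X]
    [AddCommGroup Y] [Module A Y] (ρ : Representation A K X) (σ : Representation A K Y) : ℕ :=
  sSup {n : ℕ | ∃ s : CompositionSeries (Submodule A[K] ρ.asModule),
    RelSeries.head s = ⊥ ∧ RelSeries.last s = ⊤ ∧
    n = Nat.card {i : Fin s.length //
      Nonempty ((s i.succ ⧸ (s i.castSucc).submoduleOf (s i.succ)) ≃ₗ[A[K]] σ.asModule)}}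

/-- An irreducible smooth `k`-representation of `K`. -/
structure SmoothIrrep (k K : Type u) [Field k] [Group K] [TopologicalSpace K] where
  carrier : Type u
  [addCommGroup : AddCommGroup carrier]
  [module : Module k carrier]
  ρ : Representation k K carrier
  irreducible : ρ.IsIrreducible
  smooth : IsSmooth ρ

attribute [instance] SmoothIrrep.addCommGroup SmoothIrrep.module

/-- Isomorphism of irreducible smooth representations. -/
instance SmoothIrrep.setoid (k K : Type u) [Field k] [Group K] [TopologicalSpace K] :
    Setoid (SmoothIrrep k K) where
  r σ τ := Nonempty (σ.ρ.Equiv τ.ρ)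
  iseqv := ⟨fun _ => ⟨.refl _⟩, fun ⟨e⟩ => ⟨e.symm⟩, fun ⟨e⟩ ⟨f⟩ => ⟨e.trans f⟩⟩

/-- The set of isomorphism classes of smooth irreducible `k`-representations of `K`. -/
def IrrepClass (k K : Type u) [Field k] [Group K] [TopologicalSpace K] : Type (u + 1) :=
  Quotient (SmoothIrrep.setoid k K)

section Restrict

variable (O : Type u) {K : Type u} [CommRing O] [IsLocalRing O] [Group K] [TopologicalSpace K]
  (σ : SmoothIrrep (IsLocalRing.ResidueField O) K)

/-- The vector space of a representation over the residue field `k` of `O`, as an `O`-module. -/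
def SmoothIrrep.Restrict : Type u := σ.carrier

instance : AddCommGroup (σ.Restrict O) := σ.addCommGroup

instance : Module O (σ.Restrict O) := Module.compHom σ.carrier (IsLocalRing.residue O)

/-- A representation over the residue field `k` of `O`, viewed as a representation over `O`. -/
def SmoothIrrep.restrict : Representation O K (σ.Restrict O) where
  toFun g :=
    { toFun := fun x => (σ.ρ g : σ.carrier →ₗ[_] σ.carrier) x
      map_add' := fun x y => (σ.ρ g).map_add x y
      map_smul' := fun a x => (σ.ρ g).map_smul (IsLocalRing.residue O a) x }
  map_one' := LinearMap.ext fun x => LinearMap.congr_fun (map_one σ.ρ) x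
  map_mul' g h := LinearMap.ext fun x => LinearMap.congr_fun (map_mul σ.ρ g h) x

end Restrict

/-! ## Duals -/

section LinDual

variable (O T Q : Type u) [CommRing O] [AddCommGroup T] [Module O T] [AddCommGroup Q] [Module O Q]

/-- `Hom_O(T, Q)`. For `Q = O` this is the Schikhof dual of `T`; for `Q = L/O` and `T` discrete,
it is the Pontryagin dual of `T`. -/
def LinDual : Type u := T →ₗ[O] Q

instance : AddCommGroup (LinDual O T Q) := inferInstanceAs (AddCommGroup (T →ₗ[O] Q))

instance : FunLike (LinDual O T Q) T Q := inferInstanceAs (FunLike (T →ₗ[O] Q) T Q)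

instance : AddMonoidHomClass (LinDual O T Q) T Q :=
  inferInstanceAs (AddMonoidHomClass (T →ₗ[O] Q) T Q)

/-- The topology of pointwise convergence. If `T` is discrete, it is the compact-open topology. -/
instance [TopologicalSpace Q] : TopologicalSpace (LinDual O T Q) :=
  TopologicalSpace.induced (fun (f : LinDual O T Q) (t : T) => f t) inferInstance

instance [TopologicalSpace Q] [IsTopologicalAddGroup Q] :
    IsTopologicalAddGroup (LinDual O T Q) :=
  topologicalAddGroup_induced
    ({ toFun := fun f t => f t, map_zero' := rfl, map_add' := fun _ _ => rfl } :
      LinDual O T Q →+ (T → Q))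

/-- An action of a commutative ring on `T` induces one on `Hom_O(T, Q)`: `(s • f)(t) = f(s • t)`. -/
instance {S : Type*} [CommSemiring S] [Module S T] [SMulCommClass S O T] :
    Module S (LinDual O T Q) where
  smul s f := (LinearMap.comp f
    ({ toFun := fun t => s • t, map_add' := smul_add s,
       map_smul' := fun a t => smul_comm s a t } : T →ₗ[O] T) : T →ₗ[O] Q)
  one_smul f := LinearMap.ext fun t => congrArg f (one_smul S t)
  mul_smul r s f := LinearMap.ext fun t => congrArg f (by
    change (r * s) • t = s • r • t
    rw [mul_comm, mul_smul])
  smul_zero s := rfl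
  smul_add s f g := rfl
  add_smul r s f := LinearMap.ext fun t => by
    change f ((r + s) • t) = f (r • t) + f (s • t)
    rw [add_smul, map_add]
  zero_smul f := LinearMap.ext fun t => by
    change f ((0 : S) • t) = 0
    rw [zero_smul, map_zero]

variable {T} in
/-- The contragredient representation on `Hom_O(T, Q)`: `(g f)(t) = f(g⁻¹ t)`. -/
def contragredient {K : Type*} [Group K] (ρ : Representation O K T) :
    Representation O K (LinDual O T Q) where
  toFun g :=
    { toFun := fun f => LinearMap.comp (f : T →ₗ[O] Q) (ρ g⁻¹)
      map_add' := fun _ _ => rfl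
      map_smul' := fun a f => LinearMap.ext fun t =>
        congrArg (f : T →ₗ[O] Q) ((ρ g⁻¹).map_smul a t).symm }
  map_one' := by
    refine LinearMap.ext fun f => LinearMap.ext fun t => ?_
    change (f : T →ₗ[O] Q) (ρ 1⁻¹ t) = (f : T →ₗ[O] Q) t
    simp
  map_mul' g h := by
    refine LinearMap.ext fun f => LinearMap.ext fun t => ?_
    change (f : T →ₗ[O] Q) (ρ (g * h)⁻¹ t) = (f : T →ₗ[O] Q) (ρ h⁻¹ (ρ g⁻¹ t))
    simp

end LinDual

/-- The `O`-module `L/O`. -/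
abbrev ModInt (O L : Type u) [CommRing O] [CommRing L] [Algebra O L] : Type u :=
  L ⧸ LinearMap.range (Algebra.linearMap O L)

/-! ## The modules attached to `N` -/

section Formalism

variable (O R K N : Type u) [CommRing O] [CommRing R] [IsLocalRing R] [Algebra O R]
  [Group K] [TopologicalSpace K]
  [AddCommGroup N] [Module (CompletedGroupAlgebra R K) N]
  [Module R N] [IsScalarTower R (CompletedGroupAlgebra R K) N] [Module O N] [IsScalarTower O R N]

/-- The `O`-linear action of `K` on an `R⟦K⟧`-module. -/
def groupRep : Representation O K N where
  toFun g := ((Algebra.lsmul R R N : CompletedGroupAlgebra R K →ₐ[R] Module.End R N)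
    (CompletedGroupAlgebra.of R K g)).restrictScalars O
  map_one' := by
    ext x
    simp
  map_mul' g h := by
    ext x
    simp

/-- `N` is projective in the category `Mod^pro_K(O)` of compact `O⟦K⟧`-modules. The objects of
that category are the compact Hausdorff topological `O`-modules with a continuous `O`-linear action
of `K`, and its morphisms are the continuous `O`-linear `K`-equivariant maps. -/
def IsProjectivePro [TopologicalSpace O] [TopologicalSpace N] : Prop :=
  ∀ (X Y : Type u) [AddCommGroup X] [AddCommGroup Y] [Module O X] [Module O Y]
    [TopologicalSpace X] [TopologicalSpace Y] [IsTopologicalAddGroup X] [IsTopologicalAddGroup Y]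
    [ContinuousSMul O X] [ContinuousSMul O Y] [CompactSpace X] [CompactSpace Y]
    [T2Space X] [T2Space Y] (ρX : Representation O K X) (ρY : Representation O K Y),
    (Continuous fun z : K × X => ρX z.1 z.2) → (Continuous fun z : K × Y => ρY z.1 z.2) →
    ∀ (q : X →L[O] Y) (f : N →L[O] Y), Function.Surjective q →
      (∀ g x, q (ρX g x) = ρY g (q x)) → (∀ g n, f (groupRep O R K N g n) = ρY g (f n)) →
      ∃ h : N →L[O] X, (∀ g n, h (groupRep O R K N g n) = ρX g (h n)) ∧ q.comp h = f

variable [TopologicalSpace N]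

section HomCont

variable (X : Type u) [AddCommGroup X] [Module O X] [TopologicalSpace X] [IsTopologicalAddGroup X]
  (ρX : Representation O K X)

/-- The group of continuous `O`-linear `K`-equivariant maps `N → X`. -/
def homContSubgroup : AddSubgroup (N →ₗ[O] X) where
  carrier := {f | Continuous f ∧ ∀ g n, f (groupRep O R K N g n) = ρX g (f n)}
  add_mem' := by
    rintro f f' ⟨hf, hf'⟩ ⟨hg, hg'⟩
    exact ⟨hf.add hg, fun g n => by simp [hf', hg']⟩
  zero_mem' := ⟨continuous_const, fun g n => by simp⟩
  neg_mem' := by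
    rintro f ⟨hf, hf'⟩
    exact ⟨hf.neg, fun g n => by simp [hf']⟩

/-- `Hom^cont_{O⟦K⟧}(N, X)`: for compact `O⟦K⟧`-modules `N` and `X`, a continuous map is
`O⟦K⟧`-linear if and only if it is `O`-linear and `K`-equivariant, as `O[K]` is dense in
`O⟦K⟧`. -/
def HomCont : Type u := homContSubgroup O R K N X ρX

instance : AddCommGroup (HomCont O R K N X ρX) :=
  inferInstanceAs (AddCommGroup (homContSubgroup O R K N X ρX))

variable [TopologicalSpace O] [ContinuousSMul (CompletedGroupAlgebra R K) N]

/-- `R` acts on `Hom^cont_{O⟦K⟧}(N, X)` through its action on `N`. -/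
instance : Module R (HomCont O R K N X ρX) where
  smul r f := (⟨f.1.comp ((LinearMap.lsmul R N r).restrictScalars O), by
    refine ⟨f.2.1.comp ?_, fun g n => ?_⟩
    · have h : Continuous fun n : N => algebraMap R (CompletedGroupAlgebra R K) r • n :=
        continuous_const.smul continuous_id
      simp only [algebraMap_smul] at h
      exact h
    · have h : r • groupRep O R K N g n = groupRep O R K N g (r • n) :=
        smul_comm r (CompletedGroupAlgebra.of R K g) n
      change f.1 (r • groupRep O R K N g n) = ρX g (f.1 (r • n))
      rw [h, f.2.2]⟩ : homContSubgroup O R K N X ρX)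
  one_smul f := Subtype.ext <| LinearMap.ext fun n => congrArg f.1 (one_smul R n)
  mul_smul r s f := Subtype.ext <| LinearMap.ext fun n => congrArg f.1 (by
    change (r * s) • n = s • r • n
    rw [mul_comm, mul_smul])
  smul_zero r := rfl
  smul_add r f g := rfl
  add_smul r s f := Subtype.ext <| LinearMap.ext fun n => by
    change f.1 ((r + s) • n) = f.1 (r • n) + f.1 (s • n)
    rw [add_smul, map_add]
  zero_smul f := Subtype.ext <| LinearMap.ext fun n => by
    change f.1 ((0 : R) • n) = 0
    rw [zero_smul, map_zero]

/-- `O` acts through `O → R`, that is by `(a • f)(n) = f(a • n) = a • f(n)`. -/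
instance : Module O (HomCont O R K N X ρX) := Module.compHom _ (algebraMap O R)

instance : IsScalarTower O R (HomCont O R K N X ρX) where
  smul_assoc a r f := by
    change (a • r) • f = algebraMap O R a • r • f
    rw [Algebra.smul_def, mul_smul]

end HomCont

variable [TopologicalSpace O] [IsTopologicalRing O] [ContinuousSMul (CompletedGroupAlgebra R K) N]

/-- `M(Θ) = Hom_O(Hom^cont_{O⟦K⟧}(N, Θ^d), O)`, where `Θ^d = Hom_O(Θ, O)`. -/
abbrev MLattice {Θ : Type u} [AddCommGroup Θ] [Module O Θ] (ρ : Representation O K Θ) : Type u :=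
  LinDual O (HomCont O R K N (LinDual O Θ O) (contragredient O O ρ)) O

/-- `M(lam) = (Hom^cont_{O⟦K⟧}(N, lam^∨))^∨`, where `∨` denotes the Pontryagin dual
`Hom_O(-, L/O)`. -/
abbrev MSmooth (L : Type u) [Field L] [Algebra O L] [TopologicalSpace L] [IsTopologicalRing L]
    {lam : Type u} [AddCommGroup lam] [Module O lam] (ρ : Representation O K lam) : Type u :=
  LinDual O (HomCont O R K N (LinDual O lam (ModInt O L)) (contragredient O (ModInt O L) ρ))
    (ModInt O L)

/-! ## The Banach space representations `Π(m)` -/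

section Banach

variable (L : Type u) [Field L] [Algebra O L] [TopologicalSpace L] [IsTopologicalRing L]
  (m : Type u) [AddCommGroup m] [Module R m] [Module O m] [IsScalarTower O R m]

/-- The underlying `L`-vector space of `Π(m) = Hom^cont_O(m⁰ ⊗_R N, L)`, where `m` is a finitely
generated `R[1/p]`-module and `m⁰` is a finitely generated `R`-submodule of `m` with
`m⁰[1/p] = m`. As `p` is invertible in `L`, every `O`-linear map `m⁰ ⊗_R N → L` extends uniquely to
`m ⊗_R N = (m⁰ ⊗_R N)[1/p]`; and as `m⁰ ⊗_R N` carries the quotient topology from `Nʳ`, for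
generators `x₁, …, x_r` of `m⁰`, the map is continuous if and only if `n ↦ φ(x_i ⊗ n)` is
continuous for all `i`, equivalently if `n ↦ φ(x ⊗ n)` is continuous for all `x` in `m`. -/
def banachSubmodule : Submodule L (m ⊗[R] N →ₗ[O] L) where
  carrier := {φ | ∀ x : m, Continuous fun n : N => φ (x ⊗ₜ[R] n)}
  add_mem' hφ hψ x := (hφ x).add (hψ x)
  zero_mem' _ := continuous_const
  smul_mem' _ _ hφ x := continuous_const.mul (hφ x)

/-- The `L`-vector space `Π(m)`. -/
def Banach : Type u := banachSubmodule O R N L m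

instance : AddCommGroup (Banach O R N L m) :=
  inferInstanceAs (AddCommGroup (banachSubmodule O R N L m))

instance : Module L (Banach O R N L m) :=
  inferInstanceAs (Module L (banachSubmodule O R N L m))

/-- The action of `K` on `Π(m)`: `(g φ)(x ⊗ n) = φ(x ⊗ g⁻¹ n)`. -/
def banachRep : Representation L K (Banach O R N L m) where
  toFun g :=
    { toFun := fun φ => (⟨φ.1.comp ((LinearMap.lTensor m (Algebra.lsmul R R N
          (CompletedGroupAlgebra.of R K g⁻¹))).restrictScalars O), fun x => by
        have h : Continuous fun n : N => CompletedGroupAlgebra.of R K g⁻¹ • n :=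
          continuous_const.smul continuous_id
        exact (φ.2 x).comp h⟩ : banachSubmodule O R N L m)
      map_add' := fun _ _ => rfl
      map_smul' := fun _ _ => rfl }
  map_one' := by
    refine LinearMap.ext fun φ => Subtype.ext <| LinearMap.ext fun z => ?_
    change φ.1 (LinearMap.lTensor m (Algebra.lsmul R R N
      (CompletedGroupAlgebra.of R K 1⁻¹)) z) = φ.1 z
    have h : (1 : Module.End R N) = LinearMap.id := rfl
    simp [h]
  map_mul' g g' := by
    refine LinearMap.ext fun φ => Subtype.ext <| LinearMap.ext fun z => ?_
    change φ.1 (LinearMap.lTensor m (Algebra.lsmul R R N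
      (CompletedGroupAlgebra.of R K (g * g')⁻¹)) z) =
      φ.1 (LinearMap.lTensor m (Algebra.lsmul R R N (CompletedGroupAlgebra.of R K g'⁻¹))
        (LinearMap.lTensor m (Algebra.lsmul R R N (CompletedGroupAlgebra.of R K g⁻¹)) z))
    rw [mul_inv_rev, map_mul, map_mul, Module.End.mul_eq_comp, LinearMap.lTensor_comp,
      LinearMap.comp_apply]

section Action

variable {S : Type*} [CommRing S] [Module S m] [SMulCommClass R S m] [SMulCommClass S O m]

/-- A commutative ring acting on `m` acts on `Π(m)`, by functoriality:
`(s φ)(x ⊗ n) = φ(s x ⊗ n)`. -/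
instance : Module S (Banach O R N L m) where
  smul s φ := (⟨φ.1.comp
    ({ toFun := fun z => s • z, map_add' := smul_add s,
       map_smul' := fun a z => smul_comm s a z } : m ⊗[R] N →ₗ[O] m ⊗[R] N),
    fun x => φ.2 (s • x)⟩ : banachSubmodule O R N L m)
  one_smul φ := Subtype.ext <| LinearMap.ext fun z => congrArg φ.1 (one_smul S z)
  mul_smul r s φ := Subtype.ext <| LinearMap.ext fun z => congrArg φ.1 (by
    change (r * s) • z = s • r • z
    rw [mul_comm, mul_smul])
  smul_zero s := rfl
  smul_add s φ ψ := rfl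
  add_smul r s φ := Subtype.ext <| LinearMap.ext fun z => by
    change φ.1 ((r + s) • z) = φ.1 (r • z) + φ.1 (s • z)
    rw [add_smul, map_add]
  zero_smul φ := Subtype.ext <| LinearMap.ext fun z => by
    change φ.1 ((0 : S) • z) = 0
    rw [zero_smul, map_zero]

theorem banach_smul_comm (s : S) (c : L) (φ : Banach O R N L m) : s • c • φ = c • s • φ := rfl

theorem banachRep_smul (s : S) (g : K) (φ : Banach O R N L m) :
    banachRep O R K N L m g (s • φ) = s • banachRep O R K N L m g φ := by
  refine Subtype.ext <| LinearMap.ext fun z => congrArg φ.1 ?_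
  change s • LinearMap.lTensor m (Algebra.lsmul R R N (CompletedGroupAlgebra.of R K g⁻¹)) z =
    LinearMap.lTensor m (Algebra.lsmul R R N (CompletedGroupAlgebra.of R K g⁻¹)) (s • z)
  induction z with
  | zero => simp
  | add a b ha hb => simp only [smul_add, map_add, ha, hb]
  | tmul a b => simp [TensorProduct.smul_tmul']

end Action

variable {V : Type u} [AddCommGroup V] [Module L V] (ρV : Representation L K V)

/-- The group of `L`-linear `K`-equivariant maps `V → Π(m)`. -/
def homBanachSubgroup : AddSubgroup (V →ₗ[L] Banach O R N L m) where
  carrier := {f | ∀ g v, f (ρV g v) = banachRep O R K N L m g (f v)}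
  add_mem' hf hf' g v := by
    simp only [LinearMap.add_apply, hf g v, hf' g v, map_add]
  zero_mem' g v := by simp
  neg_mem' hf g v := by
    simp only [LinearMap.neg_apply, hf g v, map_neg]

/-- `Hom_K(V, Π(m))`, for a representation `V` of `K` on a finite dimensional `L`-vector space
(so that every `L`-linear map `V → Π(m)` is continuous). -/
def HomBanach : Type u := homBanachSubgroup O R K N L m ρV

instance : AddCommGroup (HomBanach O R K N L m ρV) :=
  inferInstanceAs (AddCommGroup (homBanachSubgroup O R K N L m ρV))

/-- A commutative ring acting on `m` acts on `Hom_K(V, Π(m))`, by functoriality. -/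
instance {S : Type*} [CommRing S] [Module S m] [SMulCommClass R S m] [SMulCommClass S O m] :
    Module S (HomBanach O R K N L m ρV) where
  smul s f := (⟨{ toFun := fun v => s • f.1 v
                  map_add' := fun v w => by rw [map_add, smul_add]
                  map_smul' := fun c v => by
                    rw [map_smul, banach_smul_comm, RingHom.id_apply] }, fun g v => by
      change s • f.1 (ρV g v) = banachRep O R K N L m g (s • f.1 v)
      rw [f.2 g v, banachRep_smul]⟩ : homBanachSubgroup O R K N L m ρV)
  one_smul f := Subtype.ext <| LinearMap.ext fun v => one_smul S (f.1 v)
  mul_smul r s f := Subtype.ext <| LinearMap.ext fun v => mul_smul r s (f.1 v)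
  smul_zero s := Subtype.ext <| LinearMap.ext fun _ => smul_zero s
  smul_add s f f' := Subtype.ext <| LinearMap.ext fun v => smul_add s (f.1 v) (f'.1 v)
  add_smul r s f := Subtype.ext <| LinearMap.ext fun v => add_smul r s (f.1 v)
  zero_smul f := Subtype.ext <| LinearMap.ext fun v => zero_smul S (f.1 v)

end Banach

end Formalism

/-! ## Commutative algebra -/

section Points

variable {A : Type u} [CommRing A] (n : MaximalSpectrum A)

/-- The residue field `κ(n)`. -/
abbrev Kappa : Type u := n.asIdeal.ResidueField

/-- The ring `A_n/n²`, where `A_n` is the localization of `A` at `n`. -/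
abbrev ModSq : Type u :=
  Localization.AtPrime n.asIdeal ⧸
    IsLocalRing.maximalIdeal (Localization.AtPrime n.asIdeal) ^ 2

/-- The reduction map `A_n/n² → κ(n)`. -/
def modSqToKappa : ModSq n →+* Kappa n :=
  Ideal.Quotient.lift _ (IsLocalRing.residue (Localization.AtPrime n.asIdeal)) fun a ha => by
    rw [IsLocalRing.residue_eq_zero_iff]
    exact Ideal.pow_le_self two_ne_zero ha

end Points

/-- The dimension over the field `F` of an `S`-module `H`, where `F` acts on `H` through a ring
homomorphism `F → S`. -/
def dimAlong {F S : Type*} (H : Type*) [Field F] [CommRing S] [AddCommGroup H] [Module S H]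
    (s : F →+* S) : ℕ∞ :=
  letI : Module F H := Module.compHom H s
  Cardinal.toENat (Module.rank F H)

/-- A ring is equidimensional if all its irreducible components have the same dimension. -/
def IsEquidimensional (A : Type*) [CommRing A] : Prop :=
  ∀ q ∈ minimalPrimes A, ringKrullDim (A ⧸ q) = ringKrullDim A

/-- The group of `e`-dimensional cycles of `R`: the free abelian group on the prime ideals `q` of
`R` with `dim R/q = e`. -/
abbrev Cycles (R : Type*) [CommRing R] (e : WithBot ℕ∞) : Type _ :=
  {q : PrimeSpectrum R // ringKrullDim (R ⧸ q.asIdeal) = e} →₀ ℤ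

/-- The `e`-dimensional cycle `z_e(M) = ∑ ℓ(M_q) q` of a finitely generated `R`-module `M` of
dimension at most `e`. For such `M` all the lengths are finite and only finitely many are
non-zero. -/
def cycle {R : Type*} [CommRing R] (e : WithBot ℕ∞) (M : Type*) [AddCommGroup M] [Module R M] :
    Cycles R e :=
  ∑ᶠ q : {q : PrimeSpectrum R // ringKrullDim (R ⧸ q.asIdeal) = e},
    Finsupp.single q ((Module.length (Localization.AtPrime q.1.asIdeal)
      (LocalizedModule q.1.asIdeal.primeCompl M)).toNat : ℤ)

/-- The representation of `K` on a `K`-stable lattice `Θ` of `V`. -/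
def latticeRep {O L K V : Type*} [CommRing O] [CommRing L] [Algebra O L] [Group K]
    [AddCommGroup V] [Module O V] [Module L V] [IsScalarTower O L V] (ρ : Representation L K V)
    (Θ : Submodule O V) (hΘ : ∀ g, ∀ x ∈ Θ, ρ g x ∈ Θ) : Representation O K Θ where
  toFun g := ((ρ g).restrictScalars O).restrict (hΘ g)
  map_one' := LinearMap.ext fun x => Subtype.ext <| LinearMap.congr_fun (map_one ρ) (x : V)
  map_mul' g h := LinearMap.ext fun x => Subtype.ext <| LinearMap.congr_fun (map_mul ρ g h) (x : V)

/-- The reduction modulo `ϖ` of a representation over `O`. -/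
def reduction {O K Θ : Type*} [CommRing O] [Group K] [AddCommGroup Θ] [Module O Θ]
    (ρ : Representation O K Θ) (ϖ : O) :
    Representation O K (Θ ⧸ (Ideal.span {ϖ} • ⊤ : Submodule O Θ)) :=
  ρ.quotient _ fun g => by
    rw [← Submodule.map_le_iff_le_comap, Submodule.map_smul'']
    exact Submodule.smul_mono le_rfl le_top

end BreuilMezard

end

open BreuilMezard

namespace BreuilMezard

/-! ## Commutative algebra -/

/-! ### Nakayama's lemma over adically complete rings. -/

section CompleteNakayama

variable {B X : Type*} [CommRing B] [AddCommGroup X] [Module B X] (I : Ideal B)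

/-! Let H be the group of continuous equivariant maps from N to the dual lattice, so that M(Θ) is
the O-dual of H, and let 𝔪 be the maximal ideal of R. What is needed about H is recorded in
`IsAdmissible`: it is ϖ-torsion free, ϖ-adic series converge in it, the powers of 𝔪 act on each
element by operators tending to zero, and the part of H/ϖH killed by 𝔪 is finite. Compactness and
finite generation of N give this (`isAdmissible_homCont`). Duality then shows that M(Θ) is finitely
generated over R (`IsAdmissible.finite`) and that every 𝔪-adically continuous functional on it is
evaluation at an element of H (`IsAdmissible.exists_eq_apply`).

The second fact yields the comparison with Banach space representations: for the modules m attached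
to a point n, the linear dual of m ⊗ M(Θ) embeds into Hom_K(V, Π(m))
(`rank_tensor_le_rank_homBanach`); only this inequality is needed. Taking m = κ(n) and m = R_n/n²,
condition (c) says that M(Θ)_n is cyclic, say R_n/I, and that R_n/I modulo the square of its maximal
ideal has length at most d. So the embedding dimension of R_n/I is at most d - 1. Let P be a minimal
prime of 𝔞 contained in the prime q of R below n. Then q/P has height at least d - 1
(`le_height_map_quotientMk`): R/P is finite over a power series ring over O in d - 1 parameters
taken from q, the prime q contracts to the ideal of the variables, and going-down holds because
power series rings over O are normal. Hence R_n/I is regular, so a domain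
(`isDomain_of_length_quotient_sq_le`), and I = P R_n (`exists_generic_generator`).

By density every minimal prime of 𝔞 lies below a point, and by equidimensionality the count above
applies to all of them. Thus R/𝔞 is generically reduced and M(Θ) is generically cyclic over it; the
absence of embedded primes upgrades this to reducedness (`isReduced_of_generic`).

For the cycles, the local generators are glued to one element generating a copy T of R/𝔞 in M(Θ)
whose cokernel vanishes at all minimal primes (`exists_generator_of_generic`). Computing the length
of M(Θ)/ϖT in two ways shows that R/(ϖ, 𝔞) and M(Θ)/ϖM(Θ) have the same cycle
(`localLength_quotient_eq`). Projectivity of N identifies the latter module with M(Θ/ϖΘ)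
(`exists_mLattice_mSmooth`) and makes M(·) exact on finite smooth representations killed by ϖ
(`exists_exact_mSmooth`). A composition series of Θ/ϖΘ then gives the stated sum
(`cycle_mSmooth_eq`). -/

theorem isPrecomplete_pi {ι : Type*} [Finite ι] [IsPrecomplete I B] : IsPrecomplete I (ι → B) := by
  classical
  have := Fintype.ofFinite ι
  have key : ∀ (n : ℕ) (y : ι → B), y ∈ (I ^ n • ⊤ : Submodule B (ι → B)) ↔ ∀ i, y i ∈ I ^ n := by
    intro n y
    refine ⟨fun hy i => ?_, fun hy => ?_⟩
    · refine Submodule.smul_induction_on hy (fun r hr z _ => ?_) fun a b ha hb => ?_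
      · exact Ideal.mul_mem_right _ _ hr
      · exact Ideal.add_mem _ ha hb
    · have h : y = ∑ i, y i • (Pi.single i 1 : ι → B) := by
        ext j
        simp [Finset.sum_apply, Pi.single_apply]
      rw [h]
      exact Submodule.sum_mem _ fun i _ => Submodule.smul_mem_smul (hy i) Submodule.mem_top
  refine ⟨fun f hf => ?_⟩
  have h : ∀ i, ∃ l : B, ∀ n, f n i ≡ l [SMOD (I ^ n • ⊤ : Submodule B B)] := fun i =>
    IsPrecomplete.prec' (I := I) (fun n => f n i) fun {m n} hmn => by
      have h1 := hf hmn
      rw [SModEq.sub_mem] at h1 ⊢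
      simpa using (key _ _).1 h1 i
  choose l hl using h
  refine ⟨l, fun n => ?_⟩
  rw [SModEq.sub_mem, key]
  intro i
  have h1 := hl i n
  rw [SModEq.sub_mem] at h1
  simpa using h1

/-- A separated module over an adically complete ring that is finitely generated modulo the ideal
is finitely generated. -/
theorem finite_of_finite_quotient_of_isHausdorff [IsPrecomplete I B] [IsHausdorff I X]
    (h : Module.Finite B (X ⧸ (I • ⊤ : Submodule B X))) : Module.Finite B X := by
  obtain ⟨n, f, hf⟩ := Module.Finite.exists_fin' B (X ⧸ (I • ⊤ : Submodule B X))
  -- A presentation of the quotient lifts to a map from a free module; completeness of the source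
  -- and separatedness of the target make it surjective by successive approximation.
  obtain ⟨g, hg⟩ := Module.projective_lifting_property (Submodule.mkQ (I • ⊤ : Submodule B X)) f
    (Submodule.mkQ_surjective _)
  have := isPrecomplete_pi I (ι := Fin n)
  exact Module.Finite.of_surjective g
    (surjective_of_mkQ_comp_surjective (I := I) (by rw [hg]; exact hf))

end CompleteNakayama

/-! ### Regular local rings are domains. -/

section RegularDomain

open IsLocalRing

/-- The class of x is a nonzero element of the kernel of C/𝔪² → (C/x)/𝔪², so dividing by x costs at
least one unit of length. -/
theorem length_quotient_sq_quotient_add_one_le {C : Type u} [CommRing C] [IsLocalRing C]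
    {x : C} (hx2 : x ∉ maximalIdeal C ^ 2)
    [IsLocalRing (C ⧸ Ideal.span {x})] :
    Module.length (C ⧸ Ideal.span {x}) ((C ⧸ Ideal.span {x}) ⧸
      maximalIdeal (C ⧸ Ideal.span {x}) ^ 2) + 1 ≤ Module.length C (C ⧸ maximalIdeal C ^ 2) := by
  set I := Ideal.span {x}
  set f : C ⧸ maximalIdeal C ^ 2 →ₗ[C] (C ⧸ I) ⧸ maximalIdeal (C ⧸ I) ^ 2 :=
    Submodule.liftQ _ ((Submodule.mkQ (maximalIdeal (C ⧸ I) ^ 2)).restrictScalars C ∘ₗ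
      Submodule.mkQ I) (by
      intro y hy
      simp only [LinearMap.mem_ker, LinearMap.comp_apply, LinearMap.coe_restrictScalars,
        Submodule.mkQ_apply, Submodule.Quotient.mk_eq_zero]
      have : maximalIdeal C ≤ (maximalIdeal (C ⧸ I)).comap (Ideal.Quotient.mk I) :=
        ((local_hom_TFAE (Ideal.Quotient.mk I)).out 0 3).1
          (IsLocalHom.of_surjective _ Ideal.Quotient.mk_surjective)
      exact (Ideal.pow_right_mono this 2).trans (Ideal.le_comap_pow _ 2) hy)
  have hf : Function.Surjective f := by
    intro y
    obtain ⟨y, rfl⟩ := Submodule.mkQ_surjective _ y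
    obtain ⟨y, rfl⟩ := Submodule.mkQ_surjective _ y
    exact ⟨Submodule.Quotient.mk y, rfl⟩
  rw [← Module.length_eq_of_surjective (S := C) (R := C ⧸ I) Ideal.Quotient.mk_surjective]
  rw [Module.length_eq_add_of_exact (LinearMap.ker f).subtype f (Submodule.subtype_injective _) hf
    (LinearMap.exact_subtype_ker_map f), add_comm]
  gcongr
  rw [Order.one_le_iff_pos, Module.length_pos_iff]
  refine ⟨⟨⟨Submodule.Quotient.mk x, ?_⟩, 0, ?_⟩⟩
  · have : (Submodule.Quotient.mk x : C ⧸ I) = 0 :=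
      (Submodule.Quotient.mk_eq_zero _).2 (Ideal.mem_span_singleton_self x)
    exact congrArg (Submodule.mkQ (maximalIdeal (C ⧸ I) ^ 2)) this
  · simpa [Subtype.ext_iff, Ideal.Quotient.eq_zero_iff_mem] using hx2

/-- The two bounds say that the embedding dimension does not exceed the dimension, that is, that C
is regular. Take x in 𝔪 outside 𝔪² and outside all minimal primes. By induction C/x is a domain, so
(x) is prime and contains a minimal prime P; since x ∉ P one has P = xP, and P = 0 by Nakayama. -/
theorem isDomain_of_length_quotient_sq_le (n : ℕ) : ∀ (C : Type u) [CommRing C] [IsLocalRing C]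
    [IsNoetherianRing C], Module.length C (C ⧸ maximalIdeal C ^ 2) ≤ n + 1 →
    (n : WithBot ℕ∞) ≤ ringKrullDim C → IsDomain C := by
  induction n with
  | zero => 
    intro C _ _ _ h _
    have h0 : maximalIdeal C = ⊥ := by
      refine Submodule.eq_bot_of_le_smul_of_le_jacobson_bot (maximalIdeal C) _
        (IsNoetherian.noetherian _) ?_ (maximalIdeal_le_jacobson _)
      intro x hx
      by_contra hx2
      rw [smul_eq_mul, ← sq] at hx2
      have : Nontrivial (C ⧸ Ideal.span {x}) := by
        rw [Ideal.Quotient.nontrivial_iff]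
        intro h1
        exact (Ideal.span_singleton_eq_top.not.2 hx) h1
      have : IsLocalRing (C ⧸ Ideal.span {x}) := .of_surjective' _ Ideal.Quotient.mk_surjective
      have h1 := (length_quotient_sq_quotient_add_one_le hx2).trans h
      rw [Nat.cast_zero, ENat.add_le_add_iff_right ENat.one_ne_top, nonpos_iff_eq_zero,
        Module.length_eq_zero_iff, Ideal.Quotient.subsingleton_iff] at h1
      exact (maximalIdeal (C ⧸ Ideal.span {x})).ne_top_iff_one.1 Ideal.IsPrime.ne_top'
        (Ideal.pow_le_self two_ne_zero (h1 ▸ trivial))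
    exact @IsDomain.of_bot_isPrime C _ (h0 ▸ inferInstance)
  | succ n ih =>
    intro C _ _ _ h hn
    obtain ⟨x, hx, hx2, hxP⟩ : ∃ x ∈ maximalIdeal C, x ∉ maximalIdeal C ^ 2 ∧ 
        ∀ P ∈ minimalPrimes C, x ∉ P := by
      by_contra! hcon
      have hfin := minimalPrimes.finite_of_isNoetherianRing C
      have hsub : (maximalIdeal C : Set C) ⊆ ⋃ P ∈ ((insert (maximalIdeal C ^ 2)
          hfin.toFinset : Finset (Ideal C)) : Set (Ideal C)), (P : Set C) := by
        intro x hx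
        by_cases hx2 : x ∈ maximalIdeal C ^ 2
        · exact Set.mem_biUnion (by simp) hx2
        · obtain ⟨P, hP, hxP⟩ := hcon x hx hx2
          exact Set.mem_biUnion (by simp [hP]) hxP
      -- Prime avoidance tolerates two non-prime members; both slots are given to 𝔪².
      obtain ⟨P, hP, hle⟩ := (Ideal.subset_union_prime (f := id) (maximalIdeal C ^ 2)
        (maximalIdeal C ^ 2) (by
          intro P hP hne _
          simp only [Finset.mem_insert, hne, Set.Finite.mem_toFinset, false_or] at hP
          exact hP.1.1)).1 hsub
      -- Either 𝔪 = 𝔪², hence 𝔪 = 0, or 𝔪 lies in a minimal prime. In both cases the dimension would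
      -- be zero.
      have hmin : maximalIdeal C ∈ minimalPrimes C := by
        rcases Finset.mem_insert.1 hP with rfl | hP
        · have h0 : maximalIdeal C = ⊥ :=
            Submodule.eq_bot_of_le_smul_of_le_jacobson_bot (maximalIdeal C) _
              (IsNoetherian.noetherian _) (by rw [smul_eq_mul, ← sq]; exact hle)
              (maximalIdeal_le_jacobson _)
          refine ⟨⟨inferInstance, bot_le⟩, fun Q _ _ => ?_⟩
          rw [h0]; exact bot_le
        · rw [Set.Finite.mem_toFinset] at hP
          have := hP.1.1
          rwa [le_antisymm hle (le_maximalIdeal hP.1.1.ne_top)]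
      have h1 := maximalIdeal_height_eq_ringKrullDim (R := C)
      rw [Ideal.height_eq_zero_iff.2 hmin] at h1
      rw [← h1] at hn
      exact absurd hn (by norm_cast)
    have : Nontrivial (C ⧸ Ideal.span {x}) := by
      rw [Ideal.Quotient.nontrivial_iff]
      intro h1
      exact (Ideal.span_singleton_eq_top.not.2 hx) h1
    have : IsLocalRing (C ⧸ Ideal.span {x}) := .of_surjective' _ Ideal.Quotient.mk_surjective
    have h1 : IsDomain (C ⧸ Ideal.span {x}) := by
      refine ih _ ((ENat.add_le_add_iff_right ENat.one_ne_top).1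
        ((length_quotient_sq_quotient_add_one_le hx2).trans (by exact_mod_cast h))) ?_
      have h2 := ringKrullDim_le_ringKrullDim_quotient_add_card (R := C) {x}
        (by simpa [ringJacobson_eq_maximalIdeal] using hx)
      have h3 := hn.trans h2
      rw [Finset.coe_singleton, Finset.card_singleton, Nat.cast_add, Nat.cast_one] at h3
      exact ENat.WithBot.add_le_add_one_right_iff.1 h3
    have hp : (Ideal.span {x}).IsPrime := (Ideal.Quotient.isDomain_iff_prime _).1 h1
    obtain ⟨P, hP, hPx⟩ := Ideal.exists_minimalPrimes_le (I := (⊥ : Ideal C)) (J := Ideal.span {x}) bot_le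
    have hPp : P.IsPrime := hP.1.1
    have hP0 : P = ⊥ := by
      refine Submodule.eq_bot_of_le_smul_of_le_jacobson_bot (Ideal.span {x}) P (IsNoetherian.noetherian P) ?_ ?_
      · intro y hy
        obtain ⟨z, rfl⟩ := Ideal.mem_span_singleton'.1 (hPx hy)
        have hz : z ∈ P := (hPp.mem_or_mem hy).resolve_right (hxP P hP)
        rw [mul_comm, ← smul_eq_mul]
        exact Submodule.smul_mem_smul (Ideal.mem_span_singleton_self x) hz
      · rw [Ideal.span_singleton_le_iff_mem]
        exact maximalIdeal_le_jacobson _ hx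
    subst hP0
    exact @IsDomain.of_bot_isPrime C _ hPp

end RegularDomain


/-! ### Power series over a normal noetherian domain are normal. -/

section PowerSeriesIntegrallyClosed

open PowerSeries nonZeroDivisors

variable {B F : Type*} [CommRing B] [IsDomain B] [Field F] [Algebra B F] [IsFractionRing B F]

/-- A power series t over the fraction field whose powers have a common denominator r has
coefficients in B. The constant coefficient is almost integral, hence in B; subtracting it and
dividing by X preserves the hypothesis, so the next coefficient can be treated. -/
theorem coeff_mem_range_of_forall_mul_pow_mem [IsNoetherianRing B] [IsIntegrallyClosed B]
    (n : ℕ) : ∀ (t : F⟦X⟧) (r : B⟦X⟧), r ≠ 0 →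
    (∀ n, ∃ h : B⟦X⟧, map (algebraMap B F) r * t ^ n = map (algebraMap B F) h) →
    coeff n t ∈ (algebraMap B F).range := by
  have hinj : Function.Injective (map (algebraMap B F)) := 
    map_injective _ (IsFractionRing.injective B F)
  have key : ∀ (t : F⟦X⟧) (r : B⟦X⟧), r ≠ 0 →
      (∀ n, ∃ h : B⟦X⟧, map (algebraMap B F) r * t ^ n = map (algebraMap B F) h) →
      constantCoeff t ∈ (algebraMap B F).range := by
    intro t r hr h
    -- With the power of X removed, the nonzero constant coefficient of r' is a common denominator
    -- for the powers of the constant coefficient of t, as the coefficient of X ^ k shows.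
    obtain ⟨k, r', hr', rfl⟩ : ∃ (k : ℕ) (r' : B⟦X⟧), constantCoeff r' ≠ 0 ∧ r = X ^ k * r' :=
      ⟨r.order.toNat, divXPowOrder r, constantCoeff_divXPowOrder_eq_zero_iff.not.2 hr,
        (X_pow_order_mul_divXPowOrder).symm⟩
    have h1 : IsAlmostIntegral B (constantCoeff t) := by
      refine ⟨constantCoeff r', mem_nonZeroDivisors_of_ne_zero hr', fun n => ?_⟩
      obtain ⟨g, hg⟩ := h n
      refine ⟨coeff k g, ?_⟩
      have := congrArg (coeff k) hg
      rw [map_mul (map (algebraMap B F)), map_pow (map (algebraMap B F)), map_X, mul_assoc, coeff_X_pow_mul', if_pos le_rfl, Nat.sub_self, 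
        coeff_zero_eq_constantCoeff_apply, map_mul, map_pow, coeff_map] at this
      rw [← this, Algebra.smul_def, ← coeff_zero_eq_constantCoeff_apply,
        ← coeff_zero_eq_constantCoeff_apply, ← coeff_zero_eq_constantCoeff_apply, coeff_map]
    exact IsIntegrallyClosed.isIntegral_iff.1 h1.isIntegral
  induction n with
  | zero => 
    intro t r hr h
    rw [coeff_zero_eq_constantCoeff_apply]
    exact key t r hr h
  | succ n ih =>
    intro t r hr h
    obtain ⟨b, hb⟩ := key t r hr h
    obtain ⟨t', ht'⟩ : ∃ t', t = X * t' + C (algebraMap B F b) := by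
      refine ⟨mk fun n => coeff (n + 1) t, ?_⟩
      rw [hb]
      exact eq_X_mul_shift_add_const t
    have hc : coeff (n + 1) t = coeff n t' := by
      rw [ht', map_add, coeff_succ_X_mul, coeff_C, if_neg (Nat.succ_ne_zero n), add_zero]
    rw [hc]
    refine ih t' r hr fun n => ?_
    -- Expand (X t')ⁿ = (t - b)ⁿ binomially; each term becomes integral after multiplication by r.
    have h2 : ∃ g : B⟦X⟧, X ^ n * (map (algebraMap B F) r * t' ^ n) = map (algebraMap B F) g := by
      choose w hw using h
      refine ⟨∑ m ∈ Finset.range (n + 1), w m * C (-b) ^ (n - m) * (n.choose m : B⟦X⟧), ?_⟩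
      have h3 : X * t' = t + C (algebraMap B F (-b)) := by rw [ht', map_neg, map_neg]; ring
      have h4 : X ^ n * (map (algebraMap B F) r * t' ^ n) =
          map (algebraMap B F) r * (X * t') ^ n := by ring
      rw [h4, h3, add_pow, Finset.mul_sum, map_sum]
      refine Finset.sum_congr rfl fun m _ => ?_
      rw [map_mul, map_mul, ← hw, map_pow, map_C, map_natCast]
      ring
    obtain ⟨g, hg⟩ := h2
    refine ⟨mk fun i => coeff (i + n) g, ?_⟩
    ext i
    have := congrArg (coeff (i + n)) hg
    rw [coeff_X_pow_mul] at this
    rw [this, coeff_map, coeff_map, coeff_mk]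

/-- This normality is what going-down needs. An integral fraction is almost integral, so it lies in
F⟦X⟧, which is integrally closed; the previous lemma then puts its coefficients in B. -/
instance isIntegrallyClosed_powerSeries [IsNoetherianRing B] [IsIntegrallyClosed B] :
    IsIntegrallyClosed B⟦X⟧ := by
  let F := FractionRing B
  have hinj : Function.Injective (map (algebraMap B F)) := 
    map_injective _ (IsFractionRing.injective B F)
  rw [isIntegrallyClosed_iff (FractionRing B⟦X⟧)]
  intro x hx
  obtain ⟨r, hr, hrx⟩ := hx.isAlmostIntegral
  obtain ⟨f, g, hg, rfl⟩ := IsFractionRing.div_surjective (A := B⟦X⟧) x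
  have hg0 : g ≠ 0 := nonZeroDivisors.ne_zero hg
  have hr0 : r ≠ 0 := nonZeroDivisors.ne_zero hr
  have h1 : ∀ n, ∃ h, r * f ^ n = g ^ n * h := by
    intro n
    obtain ⟨h, hh⟩ := hrx n
    refine ⟨h, IsFractionRing.injective B⟦X⟧ (FractionRing B⟦X⟧) ?_⟩
    have : algebraMap B⟦X⟧ (FractionRing B⟦X⟧) g ≠ 0 := by simpa using hg0
    rw [map_mul _ _ h, hh, Algebra.smul_def, map_mul, map_pow, map_pow, div_pow]
    field_simp
  have hgF : map (algebraMap B F) g ≠ 0 := by simpa using hinj.ne hg0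
  obtain ⟨t, ht⟩ : map (algebraMap B F) g ∣ map (algebraMap B F) f := by
    have h3 : algebraMap F⟦X⟧ (FractionRing F⟦X⟧) (map (algebraMap B F) g) ≠ 0 := by simpa using hgF
    have h2 : IsAlmostIntegral F⟦X⟧ (algebraMap F⟦X⟧ (FractionRing F⟦X⟧) (map (algebraMap B F) f) /
        algebraMap F⟦X⟧ (FractionRing F⟦X⟧) (map (algebraMap B F) g)) := by
      refine ⟨map (algebraMap B F) r, mem_nonZeroDivisors_of_ne_zero
        (by simpa using hinj.ne hr0), fun n => ?_⟩
      obtain ⟨h, hh⟩ := h1 n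
      refine ⟨map (algebraMap B F) h, ?_⟩
      rw [div_pow, Algebra.smul_def, ← mul_div_assoc, eq_div_iff (pow_ne_zero n h3), ← map_pow,
        ← map_pow, ← map_mul, ← map_mul, ← map_pow, ← map_pow, ← map_mul, ← map_mul, hh, mul_comm]
    obtain ⟨t, ht⟩ := IsIntegrallyClosed.isIntegral_iff.1 h2.isIntegral
    rw [eq_div_iff h3, ← map_mul] at ht
    exact ⟨t, by rw [mul_comm, IsFractionRing.injective _ _ ht]⟩
  have h2 : ∀ n, ∃ h : B⟦X⟧, map (algebraMap B F) r * t ^ n = map (algebraMap B F) h := by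
    intro n
    obtain ⟨h, hh⟩ := h1 n
    refine ⟨h, mul_left_cancel₀ (pow_ne_zero n hgF) ?_⟩
    rw [← map_pow, ← map_mul _ _ h, ← hh, map_mul, map_pow, map_pow, ht]
    ring
  choose c hc using fun n => coeff_mem_range_of_forall_mul_pow_mem n t r hr0 h2
  refine ⟨mk c, ?_⟩
  rw [eq_div_iff (by simpa using hg0), ← map_mul]
  congr 1
  apply hinj
  rw [map_mul, ht, mul_comm]
  congr 1
  ext n
  rw [coeff_map, coeff_mk, hc]

end PowerSeriesIntegrallyClosed


/-! ### Iterated power series rings mapping to a complete local ring. -/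

section Tower

open IsLocalRing PowerSeries

/-- With B discrete and R in its 𝔪-adic topology, x is topologically nilpotent, so series can be
evaluated at x. -/
theorem exists_powerSeries_eval {B R : Type*} [CommRing B] [CommRing R] [IsLocalRing R]
    [IsAdicComplete (maximalIdeal R) R] (φ : B →+* R) {x : R} (hx : x ∈ maximalIdeal R) :
    ∃ Φ : B⟦X⟧ →+* R, (∀ b, Φ (C b) = φ b) ∧ Φ X = x := by
  let : UniformSpace B := ⊥
  have : DiscreteTopology B := ⟨rfl⟩
  have : IsUniformAddGroup B := inferInstance
  let : WithIdeal R := ⟨maximalIdeal R⟩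
  have h : IsAdic (maximalIdeal R) := rfl
  obtain ⟨_, _⟩ := h.isAdicComplete_iff.1 inferInstance
  have hφ : Continuous φ := continuous_of_discreteTopology
  have hx' : HasEval x := WithIdeal.isTopologicallyNilpotent_of_mem hx
  refine ⟨eval₂Hom hφ hx', fun b => ?_, ?_⟩
  · rw [coe_eval₂Hom, eval₂_C]
  · rw [coe_eval₂Hom, eval₂_X]

/-- Chains of primes pull back along the constant coefficient, and their bottom then contains X, so
the zero ideal can be added below. -/
theorem height_add_one_le_height_comap_constantCoeff {B : Type*} [CommRing B] [IsDomain B]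
    (P : Ideal B) [P.IsPrime] :
    P.height + 1 ≤ (P.comap (constantCoeff (R := B))).height := by
  have key : ∀ (n : ℕ) (Q : Ideal B) [Q.IsPrime], (n : ℕ∞) ≤ Q.height →
      (n : ℕ∞) + 1 ≤ (Q.comap (constantCoeff (R := B))).height := by
    intro n
    induction n with
    | zero =>
      intro Q _ _
      have h : (⊥ : Ideal B⟦X⟧) < Q.comap (constantCoeff (R := B)) := by
        refine bot_lt_iff_ne_bot.2 fun h => X_ne_zero (R := B) ?_
        rw [← Ideal.mem_bot, ← h]
        simp
      exact le_trans (by gcongr; simp) (Ideal.height_add_one_le_of_lt_of_isPrime h)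
    | succ n ih =>
      intro Q _ hQ
      have h1 : ¬ Q.height ≤ n := fun h => absurd (hQ.trans h) (by norm_cast; simp)
      rw [Ideal.height_le_iff] at h1
      push Not at h1
      obtain ⟨Q', hQ', hlt, hle⟩ := h1
      have h2 : Q'.comap (constantCoeff (R := B)) < Q.comap (constantCoeff (R := B)) := by
        refine lt_of_le_of_ne (Ideal.comap_mono hlt.le) fun h => hlt.ne ?_
        exact Ideal.comap_injective_of_surjective _ constantCoeff_surj h
      refine le_trans ?_ (Ideal.height_add_one_le_of_lt_of_isPrime h2)
      push_cast
      gcongr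
      exact ih Q' hle
  refine ENat.forall_natCast_le_iff_le.1 fun m hm => ?_
  rcases m with _ | m
  · simp
  · push_cast at hm ⊢
    exact key m P ((ENat.add_le_add_iff_right ENat.one_ne_top).1 hm)

theorem ringKrullDim_powerSeries_le {B : Type*} [CommRing B] [IsNoetherianRing B] [IsLocalRing B] :
    ringKrullDim B⟦X⟧ ≤ ringKrullDim B + 1 := by
  have h2 := ringKrullDim_le_ringKrullDim_quotient_add_card (R := B⟦X⟧) {X}
    (by 
      simp [ringJacobson_eq_maximalIdeal, mem_maximalIdeal, isUnit_iff_constantCoeff])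
  rw [Finset.coe_singleton, Finset.card_singleton] at h2
  refine h2.trans ?_
  push_cast
  gcongr
  refine ringKrullDim_le_of_surjective
    ((Ideal.Quotient.mk (Ideal.span {(X : B⟦X⟧)})).comp (C (R := B))) fun y => ?_
  obtain ⟨y, rfl⟩ := Ideal.Quotient.mk_surjective y
  refine ⟨constantCoeff y, ?_⟩
  rw [RingHom.comp_apply, eq_comm, Ideal.Quotient.eq, Ideal.mem_span_singleton, X_dvd_iff]
  simp

/-- X acts on R/J through 𝔪, so R/J is X-adically separated; modulo X it is already finite over B,
and complete Nakayama applies. -/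
theorem finite_powerSeries_of_finite {B R : Type u} [CommRing B] [CommRing R] [IsLocalRing R]
    [IsNoetherianRing R] (φ : B →+* R) (Φ : B⟦X⟧ →+* R) (h : ∀ b, Φ (C b) = φ b)
    (hX : Φ X ∈ maximalIdeal R) (J : Ideal R)
    (hJ : ((Ideal.Quotient.mk (J ⊔ Ideal.span {Φ X})).comp φ).Finite) :
    ((Ideal.Quotient.mk J).comp Φ).Finite := by
  let : Algebra B⟦X⟧ R := Φ.toAlgebra
  let : Algebra B R := φ.toAlgebra
  have : IsScalarTower B B⟦X⟧ R := .of_algebraMap_eq fun b => (h b).symm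
  have hJ' : Module.Finite B (R ⧸ J ⊔ Ideal.span {Φ X}) := hJ
  change Module.Finite B⟦X⟧ (R ⧸ J)
  set I : Ideal B⟦X⟧ := Ideal.span {X}
  have hI : ∀ r ∈ I, Φ r ∈ maximalIdeal R := by
    intro r hr
    obtain ⟨s, rfl⟩ := Ideal.mem_span_singleton'.1 hr
    rw [map_mul]
    exact Ideal.mul_mem_left _ _ hX
  have hhaus : IsHausdorff I (R ⧸ J) := by
    refine ⟨fun y hy => IsHausdorff.haus (I := maximalIdeal R) inferInstance y fun n => ?_⟩
    have := hy n
    rw [SModEq.zero] at this ⊢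
    refine Submodule.smul_induction_on this (fun r hr z _ => ?_) fun a b ha hb =>
      Submodule.add_mem _ ha hb
    rw [← algebraMap_smul R r z]
    refine Submodule.smul_mem_smul ?_ Submodule.mem_top
    have h1 : I ≤ (maximalIdeal R).comap Φ := hI
    exact Ideal.le_comap_pow Φ n (Ideal.pow_right_mono h1 n hr)
  refine finite_of_finite_quotient_of_isHausdorff I ?_
  have h2 : Module.Finite B⟦X⟧ (R ⧸ J ⊔ Ideal.span {Φ X}) :=
    Module.Finite.of_restrictScalars_finite B _ _
  let g : R →ₗ[B⟦X⟧] (R ⧸ J) ⧸ (I • ⊤ : Submodule B⟦X⟧ (R ⧸ J)) :=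
    Submodule.mkQ _ ∘ₗ (Ideal.Quotient.mkₐ B⟦X⟧ J).toLinearMap
  have hg : ((J ⊔ Ideal.span {Φ X}).restrictScalars B⟦X⟧) ≤ LinearMap.ker g := by
    intro y hy
    obtain ⟨a, ha, b, hb, rfl⟩ := Submodule.mem_sup.1 (show y ∈ J ⊔ Ideal.span {Φ X} from hy)
    obtain ⟨c, rfl⟩ := Ideal.mem_span_singleton'.1 hb
    have h3 : (Ideal.Quotient.mk J) (a + c * Φ X) = (X : B⟦X⟧) • (Ideal.Quotient.mk J c) := by
      rw [map_add, Ideal.Quotient.eq_zero_iff_mem.2 ha, zero_add, Algebra.smul_def, mul_comm]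
      rfl
    change (Submodule.Quotient.mk (Ideal.Quotient.mk J (a + c * Φ X)) : (R ⧸ J) ⧸ _) = 0
    rw [h3, Submodule.Quotient.mk_eq_zero]
    exact Submodule.smul_mem_smul (Ideal.mem_span_singleton_self X) Submodule.mem_top
  refine Module.Finite.of_surjective
    (Submodule.liftQ _ g hg ∘ₗ (Submodule.Quotient.restrictScalarsEquiv B⟦X⟧ _).symm.toLinearMap) ?_
  intro y
  obtain ⟨y, rfl⟩ := Submodule.Quotient.mk_surjective _ y
  obtain ⟨y, rfl⟩ := Ideal.Quotient.mk_surjective y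
  exact ⟨Ideal.Quotient.mk _ y, rfl⟩

/-- Here B is O⟦X₁, …, X_k⟧, with one variable adjoined for each member of the list, and P is the
ideal of the variables. The induction carries exactly what Noether normalization and going-down use:
normality, the height of P, the dimension bound, the fact that O surjects onto B/P, and finiteness.
-/
theorem exists_powerSeries_tower {O R : Type u} [CommRing O] [IsDomain O] [IsNoetherianRing O]
    [IsIntegrallyClosed O] [IsLocalRing O] [CommRing R] [IsLocalRing R] [IsNoetherianRing R]
    [IsAdicComplete (maximalIdeal R) R] (ψ : O →+* R) (l : List R) :
    (∀ x ∈ l, x ∈ maximalIdeal R) →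
    ∃ (B : Type u) (_ : CommRing B) (_ : IsDomain B) (_ : IsNoetherianRing B)
      (_ : IsIntegrallyClosed B) (_ : IsLocalRing B) (φ : B →+* R) (ι : O →+* B) (P : Ideal B),
      P.IsPrime ∧ l.length ≤ P.height ∧ ringKrullDim B ≤ ringKrullDim O + l.length ∧
      φ.comp ι = ψ ∧ (∀ b, ∃ a, b - ι a ∈ P) ∧ P.map φ ≤ Ideal.ofList l ∧
      ∀ J : Ideal R, ((Ideal.Quotient.mk (J ⊔ Ideal.ofList l)).comp ψ).Finite →
        ((Ideal.Quotient.mk J).comp φ).Finite := by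
  induction l with
  | nil =>
    intro _
    refine ⟨O, inferInstance, inferInstance, inferInstance, inferInstance, inferInstance, ψ,
      RingHom.id O, ⊥, Ideal.isPrime_bot, by simp, by simp, rfl, fun b => ⟨b, by simp⟩, by simp, ?_⟩
    intro J hJ
    rwa [Ideal.ofList_nil, sup_bot_eq] at hJ
  | cons x l ih =>
    intro hl
    obtain ⟨B, _, _, _, _, _, φ, ι, P, hP, hht, hdim, hφ, hι, hPφ, hfin⟩ :=
      ih fun y hy => hl y (List.mem_cons_of_mem _ hy)
    obtain ⟨Φ, hΦC, hΦX⟩ := exists_powerSeries_eval φ (hl x List.mem_cons_self)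
    refine ⟨B⟦X⟧, inferInstance, inferInstance, inferInstance, inferInstance, inferInstance, Φ,
      (C (R := B)).comp ι, P.comap (constantCoeff (R := B)), inferInstance, ?_, ?_, ?_, ?_, ?_, ?_⟩
    · refine le_trans ?_ (height_add_one_le_height_comap_constantCoeff P)
      rw [List.length_cons, Nat.cast_add, Nat.cast_one]
      gcongr
    · refine ringKrullDim_powerSeries_le.trans ?_
      rw [List.length_cons, Nat.cast_add, Nat.cast_one, ← add_assoc]
      gcongr
    · rw [← hφ]
      ext a
      simp [hΦC]
    · intro b
      obtain ⟨a, ha⟩ := hι (constantCoeff b)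
      exact ⟨a, by simpa using ha⟩
    · rw [Ideal.map_le_iff_le_comap]
      intro b hb
      rw [eq_X_mul_shift_add_const b, Ideal.mem_comap, map_add, map_mul, hΦC, hΦX,
        Ideal.ofList_cons]
      exact Ideal.add_mem _ (Ideal.mul_mem_right _ _ (Ideal.mem_sup_left
        (Ideal.mem_span_singleton_self x))) (Ideal.mem_sup_right (hPφ (Ideal.mem_map_of_mem φ hb)))
    · intro J hJ
      refine finite_powerSeries_of_finite φ Φ hΦC (hΦX ▸ hl x List.mem_cons_self) J ?_
      rw [hΦX]
      apply hfin
      rwa [sup_assoc, ← Ideal.ofList_cons]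

end Tower


/-! ### One-dimensional quotients of R are finite over O. -/

section FiniteOverDVR

open IsLocalRing

variable {O R : Type u} [CommRing O] [CommRing R] [IsLocalRing R] [Algebra O R]

/-- A simple R-module is the residue field of R, which is a quotient of O. -/
theorem finite_of_isFiniteLength (hk : Function.Surjective ((residue R).comp (algebraMap O R)))
    {X : Type*} [AddCommGroup X] [Module R X] (hX : IsFiniteLength R X) :
    ∀ [Module O X] [IsScalarTower O R X], Module.Finite O X := by
  induction hX with
  | of_subsingleton => intro _ _; infer_instance
  | @of_simple_quotient M _ _ N hs _ ih =>
    intro _ _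
    have h1 : Module.Finite O N := ih
    have h2 : Module.Finite O (M ⧸ N) := by
      obtain ⟨I, hI, ⟨e⟩⟩ := isSimpleModule_iff_quot_maximal.1 hs
      obtain rfl := eq_maximalIdeal hI
      have h3 : Module.Finite O (R ⧸ maximalIdeal R) :=
        Module.Finite.of_surjective (Algebra.linearMap O (R ⧸ maximalIdeal R)) hk
      exact Module.Finite.equiv (e.symm.restrictScalars O)
    have h3 : Module.Finite O (N.restrictScalars O) := h1
    have h4 : Module.Finite O (M ⧸ N.restrictScalars O) :=
      Module.Finite.equiv (Submodule.Quotient.restrictScalarsEquiv O N).symm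
    exact Module.Finite.of_submodule_quotient (N.restrictScalars O)

theorem isFiniteLength_quotient [IsNoetherianRing R] (I : Ideal R) 
    (h : ∀ Q : Ideal R, Q.IsPrime → I ≤ Q → Q = maximalIdeal R) : IsFiniteLength R (R ⧸ I) := by
  have : Ring.KrullDimLE 0 (R ⧸ I) := Ring.krullDimLE_zero_iff.mpr fun Q hQ => by
    have h1 := h (Q.comap (Ideal.Quotient.mk I)) inferInstance 
      (by rw [← Ideal.map_le_iff_le_comap]; simp)
    have : (Q.comap (Ideal.Quotient.mk I)).IsMaximal := h1 ▸ inferInstance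
    exact Ideal.map_comap_of_surjective _ Ideal.Quotient.mk_surjective Q ▸ 
      (Ideal.map_eq_top_or_isMaximal_of_surjective _ Ideal.Quotient.mk_surjective this).resolve_left (by
        rw [Ideal.map_comap_of_surjective _ Ideal.Quotient.mk_surjective Q]; exact hQ.ne_top)
  have h2 : IsArtinianRing (R ⧸ I) :=
    isArtinianRing_iff_isNoetherianRing_krullDimLE_zero.2 ⟨inferInstance, this⟩
  rw [isFiniteLength_iff_isNoetherian_isArtinian]
  exact ⟨inferInstance, (isArtinian_of_surjective_algebraMap (S := R) (R := R ⧸ I) Ideal.Quotient.mk_surjective)⟩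

/-- The hypothesis makes R/(I, ϖ) of finite length, so finite over O. As ϖ lies in 𝔪, R/I is
ϖ-adically separated, and finiteness lifts from the reduction modulo ϖ. -/
theorem finite_quotient_of_forall_isPrime [IsNoetherianRing R]
    (hk : Function.Surjective ((residue R).comp (algebraMap O R))) (ϖ : O)
    [IsPrecomplete (Ideal.span {ϖ}) O]
    (hϖ : algebraMap O R ϖ ∈ maximalIdeal R) (I : Ideal R)
    (h : ∀ Q : Ideal R, Q.IsPrime → I ≤ Q → algebraMap O R ϖ ∈ Q → Q = maximalIdeal R) :
    Module.Finite O (R ⧸ I) := by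
  have hhaus : IsHausdorff (Ideal.span {ϖ}) (R ⧸ I) := by
    refine ⟨fun y hy => IsHausdorff.haus (I := maximalIdeal R) inferInstance y fun n => ?_⟩
    have := hy n
    rw [SModEq.zero] at this ⊢
    refine Submodule.smul_induction_on this (fun r hr z _ => ?_) fun a b ha hb =>
      Submodule.add_mem _ ha hb
    rw [← algebraMap_smul R r z]
    refine Submodule.smul_mem_smul ?_ Submodule.mem_top
    have h1 : Ideal.span {ϖ} ≤ (maximalIdeal R).comap (algebraMap O R) := by
      rwa [Ideal.span_singleton_le_iff_mem]
    exact Ideal.le_comap_pow _ n (Ideal.pow_right_mono h1 n hr)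
  refine finite_of_finite_quotient_of_isHausdorff (Ideal.span {ϖ}) ?_
  have h2 := finite_of_isFiniteLength (O := O) hk
    (isFiniteLength_quotient (I ⊔ Ideal.span {algebraMap O R ϖ}) fun Q hQ hle => 
      h Q hQ (le_sup_left.trans hle) (hle (Ideal.mem_sup_right (Ideal.mem_span_singleton_self _))))
  let g : R →ₗ[O] (R ⧸ I) ⧸ (Ideal.span {ϖ} • ⊤ : Submodule O (R ⧸ I)) :=
    Submodule.mkQ _ ∘ₗ (Ideal.Quotient.mkₐ O I).toLinearMap
  have hg : ((I ⊔ Ideal.span {algebraMap O R ϖ}).restrictScalars O) ≤ LinearMap.ker g := by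
    intro y hy
    obtain ⟨a, ha, b, hb, rfl⟩ := Submodule.mem_sup.1
      (show y ∈ I ⊔ Ideal.span {algebraMap O R ϖ} from hy)
    obtain ⟨c, rfl⟩ := Ideal.mem_span_singleton'.1 hb
    have h3 : (Ideal.Quotient.mk I) (a + c * algebraMap O R ϖ) = ϖ • (Ideal.Quotient.mk I c) := by
      rw [map_add, Ideal.Quotient.eq_zero_iff_mem.2 ha, zero_add, Algebra.smul_def, mul_comm,
        map_mul]
      rfl
    change (Submodule.Quotient.mk (Ideal.Quotient.mk I (a + c * algebraMap O R ϖ)) : 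
      (R ⧸ I) ⧸ _) = 0
    rw [h3, Submodule.Quotient.mk_eq_zero]
    exact Submodule.smul_mem_smul (Ideal.mem_span_singleton_self ϖ) Submodule.mem_top
  refine Module.Finite.of_surjective
    (Submodule.liftQ _ g hg ∘ₗ (Submodule.Quotient.restrictScalarsEquiv O _).symm.toLinearMap) ?_
  intro y
  obtain ⟨y, rfl⟩ := Submodule.Quotient.mk_surjective _ y
  obtain ⟨y, rfl⟩ := Ideal.Quotient.mk_surjective y
  exact ⟨Ideal.Quotient.mk _ y, rfl⟩

/-- If `q` is maximal among the primes not containing `a`, then the maximal ideal is the only prime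
containing `q` and `a`. -/
theorem eq_maximalIdeal_of_forall_lt_mem [IsNoetherianRing R] {a : R} {q : Ideal R} [q.IsPrime] 
    (haq : a ∉ q) (h : ∀ Q : Ideal R, Q.IsPrime → q < Q → a ∈ Q) (Q : Ideal R)
    (hQ : Q.IsPrime) (hqQ : q ≤ Q) (haQ : a ∈ Q) : Q = maximalIdeal R := by
  by_contra hne
  set I := q ⊔ Ideal.span {a}
  have hfin := I.finite_minimalPrimes_of_isNoetherianRing
  -- Prime avoidance: otherwise 𝔪 would be contained in a minimal prime of I, which would force Q =
  -- 𝔪.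
  obtain ⟨y, hy, hyP⟩ : ∃ y ∈ maximalIdeal R, ∀ P ∈ I.minimalPrimes, y ∉ P := by
    by_contra! hcon
    obtain ⟨P, hP, hle⟩ := (Ideal.subset_union_prime (s := hfin.toFinset) (f := id) (I := maximalIdeal R) ⊥ ⊥ (by
          intro P hP _ _
          rw [Set.Finite.mem_toFinset] at hP
          exact hP.1.1)).1 (by
        intro x hx
        obtain ⟨P, hP, hxP⟩ := hcon x hx
        exact Set.mem_biUnion (by simpa using hP) hxP)
    rw [Set.Finite.mem_toFinset] at hP
    have hQI : I ≤ Q := sup_le hqQ ((Ideal.span_singleton_le_iff_mem _).2 haQ)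
    have h1 := hP.2 ⟨hQ, hQI⟩ ((le_maximalIdeal hQ.ne_top).trans hle)
    exact hne (le_antisymm (le_maximalIdeal hQ.ne_top) (hle.trans h1))
  -- By Krull, Q' has height at most one modulo q. But Q' properly contains q, hence contains a and
  -- so a minimal prime P₁ of I; as y ∉ P₁, the chain q < P₁ < Q' is strict.
  obtain ⟨Q', hQ'⟩ := (q ⊔ Ideal.span {y}).nonempty_minimalPrimes (by
    intro htop
    have : q ⊔ Ideal.span {y} ≤ maximalIdeal R := 
      sup_le (le_maximalIdeal (Ideal.IsPrime.ne_top ‹_›)) ((Ideal.span_singleton_le_iff_mem _).2 hy)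
    exact (maximalIdeal.isMaximal R).ne_top (top_le_iff.1 (htop ▸ this)))
  have hQ'p := hQ'.1.1
  have hyQ' : y ∈ Q' := hQ'.1.2 (Ideal.mem_sup_right (Ideal.mem_span_singleton_self y))
  have hqQ' : q ≤ Q' := le_sup_left.trans hQ'.1.2
  have hht := Ideal.map_height_le_one_of_mem_minimalPrimes hQ'
  obtain ⟨P₀, hP₀, hP₀Q⟩ := Ideal.exists_minimalPrimes_le (I := I) (J := Q) 
    (sup_le hqQ ((Ideal.span_singleton_le_iff_mem _).2 haQ))
  have hlt : q < Q' := lt_of_le_of_ne hqQ' (by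
    rintro rfl
    exact hyP P₀ hP₀ (hP₀.1.2 (Ideal.mem_sup_left hyQ')))
  obtain ⟨P₁, hP₁, hP₁Q⟩ := Ideal.exists_minimalPrimes_le (I := I) (J := Q') 
    (sup_le hqQ' ((Ideal.span_singleton_le_iff_mem _).2 (h Q' hQ'p hlt)))
  have hP₁p := hP₁.1.1
  have hqP₁ : q ≤ P₁ := le_sup_left.trans hP₁.1.2
  have haP₁ : a ∈ P₁ := hP₁.1.2 (Ideal.mem_sup_right (Ideal.mem_span_singleton_self a))
  have mapprime : ∀ P : Ideal R, P.IsPrime → q ≤ P → (P.map (Ideal.Quotient.mk q)).IsPrime := 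
    fun P hP hle => Ideal.map_isPrime_of_surjective Ideal.Quotient.mk_surjective (by simpa using hle)
  have maplt : ∀ P P' : Ideal R, q ≤ P → q ≤ P' → P < P' → 
      P.map (Ideal.Quotient.mk q) < P'.map (Ideal.Quotient.mk q) := by
    intro P P' hP hP' hlt
    refine lt_of_le_of_ne (Ideal.map_mono hlt.le) fun heq => hlt.ne ?_
    have := congrArg (Ideal.comap (Ideal.Quotient.mk q)) heq
    rwa [Ideal.comap_map_mk hP, Ideal.comap_map_mk hP'] at this
  have := mapprime q inferInstance le_rfl
  have := mapprime P₁ hP₁p hqP₁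
  have := mapprime Q' hQ'p hqQ'
  have h1 := Ideal.height_add_one_le_of_lt_of_isPrime (maplt q P₁ le_rfl hqP₁
    (lt_of_le_of_ne hqP₁ (by rintro rfl; exact haq haP₁)))
  have h2 := Ideal.height_add_one_le_of_lt_of_isPrime (maplt P₁ Q' hqP₁ hqQ'
    (lt_of_le_of_ne hP₁Q (by rintro rfl; exact hyP _ hP₁ hyQ')))
  have h3 := h2.trans hht
  have h4 : (1 : ℕ∞) + 1 ≤ 1 := le_trans (by gcongr; exact le_trans (by simp) h1) h3
  exact absurd h4 (by norm_num)

end FiniteOverDVR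


/-! ### Heights of points, by Noether normalization and going-down. -/

section Height

open IsLocalRing

/-- Incomparability: contraction of primes along an integral map is strictly monotone. -/
theorem ringKrullDim_le_of_isIntegral {A B : Type*} [CommRing A] [CommRing B]
    [Algebra B A] [Algebra.IsIntegral B A] :
    ringKrullDim A ≤ ringKrullDim B :=
  Order.krullDim_le_of_strictMono (PrimeSpectrum.comap (algebraMap B A)) 
    (fun P Q hPQ => by
      obtain ⟨x, hxQ, hxP⟩ := SetLike.exists_of_lt (show P.asIdeal < Q.asIdeal from hPQ)
      exact Ideal.comap_lt_comap_of_integral_mem_sdiff (le_of_lt hPQ) ⟨hxQ, hxP⟩ (Algebra.IsIntegral.isIntegral x))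

/-- In a complete local noetherian domain `R/P` with residue field that of `O`, the primes of
dimension one that do not contain the uniformizer have the maximal possible height. -/
theorem le_height_map_quotientMk {O R : Type u} [CommRing O] [IsDomain O]
    [IsDiscreteValuationRing O] [CommRing R] [IsLocalRing R] [IsNoetherianRing R]
    [IsAdicComplete (maximalIdeal R) R] [Algebra O R]
    (hk : Function.Surjective ((residue R).comp (algebraMap O R))) {ϖ : O} (hϖ : Irreducible ϖ)
    [IsPrecomplete (Ideal.span {ϖ}) O]
    (hϖR : algebraMap O R ϖ ∈ maximalIdeal R) {P q : Ideal R} [P.IsPrime] [q.IsPrime] (hPq : P ≤ q)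
    (hϖq : algebraMap O R ϖ ∉ q)
    (hq : ∀ Q : Ideal R, Q.IsPrime → q ≤ Q → algebraMap O R ϖ ∈ Q → Q = maximalIdeal R)
    {n : ℕ} (hn : ringKrullDim (R ⧸ P) = n + 1) :
    n ≤ (q.map (Ideal.Quotient.mk P)).height := by
  set a : R := algebraMap O R ϖ
  have haP : Ideal.Quotient.mk P a ≠ 0 := by
    rw [Ne, Ideal.Quotient.eq_zero_iff_mem]
    exact fun h => hϖq (hPq h)
  have : IsLocalRing (R ⧸ P) := .of_surjective' _ Ideal.Quotient.mk_surjective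
  have hmax : maximalIdeal (R ⧸ P) = (maximalIdeal R).map (Ideal.Quotient.mk P) := by
    refine (eq_maximalIdeal ((Ideal.map_eq_top_or_isMaximal_of_surjective _
      Ideal.Quotient.mk_surjective inferInstance).resolve_left fun h => ?_)).symm
    have := congrArg (Ideal.comap (Ideal.Quotient.mk P)) h
    rw [Ideal.comap_map_mk (le_maximalIdeal (Ideal.IsPrime.ne_top ‹_›)), Ideal.comap_top] at this
    exact (maximalIdeal.isMaximal R).ne_top this
  have hn1 : ringKrullDim ((R ⧸ P) ⧸ Ideal.span {Ideal.Quotient.mk P a}) = n := by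
    have := ringKrullDim_quotient_span_singleton_succ_eq_ringKrullDim_of_mem_nonZeroDivisors
      (x := Ideal.Quotient.mk P a) (mem_nonZeroDivisors_of_ne_zero haP)
      (hmax ▸ Ideal.mem_map_of_mem _ hϖR)
    rw [hn] at this
    exact ENat.WithBot.add_one_cancel.1 this
  -- a system of parameters of the quotient by the uniformizer, inside `q`
  set f : R →+* (R ⧸ P) ⧸ Ideal.span {Ideal.Quotient.mk P a} :=
    (Ideal.Quotient.mk _).comp (Ideal.Quotient.mk P)
  have hf : Function.Surjective f := Ideal.Quotient.mk_surjective.comp Ideal.Quotient.mk_surjective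
  have hfP : ∀ x ∈ P, f x = 0 := fun x hx => by
    simp only [f, RingHom.comp_apply, Ideal.Quotient.eq_zero_iff_mem.2 hx, map_zero]
  have hfa : f a = 0 := Ideal.Quotient.eq_zero_iff_mem.2 (Ideal.mem_span_singleton_self _)
  obtain ⟨l, hlq, hlen, hl⟩ : ∃ l : List R, (∀ x ∈ l, x ∈ q) ∧ l.length ≤ n ∧
      ∀ Q : Ideal R, Q.IsPrime → P ⊔ Ideal.ofList l ≤ Q → a ∈ Q → Q = maximalIdeal R := by
    have hqprime : ∀ Q : Ideal ((R ⧸ P) ⧸ Ideal.span {Ideal.Quotient.mk P a}), Q.IsPrime →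
        q.map f ≤ Q → Q.comap f = maximalIdeal R := fun Q hQ hle =>
      hq _ inferInstance (Ideal.map_le_iff_le_comap.1 hle) (by rw [Ideal.mem_comap, hfa]; simp)
    have hnt : Nontrivial ((R ⧸ P) ⧸ Ideal.span {Ideal.Quotient.mk P a}) :=
      not_subsingleton_iff_nontrivial.1 fun h => by
        rw [ringKrullDim_eq_bot_of_subsingleton] at hn1
        exact absurd hn1.symm (by simp)
    have : IsLocalRing ((R ⧸ P) ⧸ Ideal.span {Ideal.Quotient.mk P a}) := .of_surjective' _ hf
    -- Modulo P and ϖ, the maximal ideal is the only prime containing q, so the image of q has full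
    -- height n; it then contains an ideal of height at least n with at most n generators.
    have hht : (n : ℕ∞) ≤ (q.map f).height := by
      rw [Ideal.height_eq_inf_minimalPrimes]
      refine le_iInf₂ fun J hJ => ?_
      have hJp := hJ.1.1
      have h1 := hqprime J hJ.1.1 hJ.1.2
      have h2 : J = maximalIdeal _ := by
        have h3 := hqprime (maximalIdeal _) inferInstance
          (hJ.1.2.trans (le_maximalIdeal hJ.1.1.ne_top))
        exact Ideal.comap_injective_of_surjective f hf (h1.trans h3.symm)
      have h4 := maximalIdeal_height_eq_ringKrullDim
        (R := (R ⧸ P) ⧸ Ideal.span {Ideal.Quotient.mk P a})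
      rw [hn1, ← h2] at h4
      exact le_of_eq (by exact_mod_cast h4.symm)
    obtain ⟨J, hJq, hJr, hJh⟩ := exists_spanRank_le_and_le_height_of_le_height (q.map f) n hht
    have hJfin : J.generators.Finite := Submodule.FG.finite_generators (IsNoetherian.noetherian J)
    have hlift : ∀ y ∈ J, ∃ x ∈ q, f x = y := fun y hy =>
      (Ideal.mem_map_iff_of_surjective f hf).1 (hJq hy)
    choose! g hg using hlift
    have hgen : ∀ y ∈ J.generators, y ∈ J := fun y hy =>
      J.span_generators ▸ Submodule.subset_span hy
    refine ⟨hJfin.toFinset.toList.map g, ?_, ?_, ?_⟩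
    · intro x hx
      simp only [List.mem_map, Finset.mem_toList, Set.Finite.mem_toFinset] at hx
      obtain ⟨y, hy, rfl⟩ := hx
      exact (hg y (hgen y hy)).1
    · rw [List.length_map, Finset.length_toList, ← Set.ncard_eq_toFinset_card _ hJfin]
      have h1 := J.generators_card.trans_le hJr
      rw [← Set.cast_ncard hJfin] at h1
      exact_mod_cast h1
    · intro Q hQ hle haQ
      have hker : RingHom.ker f ≤ Q := by
        intro x hx
        rw [RingHom.mem_ker, RingHom.comp_apply, Ideal.Quotient.eq_zero_iff_mem] at hx
        obtain ⟨c, hc⟩ := Ideal.mem_span_singleton'.1 hx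
        obtain ⟨c, rfl⟩ := Ideal.Quotient.mk_surjective c
        rw [← map_mul, Ideal.Quotient.eq] at hc
        have h1 := (Submodule.sub_mem_iff_right _ (Ideal.mul_mem_left _ c haQ)).1
          (hle (Ideal.mem_sup_left hc))
        exact h1
      have hQp : (Q.map f).IsPrime := Ideal.map_isPrime_of_surjective hf hker
      have hJQ : J ≤ Q.map f := by
        rw [← J.span_generators, Submodule.span_le]
        intro y hy
        rw [← (hg y (hgen y hy)).2]
        refine Ideal.mem_map_of_mem f (hle (Ideal.mem_sup_right (Ideal.subset_span ?_)))
        simp only [List.mem_map, Finset.mem_toList, Set.Finite.mem_toFinset, Set.mem_ofPred_eq]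
        exact ⟨y, hy, rfl⟩
      have hQh : (Q.map f).height = ringKrullDim ((R ⧸ P) ⧸ Ideal.span {Ideal.Quotient.mk P a}) := by
        refine le_antisymm Ideal.height_le_ringKrullDim_of_isPrime ?_
        rw [hn1]
        exact_mod_cast hJh.trans (Ideal.height_mono hJQ)
      have hQm := Ideal.isMaximal_of_height_eq_ringKrullDim hQh
      have h1 : (Q.map f).comap f = Q := by
        rw [Ideal.comap_map_of_surjective f hf, ← RingHom.ker_eq_comap_bot]
        exact sup_eq_left.2 hker
      rw [← h1]
      have := Ideal.comap_isMaximal_of_surjective f hf (K := Q.map f)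
      exact eq_maximalIdeal this
  have hlm : ∀ x ∈ l, x ∈ maximalIdeal R := fun x hx =>
    le_maximalIdeal (Ideal.IsPrime.ne_top ‹_›) (hlq x hx)
  -- Noether normalization with parameters inside q: R/P is finite over B.
  obtain ⟨B, _, _, _, _, _, φ, ι, PB, _, hht, hdim, hφ, hι, hPφ, hfin⟩ :=
    exists_powerSeries_tower (algebraMap O R) l hlm
  have hfin1 := hfin P (RingHom.finite_algebraMap.2
    (finite_quotient_of_forall_isPrime hk ϖ hϖR (P ⊔ Ideal.ofList l) hl))
  let _ : Algebra B (R ⧸ P) := ((Ideal.Quotient.mk P).comp φ).toAlgebra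
  have : Module.Finite B (R ⧸ P) := hfin1
  -- A nonzero b in the kernel would make R/P, of dimension n + 1, integral over B/b, of dimension
  -- at most n.
  have hinj : Function.Injective (algebraMap B (R ⧸ P)) := by
    rw [injective_iff_map_eq_zero]
    intro b hb
    by_contra hb0
    set 𝔨 := RingHom.ker (algebraMap B (R ⧸ P))
    have h1 : ringKrullDim (B ⧸ Ideal.span {b}) + 1 ≤ ringKrullDim B :=
      ringKrullDim_quotient_succ_le_of_nonZeroDivisor (mem_nonZeroDivisors_of_ne_zero hb0)
    let _ : Algebra (B ⧸ Ideal.span {b}) (R ⧸ P) := (Ideal.Quotient.lift (Ideal.span {b})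
      (algebraMap B (R ⧸ P)) fun x hx => by
        obtain ⟨c, rfl⟩ := Ideal.mem_span_singleton'.1 hx
        rw [map_mul, hb, mul_zero]).toAlgebra
    have : IsScalarTower B (B ⧸ Ideal.span {b}) (R ⧸ P) := .of_algebraMap_eq fun x => rfl
    have : Module.Finite (B ⧸ Ideal.span {b}) (R ⧸ P) := .of_restrictScalars_finite B _ _
    have h2 := ringKrullDim_le_of_isIntegral (A := R ⧸ P) (B := B ⧸ Ideal.span {b})
    have h3 : ringKrullDim (R ⧸ P) + 1 ≤ n + 1 := by
      calc _ ≤ ringKrullDim (B ⧸ Ideal.span {b}) + 1 := by gcongr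
        _ ≤ _ := h1
        _ ≤ _ := hdim
        _ ≤ 1 + (n : WithBot ℕ∞) := by
          rw [IsDiscreteValuationRing.ringKrullDim_eq_one]
          gcongr
        _ = _ := add_comm _ _
    rw [hn] at h3
    exact absurd (ENat.WithBot.add_le_add_one_right_iff.1 h3) (by norm_cast; simp)
  have : FaithfulSMul B (R ⧸ P) := (faithfulSMul_iff_algebraMap_injective _ _).2 hinj
  have : (q.map (Ideal.Quotient.mk P)).IsPrime :=
    Ideal.map_isPrime_of_surjective Ideal.Quotient.mk_surjective (by simpa using hPq)
  -- The contraction of q contains the variables. An element of it is, modulo the variables, a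
  -- scalar lying in q, and this scalar is zero because q contains no unit and not ϖ.
  have : (q.map (Ideal.Quotient.mk P)).LiesOver PB := by
    constructor
    ext b
    rw [Ideal.mem_comap]
    change _ ↔ Ideal.Quotient.mk P (φ b) ∈ _
    rw [← Ideal.mem_comap, Ideal.comap_map_mk hPq]
    have hle : ∀ b ∈ PB, φ b ∈ q := fun b hb =>
      (Ideal.span_le.2 hlq : Ideal.ofList l ≤ q) (hPφ (Ideal.mem_map_of_mem φ hb))
    refine ⟨hle b, fun hb => ?_⟩
    obtain ⟨c, hc⟩ := hι b
    have h1 : algebraMap O R c ∈ q := by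
      have h2 := hle _ hc
      rw [map_sub, ← RingHom.comp_apply, hφ] at h2
      simpa using Ideal.sub_mem _ hb h2
    have h2 : c = 0 := by
      by_contra hc0
      obtain ⟨k, u, rfl⟩ := IsDiscreteValuationRing.eq_unit_mul_pow_irreducible hc0 hϖ
      rw [map_mul, map_pow] at h1
      rcases Ideal.IsPrime.mem_or_mem ‹_› h1 with h1 | h1
      · exact Ideal.IsPrime.ne_top ‹_› (Ideal.eq_top_of_isUnit_mem _ h1 (u.isUnit.map _))
      · exact hϖq (Ideal.IsPrime.mem_of_pow_mem ‹_› _ h1)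
    simpa [h2] using hc
  -- Going-down applies since B is normal and R/P is an integral extension domain. It remains to see
  -- that the list has at least n members, which follows from dim R/P ≤ dim B.
  rw [Ideal.height_eq_height_add_of_liesOver_of_hasGoingDown PB]
  have h1 : (n : WithBot ℕ∞) + 1 ≤ l.length + 1 := by
    rw [← hn, add_comm (l.length : WithBot ℕ∞), ← IsDiscreteValuationRing.ringKrullDim_eq_one O]
    exact (ringKrullDim_le_of_isIntegral (A := R ⧸ P) (B := B)).trans hdim
  have h2 : (n : ℕ∞) ≤ l.length := by
    exact_mod_cast ENat.WithBot.add_le_add_one_right_iff.1 h1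
  exact (h2.trans hht).trans le_self_add

end Height


/-! ### Injectivity of L/O and lifting of functionals from L/O to L. -/

section Duality

variable {O L : Type u} [CommRing O] [IsDomain O] [IsDiscreteValuationRing O] [Field L]
  [Algebra O L] [IsFractionRing O L]

theorem modInt_mk_eq_zero {O L : Type u} [CommRing O] [Field L] [Algebra O L] {x : L} :
    (Submodule.Quotient.mk x : ModInt O L) = 0 ↔ ∃ a : O, algebraMap O L a = x := by
  rw [Submodule.Quotient.mk_eq_zero]
  rfl

variable (O L) in
-- L/O is divisible and O is principal, so Baer's criterion holds. All extensions of L/O-valued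
-- functionals rest on this.
theorem baer_modInt : Module.Baer O (ModInt O L) := by
  intro I g
  obtain ⟨a, rfl⟩ := (IsPrincipalIdealRing.principal I).principal
  by_cases ha : a = 0
  · refine ⟨0, fun x hx => ?_⟩
    have h0 : (⟨x, hx⟩ : (Submodule.span O {a} : Submodule O O)) = 0 := by
      subst ha
      simpa using hx
    rw [h0, map_zero, LinearMap.zero_apply]
  · obtain ⟨y, hy⟩ := Submodule.Quotient.mk_surjective _
      (g ⟨a, Submodule.mem_span_singleton_self a⟩)
    have ha' : algebraMap O L a ≠ 0 := by simpa using ha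
    refine ⟨LinearMap.toSpanSingleton O _ (Submodule.Quotient.mk ((algebraMap O L a)⁻¹ * y)),
      fun x hx => ?_⟩
    obtain ⟨c, rfl⟩ := Submodule.mem_span_singleton.1 hx
    have h1 : (⟨c • a, hx⟩ : (Submodule.span O {a} : Submodule O O)) =
      c • ⟨a, Submodule.mem_span_singleton_self a⟩ := rfl
    rw [h1, map_smul g, ← hy, LinearMap.toSpanSingleton_apply, ← Submodule.Quotient.mk_smul,
      ← Submodule.Quotient.mk_smul]
    congr 1
    rw [smul_eq_mul, Algebra.smul_def c y, Algebra.smul_def, map_mul]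
    field_simp

theorem exists_smul_of_modInt_smul_eq_zero {a : O} (ha : a ≠ 0) {x : ModInt O L}
    (h : a • x = 0) : ∃ b : O, x = Submodule.Quotient.mk ((algebraMap O L a)⁻¹ * algebraMap O L b) := by
  obtain ⟨y, rfl⟩ := Submodule.Quotient.mk_surjective _ x
  rw [← Submodule.Quotient.mk_smul, modInt_mk_eq_zero] at h
  obtain ⟨b, hb⟩ := h
  have ha' : algebraMap O L a ≠ 0 := by simpa using ha
  refine ⟨b, ?_⟩
  rw [hb, Algebra.smul_def]
  congr 1
  field_simp

variable {ϖ : O} (hϖ : Irreducible ϖ)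

include hϖ in
theorem exists_mul_of_fractionRing (x : L) :
    ∃ (n : ℕ) (y : O), x = algebraMap O L y * (algebraMap O L ϖ ^ n)⁻¹ := by
  obtain ⟨a, b, hb, rfl⟩ := IsFractionRing.div_surjective (A := O) x
  obtain ⟨n, u, rfl⟩ := IsDiscreteValuationRing.eq_unit_mul_pow_irreducible
    (nonZeroDivisors.ne_zero hb) hϖ
  refine ⟨n, a * ↑u⁻¹, ?_⟩
  have h1 : algebraMap O L (u : O) ≠ 0 := by simp
  have h2 : algebraMap O L ((u⁻¹ : Oˣ) : O) = (algebraMap O L (u : O))⁻¹ := by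
    exact eq_inv_of_mul_eq_one_left (by rw [← map_mul, Units.inv_mul, map_one])
  rw [map_mul, map_mul, map_pow, h2]
  have h3 : algebraMap O L ϖ ≠ 0 := by simpa using hϖ.ne_zero
  field_simp

include hϖ in
-- If c n lifts the value at ϖ⁻ⁿ, then ϖⁿ c n differs from c 0 by a partial sum of a ϖ-adic series
-- over O. Its limit, which exists by completeness, gives the multiplier.
theorem exists_mul_of_modInt_hom [IsPrecomplete (Ideal.span {ϖ}) O] (ψ : L →ₗ[O] ModInt O L) :
    ∃ c : L, ∀ x, ψ x = Submodule.Quotient.mk (c * x) := by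
  set π := algebraMap O L ϖ
  have hπ : π ≠ 0 := by simpa [π] using hϖ.ne_zero
  choose c hc using fun n : ℕ => Submodule.Quotient.mk_surjective _ (ψ ((π ^ n)⁻¹))
  have h1 : ∀ n, ∃ a : O, algebraMap O L a = π * c (n + 1) - c n := by
    intro n
    rw [← modInt_mk_eq_zero, Submodule.Quotient.mk_sub, hc]
    have h2 : (Submodule.Quotient.mk (π * c (n + 1)) : ModInt O L) =
        ϖ • Submodule.Quotient.mk (c (n + 1)) := by
      rw [← Submodule.Quotient.mk_smul, Algebra.smul_def]
    rw [h2, hc, ← map_smul, sub_eq_zero]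
    congr 1
    rw [Algebra.smul_def]
    change π * _ = _
    field_simp
    ring
  choose a ha using h1
  have h2 : ∀ n, π ^ n * c n = c 0 + algebraMap O L (∑ i ∈ Finset.range n, ϖ ^ i * a i) := by
    intro n
    induction n with
    | zero => simp
    | succ n ih =>
      rw [Finset.sum_range_succ, map_add, ← add_assoc, ← ih, map_mul, map_pow, ha]
      change _ = _ + π ^ n * _
      ring
  have hpow : ∀ n, (Ideal.span {ϖ} ^ n • ⊤ : Submodule O O) = Ideal.span {ϖ ^ n} := by
    intro n
    rw [smul_eq_mul, Ideal.mul_top, Ideal.span_singleton_pow]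
  obtain ⟨s, hs⟩ := IsPrecomplete.prec' (I := Ideal.span {ϖ})
    (fun n => ∑ i ∈ Finset.range n, ϖ ^ i * a i) (fun {m n} hmn => by
      rw [SModEq.sub_mem, hpow, ← Finset.sum_range_add_sum_Ico _ hmn, sub_add_cancel_left, neg_mem_iff]
      refine Ideal.sum_mem _ fun i hi => Ideal.mem_span_singleton.2 (Dvd.dvd.mul_right ?_ _)
      exact pow_dvd_pow _ (Finset.mem_Ico.1 hi).1)
  refine ⟨c 0 + algebraMap O L s, fun x => ?_⟩
  obtain ⟨n, y, rfl⟩ := exists_mul_of_fractionRing hϖ x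
  have h3 := hs n
  rw [SModEq.sub_mem, hpow] at h3
  obtain ⟨t, ht⟩ := Ideal.mem_span_singleton'.1 h3
  rw [← Algebra.smul_def, map_smul, ← hc, ← Submodule.Quotient.mk_smul, ← sub_eq_zero,
    ← Submodule.Quotient.mk_sub, modInt_mk_eq_zero]
  refine ⟨y * t, ?_⟩
  have h4 : c n = (π ^ n)⁻¹ * (c 0 + algebraMap O L (∑ i ∈ Finset.range n, ϖ ^ i * a i)) := by
    rw [← h2]; field_simp
  have h5 : algebraMap O L t * π ^ n =
      algebraMap O L (∑ i ∈ Finset.range n, ϖ ^ i * a i) - algebraMap O L s := by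
    rw [← map_sub, ← ht, map_mul, map_pow]
  rw [Algebra.smul_def, Algebra.smul_def, h4, map_mul]
  change _ = _ - _ * (_ * (π ^ n)⁻¹)
  have h6 : algebraMap O L t = (algebraMap O L (∑ i ∈ Finset.range n, ϖ ^ i * a i) - algebraMap O L s)
      * (π ^ n)⁻¹ := by
    rw [← h5]; field_simp
  rw [h6]
  ring

include hϖ in
/-- Over a complete discrete valuation ring, the homomorphisms from a torsion-free module to `L/O`
lift to `L`. -/
theorem exists_lift_of_isTorsionFree [IsPrecomplete (Ideal.span {ϖ}) O] {H : Type*}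
    [AddCommGroup H] [Module O H] [Module.IsTorsionFree O H] (ψ : H →ₗ[O] ModInt O L) :
    ∃ φ : H →ₗ[O] L, ∀ h, ψ h = Submodule.Quotient.mk (φ h) := by
  let i : H →ₗ[O] L ⊗[O] H := (LinearMap.rTensor H (Algebra.linearMap O L)) ∘ₗ
    (TensorProduct.lid O H).symm.toLinearMap
  have hi : Function.Injective i := by
    have hL : Function.Injective (Algebra.linearMap O L) := IsFractionRing.injective O L
    refine Function.Injective.comp (g := LinearMap.rTensor H (Algebra.linearMap O L))
      (f := (TensorProduct.lid O H).symm) ?_ (TensorProduct.lid O H).symm.injective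
    exact Module.Flat.rTensor_preserves_injective_linearMap _ hL
  obtain ⟨Ψ, hΨ⟩ := (baer_modInt O L).extension_property i hi ψ
  -- H embeds into the L-vector space L ⊗ H, to which the functional extends by injectivity of L/O.
  -- On each basis line the extension is multiplication by a scalar, so it lifts.
  let b := Module.Free.chooseBasis L (L ⊗[O] H)
  choose c hc using fun j => exists_mul_of_modInt_hom hϖ
    (Ψ ∘ₗ ((LinearMap.toSpanSingleton L (L ⊗[O] H) (b j)).restrictScalars O))
  let Φ : L ⊗[O] H →ₗ[L] L := b.constr L c
  have hΦ : ∀ w, Ψ w = Submodule.Quotient.mk (Φ w) := by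
    have key : ∀ w ∈ Submodule.span L (Set.range b), ∀ x : L,
        Ψ (x • w) = Submodule.Quotient.mk (Φ (x • w)) := by
      intro w hw
      induction hw using Submodule.span_induction with
      | zero => simp
      | add w₁ w₂ _ _ h₁ h₂ =>
        intro x
        rw [smul_add, map_add, map_add, h₁, h₂, Submodule.Quotient.mk_add]
      | smul a w _ h =>
        intro x
        rw [smul_smul]
        exact h _
      | mem w hw =>
        obtain ⟨j, rfl⟩ := hw
        intro x
        rw [map_smul Φ, b.constr_basis, smul_eq_mul, mul_comm]
        exact hc j x
    intro w
    have := key w (by rw [b.span_eq]; trivial) 1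
    rwa [one_smul] at this
  refine ⟨Φ.restrictScalars O ∘ₗ i, fun h => ?_⟩
  rw [← hΨ]
  exact hΦ _

include hϖ in
-- If ϖ kills the functional, then ϖ times a lift to L takes values in O.
theorem exists_lift_of_smul_eq_zero [IsPrecomplete (Ideal.span {ϖ}) O] {H : Type*}
    [AddCommGroup H] [Module O H] [Module.IsTorsionFree O H] (ψ : H →ₗ[O] ModInt O L)
    (hψ : ∀ h, ϖ • ψ h = 0) :
    ∃ φ : H →ₗ[O] O, ∀ h, ψ h =
      Submodule.Quotient.mk ((algebraMap O L ϖ)⁻¹ * algebraMap O L (φ h)) := by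
  obtain ⟨φ, hφ⟩ := exists_lift_of_isTorsionFree hϖ ψ
  have hπ : algebraMap O L ϖ ≠ 0 := by simpa using hϖ.ne_zero
  have h1 : ∀ h, ∃ a : O, algebraMap O L a = ϖ • φ h := fun h => by
    rw [← modInt_mk_eq_zero, Submodule.Quotient.mk_smul, ← hφ, hψ]
  choose f hf using h1
  have hinj := IsFractionRing.injective O L
  refine ⟨⟨⟨f, fun x y => hinj ?_⟩, fun a x => hinj ?_⟩, fun h => ?_⟩
  · rw [map_add, hf, hf, hf, map_add, smul_add]
  · rw [hf, map_smul, smul_comm, ← hf, Algebra.smul_def, smul_eq_mul, map_mul]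
    rfl
  · change ψ h = Submodule.Quotient.mk ((algebraMap O L ϖ)⁻¹ * algebraMap O L (f h))
    rw [hf, hφ, Algebra.smul_def, inv_mul_cancel_left₀ hπ]

end Duality


/-! ### Elementary operations on duals. -/

section LinDualLemmas

variable {O T Q : Type u} [CommRing O] [AddCommGroup T] [Module O T] [AddCommGroup Q] [Module O Q]

namespace LinDual

/-- A linear map, as an element of the dual. -/
def mk (f : T →ₗ[O] Q) : LinDual O T Q := f

/-- An element of the dual, as a linear map. -/
def toLin (f : LinDual O T Q) : T →ₗ[O] Q := f

@[simp] theorem toLin_apply (f : LinDual O T Q) (t : T) : f.toLin t = f t := rfl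

@[ext] theorem ext {f g : LinDual O T Q} (h : ∀ t, f t = g t) : f = g := LinearMap.ext h

theorem smul_apply {S : Type*} [CommSemiring S] [Module S T] [SMulCommClass S O T] (s : S)
    (f : LinDual O T Q) (t : T) : (s • f) t = f (s • t) := rfl

@[simp] theorem add_apply (f g : LinDual O T Q) (t : T) : (f + g) t = f t + g t := rfl

@[simp] theorem sub_apply (f g : LinDual O T Q) (t : T) : (f - g) t = f t - g t := rfl

@[simp] theorem zero_apply (t : T) : (0 : LinDual O T Q) t = 0 := rfl

/-- Evaluation at an element. -/
def ev (t : T) : LinDual O T Q →+ Q where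
  toFun f := f t
  map_zero' := rfl
  map_add' _ _ := rfl

theorem sum_apply {ι : Type*} (s : Finset ι) (f : ι → LinDual O T Q) (t : T) :
    (∑ i ∈ s, f i) t = ∑ i ∈ s, f i t :=
  map_sum (ev t) f s

theorem map_smul (f : LinDual O T Q) (a : O) (t : T) : f (a • t) = a • f t :=
  LinearMap.map_smul f.toLin a t

instance {R : Type*} [CommRing R] [Algebra O R] [Module R T] [IsScalarTower O R T] :
    IsScalarTower O R (LinDual O T Q) where
  smul_assoc a r f := ext fun t => by
    change f ((a • r) • t) = f (r • a • t)
    rw [smul_assoc, smul_comm]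

end LinDual

end LinDualLemmas

theorem exists_extend_modInt {O L : Type u} [CommRing O] [IsDomain O] [IsDiscreteValuationRing O]
    [Field L] [Algebra O L] [IsFractionRing O L] {A B : Type*} [AddCommGroup A] [Module O A]
    [AddCommGroup B] [Module O B] (g : A →ₗ[O] B) (ψ : A →ₗ[O] ModInt O L)
    (h : ∀ a, g a = 0 → ψ a = 0) : ∃ Ψ : B →ₗ[O] ModInt O L, ∀ a, Ψ (g a) = ψ a := by
  obtain ⟨Ψ, hΨ⟩ := (baer_modInt O L).extension_property
    ((LinearMap.ker g).liftQ g le_rfl) (LinearMap.ker_eq_bot.1 (Submodule.ker_liftQ_eq_bot _ _ _ le_rfl))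
    ((LinearMap.ker g).liftQ ψ fun a ha => h a ha)
  exact ⟨Ψ, fun a => LinearMap.congr_fun hΨ (Submodule.Quotient.mk a)⟩

/-- The map `ϖ⁻¹ · : O → L/O`. -/
def divMap {O : Type u} (L : Type u) [CommRing O] [Field L] [Algebra O L] (ϖ : O) :
    O →ₗ[O] ModInt O L :=
  LinearMap.toSpanSingleton O _ (Submodule.Quotient.mk (algebraMap O L ϖ)⁻¹)

section DivMap

variable {O L : Type u} [CommRing O] [IsDomain O] [IsDiscreteValuationRing O] [Field L]
  [Algebra O L] [IsFractionRing O L]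

theorem divMap_apply (ϖ a : O) : divMap L ϖ a =
    Submodule.Quotient.mk ((algebraMap O L ϖ)⁻¹ * algebraMap O L a) := by
  rw [divMap, LinearMap.toSpanSingleton_apply, ← Submodule.Quotient.mk_smul, Algebra.smul_def,
    mul_comm]

theorem divMap_eq_zero {ϖ : O} (hϖ : ϖ ≠ 0) {a : O} : divMap L ϖ a = 0 ↔ ϖ ∣ a := by
  have hπ : algebraMap O L ϖ ≠ 0 := by simpa using hϖ
  rw [divMap_apply, modInt_mk_eq_zero]
  refine exists_congr fun b => ⟨fun h => ?_, fun h => ?_⟩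
  · apply IsFractionRing.injective O L
    rw [map_mul, h, mul_inv_cancel_left₀ hπ]
  · rw [h, map_mul, inv_mul_cancel_left₀ hπ]

theorem smul_divMap {ϖ : O} (hϖ : ϖ ≠ 0) (a : O) : ϖ • divMap L ϖ a = 0 := by
  rw [← map_smul, divMap_eq_zero hϖ]
  exact Dvd.intro _ rfl

end DivMap

/-! ### Duality for admissible modules: finiteness and reflexivity. -/

section Package

variable {O R : Type u} [CommRing O] [IsDomain O] [IsDiscreteValuationRing O]
  [CommRing R] [IsLocalRing R] [Algebra O R] {ϖ : O}

/-- The properties of `Hom^cont(N, Θ^d)` that its duality theory depends on. -/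
structure IsAdmissible (R : Type u) [CommRing R] [IsLocalRing R] (ϖ : O) (H : Type u)
    [AddCommGroup H] [Module O H] [Module R H] : Prop where
  eq_zero_of_smul : ∀ h : H, ϖ • h = 0 → h = 0
  exists_pow : ∀ (h : H) (j : ℕ), ∃ n, ∀ r ∈ IsLocalRing.maximalIdeal R ^ n, ∃ h', r • h = ϖ ^ j • h'
  complete : ∀ f : ℕ → H, ∃ F : ℕ → H, ∀ n, F n = f n + ϖ • F (n + 1)
  cofinite : ∃ (F : Type u) (_ : Finite F) (c : H → F), ∀ h h',
    (∀ r ∈ IsLocalRing.maximalIdeal R, ∃ y, r • h = ϖ • y) →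
    (∀ r ∈ IsLocalRing.maximalIdeal R, ∃ y, r • h' = ϖ • y) → c h = c h' → ∃ y, h - h' = ϖ • y

variable {H : Type u} [AddCommGroup H] [Module O H] [Module R H] [IsScalarTower O R H]

/-- Finiteness of the 𝔪ⁿ-torsion of H/ϖH, by induction. For h killed by 𝔪ⁿ⁺¹, the products of h with
generators of 𝔪 are killed by 𝔪ⁿ and take finitely many classes; subtracting a representative with
the same classes leaves an element killed by 𝔪. -/
theorem exists_finite_map_pow [IsNoetherianRing R] (hH : IsAdmissible R ϖ H) (n : ℕ) :
    ∃ (F : Type u) (_ : Finite F) (c : H → F), ∀ h h',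
    (∀ r ∈ IsLocalRing.maximalIdeal R ^ n, ∃ y, r • h = ϖ • y) →
    (∀ r ∈ IsLocalRing.maximalIdeal R ^ n, ∃ y, r • h' = ϖ • y) →
    c h = c h' → ∃ y, h - h' = ϖ • y := by
  induction n with
  | zero =>
    refine ⟨PUnit, inferInstance, fun _ => PUnit.unit, fun h h' h1 h2 _ => ?_⟩
    obtain ⟨y, hy⟩ := h1 1 (by simp)
    obtain ⟨y', hy'⟩ := h2 1 (by simp)
    rw [one_smul] at hy hy'
    exact ⟨y - y', by rw [hy, hy', smul_sub]⟩
  | succ n ih =>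
    obtain ⟨F, _, c, hc⟩ := ih
    obtain ⟨F₁, _, c₁, hc₁⟩ := hH.cofinite
    obtain ⟨t, g, hg⟩ := Submodule.fg_iff_exists_fin_generating_family.1
      (IsNoetherian.noetherian (IsLocalRing.maximalIdeal R))
    have hgm : ∀ i, g i ∈ IsLocalRing.maximalIdeal R := fun i => by
      rw [← hg]; exact Submodule.subset_span ⟨i, rfl⟩
    let P : H → Prop := fun h => ∀ r ∈ IsLocalRing.maximalIdeal R ^ (n + 1), ∃ y, r • h = ϖ • y
    let τ : H → Fin t → F := fun h i => c (g i • h)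
    have hrep : ∀ h, P h → ∃ h₀, P h₀ ∧ τ h₀ = τ h := fun h hh => ⟨h, hh, rfl⟩
    classical
    -- The default 0 is never reached on the values of elements satisfying P.
    let ρ : (Fin t → F) → H := fun v => if hv : ∃ h₀, P h₀ ∧ τ h₀ = v then hv.choose else 0
    have hρ : ∀ h, P h → P (ρ (τ h)) ∧ τ (ρ (τ h)) = τ h := by
      intro h hh
      have hv : ∃ h₀, P h₀ ∧ τ h₀ = τ h := ⟨h, hh, rfl⟩
      have : ρ (τ h) = hv.choose := dif_pos hv
      rw [this]
      exact hv.choose_spec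
    refine ⟨(Fin t → F) × F₁, inferInstance, fun h => (τ h, c₁ (h - ρ (τ h))),
      fun h h' hh hh' heq => ?_⟩
    have key : ∀ h, P h → ∀ r ∈ IsLocalRing.maximalIdeal R, ∃ y, r • (h - ρ (τ h)) = ϖ • y := by
      intro h hh r hr
      rw [← hg] at hr
      induction hr using Submodule.span_induction with
      | mem x hx =>
        obtain ⟨i, rfl⟩ := hx
        obtain ⟨h1, h2⟩ := hρ h hh
        rw [smul_sub]
        refine hc _ _ (fun r hr => ?_) (fun r hr => ?_) ?_
        · rw [smul_smul]
          exact hh _ (by rw [pow_succ]; exact Ideal.mul_mem_mul hr (hgm i))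
        · rw [smul_smul]
          exact h1 _ (by rw [pow_succ]; exact Ideal.mul_mem_mul hr (hgm i))
        · exact (congrFun h2 i).symm
      | zero => exact ⟨0, by simp⟩
      | add a b _ _ ha hb =>
        obtain ⟨y, hy⟩ := ha
        obtain ⟨y', hy'⟩ := hb
        exact ⟨y + y', by rw [add_smul, hy, hy', smul_add]⟩
      | smul a b _ hb =>
        obtain ⟨y, hy⟩ := hb
        exact ⟨a • y, by rw [smul_assoc, hy, smul_comm]⟩
    have h1 : τ h = τ h' := congrArg Prod.fst heq
    obtain ⟨y, hy⟩ := hc₁ _ _ (key h hh) (key h' hh') (congrArg Prod.snd heq)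
    refine ⟨y, ?_⟩
    rw [← hy, h1]
    abel

variable (hϖ : Irreducible ϖ)
include hϖ

theorem isTorsionFree_of_irreducible (hH : ∀ h : H, ϖ • h = 0 → h = 0) :
    Module.IsTorsionFree O H := by
  have hpow : ∀ n : ℕ, ∀ h : H, ϖ ^ n • h = 0 → h = 0 := by
    intro n
    induction n with
    | zero => intro h hh; simpa using hh
    | succ n ih =>
      intro h hh
      rw [pow_succ, mul_smul] at hh
      exact hH _ (ih _ hh)
  refine ⟨fun a ha x y hxy => ?_⟩
  obtain ⟨n, u, rfl⟩ := IsDiscreteValuationRing.eq_unit_mul_pow_irreducible ha.ne_zero hϖ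
  have h1 : ((u : O) * ϖ ^ n) • (x - y) = 0 := by rw [smul_sub]; exact sub_eq_zero.2 hxy
  rw [mul_smul] at h1
  have h2 : ϖ ^ n • (x - y) = 0 := by
    have := congrArg (fun z => ((u⁻¹ : Oˣ) : O) • z) h1
    simpa [smul_smul] using this
  exact sub_eq_zero.1 (hpow n _ h2)

omit [IsLocalRing R] in
theorem exists_div_of_forall_dvd (φ : LinDual O H O) (h : ∀ x, ϖ ∣ φ x) :
    ∃ φ' : LinDual O H O, φ = algebraMap O R ϖ • φ' ∧ ∀ x, φ x = ϖ * φ' x := by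
  choose f hf using h
  refine ⟨LinDual.mk ⟨⟨f, fun x y => ?_⟩, fun a x => ?_⟩, ?_, hf⟩
  · apply mul_left_cancel₀ hϖ.ne_zero
    rw [← hf, map_add, mul_add, hf, hf]
  · apply mul_left_cancel₀ hϖ.ne_zero
    change ϖ * f _ = ϖ * (a * f x)
    rw [← hf, LinDual.map_smul, hf, smul_eq_mul]
    ring
  · ext x
    rw [algebraMap_smul, LinDual.smul_apply, LinDual.map_smul]
    exact hf x

variable (L : Type u) [Field L] [Algebra O L] [IsFractionRing O L] [IsPrecomplete (Ideal.span {ϖ}) O]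
include L

/-- In the Pontryagin dual of H/ϖH, the functionals vanishing on the I-torsion are I times the dual.
Indeed φ/ϖ kills the kernel of h ↦ (gᵢ h), so it extends along this map to (H/ϖH)ᵗ; lifting the
components of the extension to O gives the terms gᵢ fᵢ. -/
theorem exists_eq_add_smul_of_forall_dvd [IsNoetherianRing R] (hH : IsAdmissible R ϖ H) (I : Ideal R)
    (φ : LinDual O H O) (hφ : ∀ h, (∀ r ∈ I, ∃ y, r • h = ϖ • y) → ϖ ∣ φ h) :
    ∃ φ₁ ∈ (I • ⊤ : Submodule R (LinDual O H O)), ∃ φ₂, φ = φ₁ + algebraMap O R ϖ • φ₂ := by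
  have := isTorsionFree_of_irreducible hϖ hH.eq_zero_of_smul
  obtain ⟨t, g, hg⟩ := Submodule.fg_iff_exists_fin_generating_family.1 (IsNoetherian.noetherian I)
  have hgm : ∀ i, g i ∈ I := fun i => by rw [← hg]; exact Submodule.subset_span ⟨i, rfl⟩
  let X : Submodule O H := LinearMap.range (LinearMap.lsmul O H ϖ)
  let G : H →ₗ[O] (Fin t → H ⧸ X) := LinearMap.pi fun i =>
    X.mkQ ∘ₗ (Algebra.lsmul O O H (g i))
  have hX : ∀ h, X.mkQ h = 0 ↔ ∃ y, h = ϖ • y := fun h => by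
    rw [Submodule.mkQ_apply, Submodule.Quotient.mk_eq_zero]
    exact exists_congr fun y => eq_comm
  obtain ⟨Ψ, hΨ⟩ := exists_extend_modInt (L := L) G (divMap L ϖ ∘ₗ φ.toLin) (by
    intro h hh
    refine (divMap_eq_zero hϖ.ne_zero).2 (hφ h fun r hr => ?_)
    rw [← hg] at hr
    induction hr using Submodule.span_induction with
    | mem x hx =>
      obtain ⟨i, rfl⟩ := hx
      exact (hX _).1 (congrFun hh i)
    | zero => exact ⟨0, by simp⟩
    | add a b _ _ ha hb =>
      obtain ⟨y, hy⟩ := ha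
      obtain ⟨y', hy'⟩ := hb
      exact ⟨y + y', by rw [add_smul, hy, hy', smul_add]⟩
    | smul a b _ hb =>
      obtain ⟨y, hy⟩ := hb
      exact ⟨a • y, by rw [smul_assoc, hy, smul_comm]⟩)
  choose f hf using fun i => exists_lift_of_smul_eq_zero hϖ
    (Ψ ∘ₗ LinearMap.single O (fun _ : Fin t => H ⧸ X) i ∘ₗ X.mkQ) (fun h => by
      rw [← map_smul, LinearMap.comp_apply, LinearMap.comp_apply, (hX _).2 ⟨h, rfl⟩, map_zero,
        map_zero])
  obtain ⟨φ', hφ', -⟩ := exists_div_of_forall_dvd (R := R) hϖ (φ - ∑ i, g i • LinDual.mk (f i)) (by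
    intro h
    rw [← divMap_eq_zero (L := L) hϖ.ne_zero, LinDual.sub_apply, map_sub, sub_eq_zero]
    have h1 := hΨ h
    rw [← LinearMap.sum_single_apply (fun _ : Fin t => H ⧸ X) (G h), map_sum] at h1
    rw [LinearMap.comp_apply] at h1
    change _ = divMap L ϖ (φ h) at h1
    rw [← h1, LinDual.sum_apply, map_sum]
    refine Finset.sum_congr rfl fun i _ => ?_
    rw [divMap_apply]
    exact hf i (g i • h))
  refine ⟨∑ i, g i • LinDual.mk (f i), Submodule.sum_mem _ fun i _ =>
    Submodule.smul_mem_smul (hgm i) trivial, φ', ?_⟩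
  rw [← hφ']
  abel

end Package


section Package

variable {O R : Type u} [CommRing O] [IsDomain O] [IsDiscreteValuationRing O]
  [CommRing R] [IsLocalRing R] [Algebra O R] {ϖ : O}
  {H : Type u} [AddCommGroup H] [Module O H] [Module R H] [IsScalarTower O R H]

theorem IsAdmissible.dvd_apply (hH : IsAdmissible R ϖ H) (h : H) (j : ℕ) :
    ∃ n, ∀ φ ∈ (IsLocalRing.maximalIdeal R ^ n • ⊤ : Submodule R (LinDual O H O)), ϖ ^ j ∣ φ h := by
  obtain ⟨n, hn⟩ := hH.exists_pow h j
  refine ⟨n, fun φ hφ => ?_⟩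
  induction hφ using Submodule.smul_induction_on' with
  | smul r hr φ _ =>
    obtain ⟨h', hh'⟩ := hn r hr
    rw [LinDual.smul_apply, hh', LinDual.map_smul]
    exact Dvd.intro _ rfl
  | add x _ y _ hx hy => exact dvd_add hx hy

variable (hϖ : Irreducible ϖ)
include hϖ

theorem eq_zero_of_forall_pow_dvd {a : O} (h : ∀ j, ϖ ^ j ∣ a) : a = 0 := by
  by_contra ha
  obtain ⟨n, u, rfl⟩ := IsDiscreteValuationRing.eq_unit_mul_pow_irreducible ha hϖ
  have h1 := h (n + 1)
  rw [Units.dvd_mul_left, pow_dvd_pow_iff hϖ.ne_zero hϖ.not_isUnit] at h1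
  omega

theorem IsAdmissible.isHausdorff (hH : IsAdmissible R ϖ H) :
    IsHausdorff (IsLocalRing.maximalIdeal R) (LinDual O H O) := by
  refine ⟨fun φ hφ => LinDual.ext fun h => eq_zero_of_forall_pow_dvd hϖ fun j => ?_⟩
  obtain ⟨n, hn⟩ := hH.dvd_apply h j
  exact hn φ (SModEq.zero.1 (hφ n))

variable (L : Type u) [Field L] [Algebra O L] [IsFractionRing O L] [IsPrecomplete (Ideal.span {ϖ}) O]
include L

/-- Modulo 𝔪, a functional is determined by its values modulo ϖ on representatives of the finite
𝔪-torsion of H/ϖH. So the dual modulo 𝔪 is finite, and complete Nakayama applies. -/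
theorem IsAdmissible.finite [IsNoetherianRing R] [IsPrecomplete (IsLocalRing.maximalIdeal R) R]
    [Finite (O ⧸ Ideal.span {ϖ})] (hϖR : algebraMap O R ϖ ∈ IsLocalRing.maximalIdeal R)
    (hH : IsAdmissible R ϖ H) : Module.Finite R (LinDual O H O) := by
  have := hH.isHausdorff hϖ
  refine finite_of_finite_quotient_of_isHausdorff (IsLocalRing.maximalIdeal R) ?_
  obtain ⟨F, _, c, hc⟩ := hH.cofinite
  let P : H → Prop := fun h => ∀ r ∈ IsLocalRing.maximalIdeal R, ∃ y, r • h = ϖ • y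
  have hrep : ∀ x : F, ∃ h₀ : H, ∀ h, P h → c h = x → P h₀ ∧ c h₀ = x := by
    intro x
    by_cases hx : ∃ h, P h ∧ c h = x
    · exact ⟨hx.choose, fun _ _ _ => hx.choose_spec⟩
    · exact ⟨0, fun h h1 h2 => (hx ⟨h, h1, h2⟩).elim⟩
  choose ρ hρ using hrep
  let G : (LinDual O H O ⧸ (IsLocalRing.maximalIdeal R • ⊤ : Submodule R (LinDual O H O))) →
      F → O ⧸ Ideal.span {ϖ} := fun q x => Ideal.Quotient.mk _ (Quotient.out q (ρ x))
  have hG : Function.Injective G := by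
    intro q q' hq
    rw [← Quotient.out_eq q, ← Quotient.out_eq q']
    refine (Submodule.Quotient.eq _).2 ?_
    obtain ⟨φ₁, hφ₁, φ₂, hφ⟩ := exists_eq_add_smul_of_forall_dvd hϖ L hH
      (IsLocalRing.maximalIdeal R) (Quotient.out q - Quotient.out q') (by
        intro h hh
        obtain ⟨h1, h2⟩ := hρ (c h) h hh rfl
        obtain ⟨y, hy⟩ := hc _ _ hh h1 h2.symm
        rw [sub_eq_iff_eq_add.1 hy, map_add, LinDual.map_smul]
        refine dvd_add (Dvd.intro _ rfl) ?_
        rw [LinDual.sub_apply, ← Ideal.mem_span_singleton, ← Ideal.Quotient.eq]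
        exact congrFun hq (c h))
    rw [hφ]
    exact add_mem hφ₁ (Submodule.smul_mem_smul hϖR trivial)
  have : Finite (LinDual O H O ⧸ (IsLocalRing.maximalIdeal R • ⊤ : Submodule R (LinDual O H O))) :=
    Finite.of_injective G hG
  infer_instance

/-- Reflexivity modulo ϖ: a functional that vanishes modulo ϖ on 𝔪ⁿ times the dual depends only on
the values at finitely many elements ρ x, so it extends to a functional of those values. Its
coefficients assemble the required h. -/
theorem IsAdmissible.exists_dvd_sub [IsNoetherianRing R] (hH : IsAdmissible R ϖ H)
    (lam : LinDual O H O →ₗ[O] O) {n : ℕ}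
    (hlam : ∀ φ ∈ (IsLocalRing.maximalIdeal R ^ n • ⊤ : Submodule R (LinDual O H O)), ϖ ∣ lam φ) :
    ∃ h : H, ∀ φ, ϖ ∣ lam φ - φ h := by
  classical
  obtain ⟨F, _, c, hc⟩ := exists_finite_map_pow hH n
  have := Fintype.ofFinite F
  let P : H → Prop := fun h => ∀ r ∈ IsLocalRing.maximalIdeal R ^ n, ∃ y, r • h = ϖ • y
  have hrep : ∀ x : F, ∃ h₀ : H, ∀ h, P h → c h = x → P h₀ ∧ c h₀ = x := by
    intro x
    by_cases hx : ∃ h, P h ∧ c h = x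
    · exact ⟨hx.choose, fun _ _ _ => hx.choose_spec⟩
    · exact ⟨0, fun h h1 h2 => (hx ⟨h, h1, h2⟩).elim⟩
  choose ρ hρ using hrep
  let E : H → (LinDual O H O →ₗ[O] O) := fun h =>
    { toFun := fun φ => φ h
      map_add' := fun _ _ => rfl
      map_smul' := fun a φ => by rw [LinDual.smul_apply, LinDual.map_smul]; rfl }
  let G : LinDual O H O →ₗ[O] (F → ModInt O L) := LinearMap.pi fun x => divMap L ϖ ∘ₗ E (ρ x)
  obtain ⟨Ψ, hΨ⟩ := exists_extend_modInt (L := L) G (divMap L ϖ ∘ₗ lam) (by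
    intro φ hφ
    refine (divMap_eq_zero hϖ.ne_zero).2 ?_
    obtain ⟨φ₁, hφ₁, φ₂, h12⟩ := exists_eq_add_smul_of_forall_dvd hϖ L hH
      (IsLocalRing.maximalIdeal R ^ n) φ (by
        intro h hh
        obtain ⟨h1, h2⟩ := hρ (c h) h hh rfl
        obtain ⟨y, hy⟩ := hc _ _ hh h1 h2.symm
        rw [sub_eq_iff_eq_add.1 hy, map_add, LinDual.map_smul]
        refine dvd_add (Dvd.intro _ rfl) ?_
        exact (divMap_eq_zero hϖ.ne_zero).1 (congrFun hφ (c h)))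
    rw [h12, map_add, algebraMap_smul, map_smul]
    exact dvd_add (hlam _ hφ₁) (Dvd.intro _ rfl))
  have hb : ∀ x : F, ∃ b : O, Ψ (LinearMap.single O (fun _ : F => ModInt O L) x (divMap L ϖ 1)) =
      divMap L ϖ b := by
    intro x
    simp_rw [divMap_apply (L := L) ϖ]
    refine exists_smul_of_modInt_smul_eq_zero hϖ.ne_zero ?_
    rw [← map_smul, ← map_smul, ← divMap_apply (L := L) ϖ, smul_divMap hϖ.ne_zero, map_zero, map_zero]
  choose b hb using hb
  refine ⟨∑ x, b x • ρ x, fun φ => ?_⟩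
  rw [← divMap_eq_zero (L := L) hϖ.ne_zero, map_sub, sub_eq_zero]
  have h1 := hΨ φ
  rw [← LinearMap.sum_single_apply (fun _ : F => ModInt O L) (G φ), map_sum] at h1
  change _ = divMap L ϖ (lam φ) at h1
  rw [← h1, map_sum, map_sum]
  refine Finset.sum_congr rfl fun x _ => ?_
  have h2 : G φ x = φ (ρ x) • divMap L ϖ 1 := by
    rw [← map_smul, smul_eq_mul, mul_one]
    rfl
  have h3 : (Pi.single x (G φ x) : F → ModInt O L) =
      φ (ρ x) • LinearMap.single O (fun _ : F => ModInt O L) x (divMap L ϖ 1) := by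
    rw [h2]
    exact (LinearMap.single O (fun _ : F => ModInt O L) x).map_smul _ _
  have h4 : Ψ (Pi.single x (G φ x)) = divMap L ϖ (φ (b x • ρ x)) := by
    rw [h3, map_smul, hb, ← map_smul, LinDual.map_smul, smul_eq_mul, smul_eq_mul, mul_comm]
  exact h4

/-- A functional on the dual of `H` that is continuous for the `𝔪`-adic topology is the evaluation
at an element of `H`. -/
theorem IsAdmissible.exists_eq_apply [IsNoetherianRing R] (hH : IsAdmissible R ϖ H)
    (lam : LinDual O H O →ₗ[O] O) (hlam : ∀ j, ∃ n,
      ∀ φ ∈ (IsLocalRing.maximalIdeal R ^ n • ⊤ : Submodule R (LinDual O H O)), ϖ ^ j ∣ lam φ) :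
    ∃ h : H, ∀ φ, lam φ = φ h := by
  -- The continuous functionals. Subtracting an evaluation and dividing by ϖ stays inside C;
  -- iterating gives a ϖ-adic series of elements of H, which converges by completeness.
  let C : Type u := {lam : LinDual O H O →ₗ[O] O // ∀ j, ∃ n,
      ∀ φ ∈ (IsLocalRing.maximalIdeal R ^ n • ⊤ : Submodule R (LinDual O H O)), ϖ ^ j ∣ lam φ}
  have step : ∀ x : C, ∃ (h : H) (x' : C), ∀ φ, x.1 φ = φ h + ϖ * x'.1 φ := by
    intro x
    obtain ⟨n, hn⟩ := x.2 1
    simp only [pow_one] at hn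
    obtain ⟨h, hh⟩ := hH.exists_dvd_sub hϖ L x.1 hn
    choose f hf using hh
    refine ⟨h, ⟨⟨⟨f, fun a b => ?_⟩, fun a b => ?_⟩, fun j => ?_⟩, fun φ => ?_⟩
    · apply mul_left_cancel₀ hϖ.ne_zero
      rw [← hf, map_add, mul_add, ← hf, ← hf, LinDual.add_apply]
      ring
    · apply mul_left_cancel₀ hϖ.ne_zero
      change ϖ * f _ = ϖ * (a * f b)
      rw [← hf, mul_left_comm, ← hf, map_smul, LinDual.smul_apply, LinDual.map_smul, smul_eq_mul,
        smul_eq_mul, mul_sub]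
    · obtain ⟨n, hn⟩ := x.2 (j + 1)
      obtain ⟨n', hn'⟩ := hH.dvd_apply h (j + 1)
      refine ⟨max n n', fun φ hφ => ?_⟩
      change ϖ ^ j ∣ f φ
      rw [← mul_dvd_mul_iff_left hϖ.ne_zero, ← hf, ← pow_succ']
      have hle : ∀ k ≤ max n n', φ ∈ (IsLocalRing.maximalIdeal R ^ k • ⊤ :
          Submodule R (LinDual O H O)) := fun k hk =>
        Submodule.smul_mono_left (Ideal.pow_le_pow_right hk) hφ
      exact dvd_sub (hn _ (hle _ (le_max_left _ _))) (hn' _ (hle _ (le_max_right _ _)))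
    · change _ = _ + ϖ * f φ
      rw [← hf]
      ring
  choose a s hs using step
  let x : ℕ → C := fun n => s^[n] ⟨lam, hlam⟩
  have hx : ∀ n φ, (x n).1 φ = φ (a (x n)) + ϖ * (x (n + 1)).1 φ := by
    intro n φ
    have : x (n + 1) = s (x n) := Function.iterate_succ_apply' s n _
    rw [this]
    exact hs _ φ
  obtain ⟨F, hF⟩ := hH.complete fun n => a (x n)
  refine ⟨F 0, fun φ => ?_⟩
  rw [← sub_eq_zero]
  have h1 : ∀ n, (x n).1 φ - φ (F n) = ϖ * ((x (n + 1)).1 φ - φ (F (n + 1))) := by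
    intro n
    rw [hx, hF n, map_add, LinDual.map_smul, smul_eq_mul]
    ring
  refine eq_zero_of_forall_pow_dvd hϖ fun j => ⟨(x j).1 φ - φ (F j), ?_⟩
  induction j with
  | zero => rw [pow_zero, one_mul]; rfl
  | succ j ih => rw [ih, h1 j, pow_succ, mul_assoc]

omit [IsLocalRing R] in
/-- The reduction modulo `ϖ` of the dual of `H` is the Pontryagin dual of `H/ϖH`. -/
theorem exists_linDual_modInt {H' : Type u} [AddCommGroup H'] [Module O H'] [Module R H']
    [IsScalarTower O R H'] (hH : ∀ h : H, ϖ • h = 0 → h = 0) (π : H →ₗ[R] H')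
    (hπ : Function.Surjective π) (hker : ∀ h, π h = 0 ↔ ∃ y, h = ϖ • y) :
    ∃ Φ : LinDual O H O →ₗ[R] LinDual O H' (ModInt O L), Function.Surjective Φ ∧
      (∀ φ, Φ φ = 0 ↔ ∃ φ', φ = algebraMap O R ϖ • φ') ∧
      ∀ φ h, Φ φ (π h) = divMap L ϖ (φ h) := by
  have := isTorsionFree_of_irreducible hϖ hH
  let π' : H →ₗ[O] H' := π.restrictScalars O
  have hk : ∀ φ : LinDual O H O, LinearMap.ker π' ≤ LinearMap.ker (divMap L ϖ ∘ₗ φ.toLin) := by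
    intro φ h hh
    obtain ⟨y, rfl⟩ := (hker h).1 hh
    refine (divMap_eq_zero hϖ.ne_zero).2 ?_
    rw [LinDual.toLin_apply, LinDual.map_smul]
    exact Dvd.intro _ rfl
  have hsur : Function.Surjective π' := hπ
  let e := π'.quotKerEquivOfSurjective hsur
  let Φ₀ : LinDual O H O → LinDual O H' (ModInt O L) := fun φ =>
    LinDual.mk ((LinearMap.ker π').liftQ _ (hk φ) ∘ₗ e.symm.toLinearMap)
  have hΦ₀ : ∀ φ h, Φ₀ φ (π h) = divMap L ϖ (φ h) := by
    intro φ h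
    have : e.symm (π h) = Submodule.Quotient.mk h := by
      rw [LinearEquiv.symm_apply_eq]
      rfl
    change (LinearMap.ker π').liftQ _ (hk φ) (e.symm (π h)) = _
    rw [this]
    rfl
  refine ⟨⟨⟨Φ₀, fun φ ψ => LinDual.ext fun x => ?_⟩, fun r φ => LinDual.ext fun x => ?_⟩, ?_, ?_,
    hΦ₀⟩
  · obtain ⟨h, rfl⟩ := hπ x
    rw [LinDual.add_apply, hΦ₀, hΦ₀, hΦ₀, ← map_add]
    rfl
  · obtain ⟨h, rfl⟩ := hπ x
    change Φ₀ (r • φ) (π h) = Φ₀ φ (r • π h)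
    rw [← map_smul, hΦ₀, hΦ₀]
    rfl
  · intro ψ
    -- A functional on H/ϖH, viewed on H, is killed by ϖ and therefore lifts to an O-valued one.
    obtain ⟨φ, hφ⟩ := exists_lift_of_smul_eq_zero hϖ (ψ.toLin ∘ₗ π') (fun h => by
      rw [← map_smul]
      have : π' (ϖ • h) = 0 := (hker _).2 ⟨h, rfl⟩
      rw [LinearMap.comp_apply, this, map_zero])
    refine ⟨LinDual.mk φ, LinDual.ext fun x => ?_⟩
    obtain ⟨h, rfl⟩ := hπ x
    change Φ₀ (LinDual.mk φ) (π h) = _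
    rw [hΦ₀, divMap_apply]
    exact (hφ h).symm
  · intro φ
    constructor
    · intro h
      obtain ⟨φ', h1, -⟩ := exists_div_of_forall_dvd (R := R) hϖ φ (fun x => by
        rw [← divMap_eq_zero (L := L) hϖ.ne_zero, ← hΦ₀]
        exact congrArg (fun ψ : LinDual O H' (ModInt O L) => ψ (π x)) h)
      exact ⟨φ', h1⟩
    · rintro ⟨φ', rfl⟩
      refine LinDual.ext fun x => ?_
      obtain ⟨h, rfl⟩ := hπ x
      change Φ₀ _ (π h) = 0
      rw [hΦ₀, algebraMap_smul, LinDual.smul_apply, LinDual.map_smul, divMap_eq_zero hϖ.ne_zero]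
      exact Dvd.intro _ rfl

end Package


/-! ### Adic completeness from compactness. -/

section AdicTopology

open Topology

variable {O : Type u} [CommRing O] [TopologicalSpace O] [IsTopologicalRing O] {ϖ : O}

/-- The sets of admissible limits at each stage are closed, non-empty and decreasing, so compactness
gives a common point. -/
theorem isPrecomplete_of_compactSpace [CompactSpace O] [T2Space O] :
    IsPrecomplete (Ideal.span {ϖ}) O := by
  have hpow : ∀ n, (Ideal.span {ϖ} ^ n • ⊤ : Submodule O O) = Ideal.span {ϖ ^ n} := by
    intro n
    rw [smul_eq_mul, Ideal.mul_top, Ideal.span_singleton_pow]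
  refine ⟨fun f hf => ?_⟩
  let Z : ℕ → Set O := fun n => {a | ϖ ^ n ∣ f n - a}
  have hcl : ∀ n, IsClosed (Z n) := by
    intro n
    have : Z n = (fun a => f n - a) ⁻¹' Set.range (fun b => ϖ ^ n * b) := by
      ext a
      exact exists_congr fun b => eq_comm
    rw [this]
    exact ((isCompact_range (continuous_const.mul continuous_id)).isClosed).preimage
      (continuous_const.sub continuous_id)
  have hne : (⋂ n, Z n).Nonempty := by
    refine IsCompact.nonempty_iInter_of_sequence_nonempty_isCompact_isClosed Z (fun n a ha => ?_)
      (fun n => ⟨f n, by simp [Z]⟩) (hcl 0).isCompact hcl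
    have h1 := hf (Nat.le_succ n)
    rw [SModEq.sub_mem, hpow, Ideal.mem_span_singleton] at h1
    have h2 : ϖ ^ n ∣ f (n + 1) - a := (pow_dvd_pow _ (Nat.le_succ n)).trans ha
    have h3 := dvd_add h1 h2
    rwa [sub_add_sub_cancel] at h3
  obtain ⟨a, ha⟩ := hne
  refine ⟨a, fun n => ?_⟩
  rw [SModEq.sub_mem, hpow, Ideal.mem_span_singleton]
  exact Set.mem_iInter.1 ha n

omit [TopologicalSpace O] [IsTopologicalRing O] in
theorem exists_adic_sum [IsPrecomplete (Ideal.span {ϖ}) O] (u : ℕ → O) :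
    ∃ s, ∀ k, ϖ ^ k ∣ s - ∑ i ∈ Finset.range k, ϖ ^ i * u i := by
  have hpow : ∀ n, (Ideal.span {ϖ} ^ n • ⊤ : Submodule O O) = Ideal.span {ϖ ^ n} := by
    intro n
    rw [smul_eq_mul, Ideal.mul_top, Ideal.span_singleton_pow]
  obtain ⟨s, hs⟩ := IsPrecomplete.prec' (I := Ideal.span {ϖ})
    (fun n => ∑ i ∈ Finset.range n, ϖ ^ i * u i) (fun {m n} hmn => by
      rw [SModEq.sub_mem, hpow, ← Finset.sum_range_add_sum_Ico _ hmn, sub_add_cancel_left, neg_mem_iff]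
      refine Ideal.sum_mem _ fun i hi => Ideal.mem_span_singleton.2 (Dvd.dvd.mul_right ?_ _)
      exact pow_dvd_pow _ (Finset.mem_Ico.1 hi).1)
  refine ⟨s, fun k => ?_⟩
  have := hs k
  rw [SModEq.sub_mem, hpow, Ideal.mem_span_singleton] at this
  rwa [← neg_sub, dvd_neg]

end AdicTopology

/-! ### Topology of the completed group algebra and its action on compact modules. -/

section CompletedGroupAlgebra

open Topology

variable {A K : Type u} [CommRing A] [IsLocalRing A] [Group K] [TopologicalSpace K]

theorem OpenNormalSubgroup.exists_le_of_finite {I : Set (ℕ × OpenNormalSubgroup K)}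
    (hI : I.Finite) : ∃ (n : ℕ) (U : OpenNormalSubgroup K), ∀ i ∈ I, i.1 ≤ n ∧
      (U : Subgroup K) ≤ (i.2 : Subgroup K) := by
  induction I, hI using Set.Finite.induction_on with
  | empty =>
    exact ⟨0, { (⊤ : OpenSubgroup K) with isNormal' := (inferInstance : (⊤ : Subgroup K).Normal) },
      by simp⟩
  | insert _ _ ih =>
    rename_i a _ _ _
    obtain ⟨n, U, hU⟩ := ih
    refine ⟨max n a.1, U ⊓ a.2, fun i hi => ?_⟩
    rcases hi with rfl | hi
    · exact ⟨le_max_right _ _, fun x hx => hx.2⟩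
    · exact ⟨(hU i hi).1.trans (le_max_left _ _), fun x hx => (hU i hi).2 hx.1⟩

/-- Finitely many coordinates are all determined by a single deeper level. -/
theorem CompletedGroupAlgebra.exists_of_mem_nhds {a : CompletedGroupAlgebra A K}
    {W : Set (CompletedGroupAlgebra A K)} (hW : W ∈ 𝓝 a) :
    ∃ (n : ℕ) (U : OpenNormalSubgroup K), ∀ b : CompletedGroupAlgebra A K,
      b.1 (n, U) = a.1 (n, U) → b ∈ W := by
  let _ : ∀ i : ℕ × OpenNormalSubgroup K, TopologicalSpace (Level A K i.1 i.2) := fun _ => ⊥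
  have hd : ∀ i : ℕ × OpenNormalSubgroup K, DiscreteTopology (Level A K i.1 i.2) := fun _ => ⟨rfl⟩
  have h1 : 𝓝 a = Filter.comap (fun x : completedSubalgebra A K => x.1) (𝓝 a.1) :=
    nhds_induced _ _
  rw [h1, nhds_pi] at hW
  obtain ⟨s, hs, hsW⟩ := Filter.mem_comap.1 hW
  obtain ⟨I, hI, t, ht, hts⟩ := Filter.mem_pi.1 hs
  obtain ⟨n, U, hU⟩ := OpenNormalSubgroup.exists_le_of_finite hI
  refine ⟨n, U, fun b hb => hsW (hts fun i hi => ?_)⟩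
  obtain ⟨h2, h3⟩ := hU i hi
  have h4 : b.1 i = a.1 i := by
    rw [← a.2 i.1 n h2 i.2 U h3, ← b.2 i.1 n h2 i.2 U h3, hb]
  change b.1 i ∈ t i
  rw [h4]
  exact mem_of_mem_nhds (ht i)

theorem CompletedGroupAlgebra.exists_pow_subset {W : Set (CompletedGroupAlgebra A K)}
    (hW : W ∈ 𝓝 0) : ∃ n, ∀ r ∈ IsLocalRing.maximalIdeal A ^ n,
      algebraMap A (CompletedGroupAlgebra A K) r ∈ W := by
  obtain ⟨n, U, h⟩ := CompletedGroupAlgebra.exists_of_mem_nhds hW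
  refine ⟨n, fun r hr => h _ ?_⟩
  change algebraMap A (Level A K n U) r = 0
  rw [IsScalarTower.algebraMap_apply A (A ⧸ IsLocalRing.maximalIdeal A ^ n) (Level A K n U),
    Ideal.Quotient.algebraMap_eq, Ideal.Quotient.eq_zero_iff_mem.2 hr, map_zero]

/-- A closed additive subgroup of `A⟦K⟧` that contains the multiples of the group elements is
everything. -/
theorem CompletedGroupAlgebra.mem_of_isClosed {Z : AddSubgroup (CompletedGroupAlgebra A K)}
    (hZ : IsClosed (Z : Set (CompletedGroupAlgebra A K)))
    (h : ∀ (r : A) (g : K), r • CompletedGroupAlgebra.of A K g ∈ Z)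
    (a : CompletedGroupAlgebra A K) : a ∈ Z := by
  change a ∈ (Z : Set (CompletedGroupAlgebra A K))
  rw [← hZ.closure_eq, mem_closure_iff_nhds]
  intro W hW
  obtain ⟨n, U, hU⟩ := CompletedGroupAlgebra.exists_of_mem_nhds hW
  -- Every element of a level is a finite combination of group elements, hence lifts into Z.
  have key : ∀ x : Level A K n U, ∃ b ∈ Z, b.1 (n, U) = x := by
    intro x
    induction x using MonoidAlgebra.induction_linear with
    | zero => exact ⟨0, zero_mem _, rfl⟩
    | add x y hx hy =>
      obtain ⟨b, hb, rfl⟩ := hx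
      obtain ⟨c, hc, rfl⟩ := hy
      exact ⟨b + c, add_mem hb hc, rfl⟩
    | single k r =>
      obtain ⟨g, rfl⟩ := QuotientGroup.mk_surjective k
      obtain ⟨r, rfl⟩ := Ideal.Quotient.mk_surjective r
      refine ⟨_, h r g, ?_⟩
      change r • MonoidAlgebra.of (A ⧸ IsLocalRing.maximalIdeal A ^ n) (K ⧸ (U : Subgroup K))
        (QuotientGroup.mk g) = _
      rw [MonoidAlgebra.of_apply, MonoidAlgebra.smul_single]
      congr 1
      rw [Algebra.smul_def, mul_one]
      rfl
  obtain ⟨b, hb, hba⟩ := key (a.1 (n, U))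
  exact ⟨b, hU b hba, hb⟩

end CompletedGroupAlgebra

section Action

open Topology

variable {R K N : Type u} [CommRing R] [IsLocalRing R] [Group K] [TopologicalSpace K]
  [AddCommGroup N] [Module (CompletedGroupAlgebra R K) N]
  [Module R N] [IsScalarTower R (CompletedGroupAlgebra R K) N]
  [TopologicalSpace N] [ContinuousSMul (CompletedGroupAlgebra R K) N]

variable (K) in
include K in
/-- The powers of the maximal ideal act on a compact `R⟦K⟧`-module by operators that converge to
zero uniformly. -/
theorem exists_pow_smul_mem [CompactSpace N] {U : Set N} (hU : U ∈ 𝓝 (0 : N)) :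
    ∃ n, ∀ r ∈ IsLocalRing.maximalIdeal R ^ n, ∀ x : N, r • x ∈ U := by
  -- A tube argument: joint continuity at each (0, x) and a finite subcover of N give one
  -- neighbourhood of 0 in the algebra that works for all of N.
  have h1 : ∀ x : N, ∃ W ∈ 𝓝 (0 : CompletedGroupAlgebra R K), ∃ V ∈ 𝓝 x,
      ∀ a ∈ W, ∀ y ∈ V, a • y ∈ U := by
    intro x
    have hc : Filter.Tendsto (fun z : CompletedGroupAlgebra R K × N => z.1 • z.2)
        (𝓝 (0, x)) (𝓝 0) := by
      have := (continuous_smul (M := CompletedGroupAlgebra R K) (X := N)).tendsto (0, x)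
      simpa using this
    have h2 := hc hU
    rw [nhds_prod_eq, Filter.mem_map, Filter.mem_prod_iff] at h2
    obtain ⟨W, hW, V, hV, h⟩ := h2
    exact ⟨W, hW, V, hV, fun a ha y hy => h (Set.mk_mem_prod ha hy)⟩
  choose W hW V hV h using h1
  obtain ⟨t, ht⟩ := CompactSpace.elim_nhds_subcover V hV
  have h2 : (⋂ x ∈ t, W x) ∈ 𝓝 (0 : CompletedGroupAlgebra R K) :=
    (Filter.biInter_finset_mem t).2 fun x _ => hW x
  obtain ⟨n, hn⟩ := CompletedGroupAlgebra.exists_pow_subset h2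
  refine ⟨n, fun r hr x => ?_⟩
  have hx : x ∈ ⋃ x ∈ t, V x := by rw [ht]; trivial
  obtain ⟨y, hy, hxy⟩ := Set.mem_iUnion₂.1 hx
  rw [← algebraMap_smul (CompletedGroupAlgebra R K) r x]
  exact h y _ (Set.mem_iInter₂.1 (hn r hr) y hy) x hxy

/-- A closed submodule stable under `K` is stable under `R⟦K⟧`. -/
theorem smul_mem_of_isClosed {Z : Submodule R N} (hZ : IsClosed (Z : Set N))
    (h : ∀ (g : K), ∀ x ∈ Z, CompletedGroupAlgebra.of R K g • x ∈ Z)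
    (a : CompletedGroupAlgebra R K) {x : N} (hx : x ∈ Z) : a • x ∈ Z := by
  let Y : AddSubgroup (CompletedGroupAlgebra R K) :=
    Z.toAddSubgroup.comap ((LinearMap.toSpanSingleton (CompletedGroupAlgebra R K) N x).toAddMonoidHom)
  have hY : IsClosed (Y : Set (CompletedGroupAlgebra R K)) :=
    hZ.preimage (f := fun a : CompletedGroupAlgebra R K => a • x)
      (continuous_id.smul continuous_const)
  refine CompletedGroupAlgebra.mem_of_isClosed hY (fun r g => ?_) a
  change (r • CompletedGroupAlgebra.of R K g) • x ∈ Z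
  rw [smul_assoc]
  exact Z.smul_mem r (h g x hx)

end Action


open Topology

/-! ### Topology on duals and on continuous equivariant maps. -/

section LinDualTopology

variable {O T Q : Type u} [CommRing O] [AddCommGroup T] [Module O T] [AddCommGroup Q] [Module O Q]
  [TopologicalSpace Q]

namespace LinDual

theorem continuous_iff {Y : Type*} [TopologicalSpace Y] {f : Y → LinDual O T Q} :
    Continuous f ↔ ∀ t, Continuous fun y => f y t := by
  rw [continuous_induced_rng, continuous_pi_iff]
  rfl

theorem continuous_apply (t : T) : Continuous fun f : LinDual O T Q => f t :=
  continuous_iff.1 continuous_id t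

instance [T2Space Q] : T2Space (LinDual O T Q) :=
  T2Space.of_injective_continuous (f := fun (f : LinDual O T Q) (t : T) => f t)
    (fun _ _ h => ext fun t => congrFun h t) continuous_induced_dom

/-- Linearity is a closed condition in the compact product of copies of O. -/
instance [TopologicalSpace O] [IsTopologicalRing O] [CompactSpace O] [T2Space O] :
    CompactSpace (LinDual O T O) := by
  have hr : Set.range (fun (f : LinDual O T O) (t : T) => f t) =
      (⋂ (s : T) (t : T), {f : T → O | f (s + t) = f s + f t}) ∩
        ⋂ (a : O) (t : T), {f : T → O | f (a • t) = a * f t} := by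
    ext f
    simp only [Set.mem_range, Set.mem_inter_iff, Set.mem_iInter, Set.mem_ofPred_eq]
    constructor
    · rintro ⟨φ, rfl⟩
      exact ⟨fun s t => map_add φ s t, fun a t => LinDual.map_smul φ a t⟩
    · rintro ⟨h1, h2⟩
      exact ⟨mk ⟨⟨f, h1⟩, h2⟩, rfl⟩
  have he : IsClosedEmbedding (fun (f : LinDual O T O) (t : T) => f t) := by
    refine ⟨⟨⟨rfl⟩, fun _ _ h => ext fun t => congrFun h t⟩, ?_⟩
    rw [hr]
    refine IsClosed.inter (isClosed_iInter fun s => isClosed_iInter fun t => ?_)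
      (isClosed_iInter fun s => isClosed_iInter fun t => ?_)
    · exact isClosed_eq (_root_.continuous_apply (s + t))
        ((_root_.continuous_apply s).add (_root_.continuous_apply t))
    · exact isClosed_eq (_root_.continuous_apply _)
        (continuous_const.mul (_root_.continuous_apply t))
  exact he.compactSpace

instance [TopologicalSpace O] [IsTopologicalRing O] : ContinuousSMul O (LinDual O T O) where
  continuous_smul := by
    refine continuous_iff.2 fun t => ?_
    have : (fun z : O × LinDual O T O => (z.1 • z.2) t) = fun z => z.1 * z.2 t := by
      ext z
      exact LinDual.map_smul z.2 z.1 t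
    rw [this]
    exact continuous_fst.mul ((continuous_apply t).comp continuous_snd)

theorem exists_eq_smul [IsDomain O] {a : O} (ha : a ≠ 0) (φ : LinDual O T O) (h : ∀ t, a ∣ φ t) :
    ∃ φ', φ = a • φ' := by
  choose f hf using h
  refine ⟨LinDual.mk ⟨⟨f, fun x y => ?_⟩, fun b x => ?_⟩, ?_⟩
  · apply mul_left_cancel₀ ha
    rw [← hf, map_add, mul_add, hf, hf]
  · apply mul_left_cancel₀ ha
    change a * f _ = a * (b * f x)
    rw [← hf, LinDual.map_smul, hf, smul_eq_mul]
    ring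
  · ext x
    rw [LinDual.smul_apply, LinDual.map_smul]
    exact hf x

end LinDual

end LinDualTopology

section HomCont

variable {O R K N : Type u} [CommRing O] [CommRing R] [IsLocalRing R] [Algebra O R]
  [Group K] [TopologicalSpace K]
  [AddCommGroup N] [Module (CompletedGroupAlgebra R K) N]
  [Module R N] [IsScalarTower R (CompletedGroupAlgebra R K) N] [Module O N] [IsScalarTower O R N]
  [TopologicalSpace N] {X : Type u} [AddCommGroup X] [Module O X] [TopologicalSpace X] [IsTopologicalAddGroup X]
  {ρX : Representation O K X}

omit [TopologicalSpace N] in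
theorem groupRep_apply (g : K) (n : N) :
    groupRep O R K N g n = CompletedGroupAlgebra.of R K g • n := rfl

namespace HomCont

instance : FunLike (HomCont O R K N X ρX) N X where
  coe f := f.1
  coe_injective _ _ h := Subtype.ext (LinearMap.ext fun n => congrFun h n)

instance : AddMonoidHomClass (HomCont O R K N X ρX) N X where
  map_add f := f.1.map_add
  map_zero f := f.1.map_zero

/-- A continuous equivariant map, as an element of `Hom^cont`. -/
def mk (f : N →ₗ[O] X) (hf : Continuous f) (hg : ∀ g n, f (groupRep O R K N g n) = ρX g (f n)) :
    HomCont O R K N X ρX := (⟨f, hf, hg⟩ : homContSubgroup O R K N X ρX)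

/-- An element of `Hom^cont`, as a linear map. -/
def toLin (f : HomCont O R K N X ρX) : N →ₗ[O] X := f.1

theorem mk_apply (f : N →ₗ[O] X) (hf : Continuous f)
    (hg : ∀ g n, f (groupRep O R K N g n) = ρX g (f n)) (n : N) :
    (mk f hf hg : HomCont O R K N X ρX) n = f n := rfl

theorem ext {f f' : HomCont O R K N X ρX} (h : ∀ n, f n = f' n) : f = f' :=
  DFunLike.ext _ _ h

theorem continuous (f : HomCont O R K N X ρX) : Continuous f := f.2.1

theorem apply_groupRep (f : HomCont O R K N X ρX) (g : K) (n : N) :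
    f (groupRep O R K N g n) = ρX g (f n) := f.2.2 g n

theorem map_smul (f : HomCont O R K N X ρX) (a : O) (n : N) : f (a • n) = a • f n :=
  f.1.map_smul a n

theorem add_apply (f f' : HomCont O R K N X ρX) (n : N) : (f + f') n = f n + f' n := rfl

variable [TopologicalSpace O] [ContinuousSMul (CompletedGroupAlgebra R K) N]

omit [TopologicalSpace O] in
theorem smul_apply (r : R) (f : HomCont O R K N X ρX) (n : N) : (r • f) n = f (r • n) := rfl

omit [TopologicalSpace O] in
theorem smul_apply' (a : O) (f : HomCont O R K N X ρX) (n : N) : (a • f) n = a • f n := by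
  change f (algebraMap O R a • n) = _
  rw [algebraMap_smul, map_smul]

/-- Multiplication by a is a closed embedding of the compact Hausdorff space X, so the pointwise
quotient is again continuous. -/
theorem exists_eq_smul [CompactSpace X] [T2Space X] [ContinuousSMul O X] {a : O}
    (ha : ∀ x : X, a • x = 0 → x = 0) (f : HomCont O R K N X ρX) (h : ∀ n, ∃ y, f n = a • y) :
    ∃ f', f = a • f' := by
  have hinj : Function.Injective fun x : X => a • x := by
    intro x y hxy
    exact sub_eq_zero.1 (ha _ (by rw [smul_sub]; exact sub_eq_zero.2 hxy))
  choose F hF using h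
  have he : IsClosedEmbedding fun x : X => a • x :=
    (continuous_const_smul a).isClosedEmbedding hinj
  refine ⟨mk ⟨⟨F, fun x y => hinj ?_⟩, fun b x => hinj ?_⟩ ?_ fun g n => hinj ?_, ?_⟩
  · change a • F (x + y) = a • (F x + F y)
    rw [smul_add, ← hF, ← hF, ← hF, map_add]
  · change a • F _ = a • b • F x
    rw [smul_comm, ← hF, ← hF, map_smul]
  · rw [he.isInducing.continuous_iff]
    have : (fun x : X => a • x) ∘ F = f := funext fun n => (hF n).symm
    change Continuous ((fun x : X => a • x) ∘ F)
    rw [this]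
    exact f.continuous
  · change a • F _ = a • ρX g (F n)
    rw [← _root_.map_smul, ← hF, ← hF, f.apply_groupRep]
  · refine ext fun n => ?_
    rw [smul_apply', mk_apply]
    exact hF n

end HomCont

end HomCont

/-! ### Admissibility of the maps from N to a dual lattice. -/

section Admissible

variable {O R K N : Type u} [CommRing O] [IsDomain O] [IsDiscreteValuationRing O]
  [CommRing R] [IsLocalRing R] [Algebra O R]
  [Group K] [TopologicalSpace K] [IsTopologicalGroup K]
  [AddCommGroup N] [Module (CompletedGroupAlgebra R K) N]
  [Module R N] [IsScalarTower R (CompletedGroupAlgebra R K) N] [Module O N] [IsScalarTower O R N]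
  [TopologicalSpace N] [IsTopologicalAddGroup N] [TopologicalSpace O] [IsTopologicalRing O]
  [CompactSpace O] [T2Space O]
  [ContinuousSMul (CompletedGroupAlgebra R K) N]
  {Θ : Type u} [AddCommGroup Θ] [Module O Θ] {ρ : Representation O K Θ} {ϖ : O}

omit [IsDomain O] [IsDiscreteValuationRing O] [T2Space O] [CompactSpace O] in
-- A small change of g moves g⁻¹ t by a multiple of ϖ ^ j, and O-linear functionals respect this
-- divisibility uniformly; the remaining variation is pointwise convergence of the functional.
theorem continuous_contragredient
    (hO : (𝓝 (0 : O)).HasBasis (fun _ : ℕ => True) fun j => {a | ϖ ^ j ∣ a})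
    (hρ : ∀ t j, ∀ᶠ g in 𝓝 (1 : K), ∃ t', ρ g t - t = ϖ ^ j • t') :
    Continuous fun z : K × LinDual O Θ O => contragredient O O ρ z.1 z.2 := by
  refine LinDual.continuous_iff.2 fun t => continuous_iff_continuousAt.2 fun z₀ => ?_
  have h0 : ∀ z : K × LinDual O Θ O, (contragredient O O ρ z.1 z.2) t =
      z.2 (ρ (z.1⁻¹ * z₀.1) (ρ z₀.1⁻¹ t) - ρ z₀.1⁻¹ t) + z.2 (ρ z₀.1⁻¹ t) := by
    intro z
    rw [← map_add, sub_add_cancel, ← Module.End.mul_apply, ← map_mul, mul_inv_cancel_right]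
    rfl
  have hA : Filter.Tendsto (fun z : K × LinDual O Θ O =>
      z.2 (ρ (z.1⁻¹ * z₀.1) (ρ z₀.1⁻¹ t) - ρ z₀.1⁻¹ t)) (𝓝 z₀) (𝓝 0) := by
    rw [hO.tendsto_right_iff]
    intro j _
    have hc : Filter.Tendsto (fun z : K × LinDual O Θ O => z.1⁻¹ * z₀.1) (𝓝 z₀) (𝓝 1) := by
      have : Continuous fun z : K × LinDual O Θ O => z.1⁻¹ * z₀.1 := by fun_prop
      have := this.tendsto z₀
      simpa using this
    filter_upwards [hc.eventually (hρ (ρ z₀.1⁻¹ t) j)] with z hz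
    obtain ⟨t', ht'⟩ := hz
    rw [ht', LinDual.map_smul]
    exact Dvd.intro _ rfl
  have hB : Filter.Tendsto (fun z : K × LinDual O Θ O => z.2 (ρ z₀.1⁻¹ t)) (𝓝 z₀)
      (𝓝 (z₀.2 (ρ z₀.1⁻¹ t))) :=
    ((LinDual.continuous_apply _).comp continuous_snd).tendsto z₀
  have := hA.add hB
  rw [zero_add] at this
  refine this.congr' (Filter.Eventually.of_forall fun z => (h0 z).symm)

omit [IsDiscreteValuationRing O] [IsTopologicalGroup K] [IsTopologicalAddGroup N] in
theorem HomCont.exists_eq_smul_of_dvd {a : O} (ha : a ≠ 0)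
    (f : HomCont O R K N (LinDual O Θ O) (contragredient O O ρ)) (h : ∀ n t, a ∣ f n t) :
    ∃ f', f = a • f' := by
  refine HomCont.exists_eq_smul (fun φ hφ => LinDual.ext fun t => ?_) f
    fun n => LinDual.exists_eq_smul ha _ (h n)
  have := congrArg (fun φ : LinDual O Θ O => φ t) hφ
  rw [LinDual.smul_apply, LinDual.map_smul] at this
  exact (mul_eq_zero.1 this).resolve_left ha

theorem eq_of_forall_pow_dvd {O : Type u} [CommRing O] [IsDomain O] [IsDiscreteValuationRing O]
    {ϖ : O} (hϖ : Irreducible ϖ) {a b : O} (c : ℕ → O) (ha : ∀ k, ϖ ^ k ∣ a - c k)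
    (hb : ∀ k, ϖ ^ k ∣ b - c k) : a = b := by
  refine sub_eq_zero.1 (eq_zero_of_forall_pow_dvd hϖ fun k => ?_)
  have h := dvd_sub (ha k) (hb k)
  rwa [sub_sub_sub_cancel_right] at h

theorem LinDual.exists_adic_sum {O T : Type u} [CommRing O] [IsDomain O]
    [IsDiscreteValuationRing O] {ϖ : O} (hϖ : Irreducible ϖ) [IsPrecomplete (Ideal.span {ϖ}) O]
    [AddCommGroup T] [Module O T] (u : ℕ → LinDual O T O) :
    ∃ s : LinDual O T O, ∀ t k, ϖ ^ k ∣ s t - ∑ i ∈ Finset.range k, ϖ ^ i * u i t := by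
  choose s hs using fun t : T => BreuilMezard.exists_adic_sum (ϖ := ϖ) fun i => u i t
  refine ⟨LinDual.mk ⟨⟨s, fun x y => ?_⟩, fun a x => ?_⟩, hs⟩
  · refine eq_of_forall_pow_dvd hϖ _ (hs (x + y)) fun k => ?_
    have h := dvd_add (hs x k) (hs y k)
    rw [← add_sub_add_comm] at h
    simpa only [map_add, mul_add, Finset.sum_add_distrib] using h
  · refine eq_of_forall_pow_dvd hϖ _ (hs (a • x)) fun k => ?_
    have h := Dvd.dvd.mul_left (hs x k) a
    rw [mul_sub, Finset.mul_sum] at h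
    simpa only [LinDual.map_smul, smul_eq_mul, mul_left_comm a, RingHom.id_apply] using h

omit [IsTopologicalGroup K] [IsTopologicalAddGroup N] [ContinuousSMul (CompletedGroupAlgebra R K) N] in
-- The series is summed pointwise. Its tails are uniformly divisible by powers of ϖ, so the sum is
-- continuous, and uniqueness of ϖ-adic limits transfers linearity and equivariance.
theorem HomCont.exists_adic_sum (hϖ : Irreducible ϖ)
    (hO : (𝓝 (0 : O)).HasBasis (fun _ : ℕ => True) fun j => {a | ϖ ^ j ∣ a})
    (f : ℕ → HomCont O R K N (LinDual O Θ O) (contragredient O O ρ)) :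
    ∃ F : HomCont O R K N (LinDual O Θ O) (contragredient O O ρ),
      ∀ n t k, ϖ ^ k ∣ F n t - ∑ i ∈ Finset.range k, ϖ ^ i * f i n t := by
  have := isPrecomplete_of_compactSpace (O := O) (ϖ := ϖ)
  choose s hs using fun n : N => LinDual.exists_adic_sum hϖ fun i => f i n
  let F : N →ₗ[O] LinDual O Θ O :=
    { toFun := s
      map_add' := fun x y => LinDual.ext fun t => by
        refine eq_of_forall_pow_dvd hϖ _ (hs (x + y) t) fun k => ?_
        have h := dvd_add (hs x t k) (hs y t k)
        rw [← add_sub_add_comm] at h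
        simpa only [map_add, LinDual.add_apply, mul_add, Finset.sum_add_distrib] using h
      map_smul' := fun a x => LinDual.ext fun t => by
        refine eq_of_forall_pow_dvd hϖ _ (hs (a • x) t) fun k => ?_
        have h := Dvd.dvd.mul_left (hs x t k) a
        rw [mul_sub, Finset.mul_sum] at h
        simpa only [HomCont.map_smul, LinDual.smul_apply, LinDual.map_smul, smul_eq_mul,
          mul_left_comm a, RingHom.id_apply] using h }
  have hF : ∀ n, F n = s n := fun _ => rfl
  have hcont : Continuous F := by
    refine LinDual.continuous_iff.2 fun t => continuous_iff_continuousAt.2 fun n₀ => ?_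
    rw [ContinuousAt, ← tendsto_sub_nhds_zero_iff, hO.tendsto_right_iff]
    intro j _
    have hc : Continuous fun n : N => ∑ i ∈ Finset.range j, ϖ ^ i * f i n t :=
      continuous_finsetSum _ fun i _ => continuous_const.mul
        ((LinDual.continuous_apply t).comp (f i).continuous)
    have h1 := hc.tendsto n₀
    rw [← tendsto_sub_nhds_zero_iff, hO.tendsto_right_iff] at h1
    filter_upwards [h1 j trivial] with n hn
    have h2 := dvd_add (dvd_sub (hs n t j) (hs n₀ t j)) hn
    have h3 : ∀ a b c d : O, a - b - (c - d) + (b - d) = a - c := by intros; ring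
    rwa [h3] at h2
  refine ⟨HomCont.mk F hcont fun g n => LinDual.ext fun t => ?_, hs⟩
  rw [hF, hF]
  refine eq_of_forall_pow_dvd hϖ _ (hs _ t) fun k => ?_
  have h := hs n (ρ g⁻¹ t) k
  simp only [HomCont.apply_groupRep]
  exact h

omit [IsTopologicalGroup K] [IsTopologicalAddGroup N] in
-- The solution is F m = ∑ ϖⁱ f (m + i).
theorem HomCont.exists_complete (hϖ : Irreducible ϖ)
    (hO : (𝓝 (0 : O)).HasBasis (fun _ : ℕ => True) fun j => {a | ϖ ^ j ∣ a})
    (f : ℕ → HomCont O R K N (LinDual O Θ O) (contragredient O O ρ)) :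
    ∃ F : ℕ → HomCont O R K N (LinDual O Θ O) (contragredient O O ρ),
      ∀ n, F n = f n + ϖ • F (n + 1) := by
  choose F hF using fun m : ℕ => HomCont.exists_adic_sum hϖ hO fun i => f (m + i)
  refine ⟨F, fun m => HomCont.ext fun n => LinDual.ext fun t => ?_⟩
  refine eq_of_forall_pow_dvd hϖ _
    (fun k => (pow_dvd_pow ϖ (Nat.le_succ k)).trans (hF m n t (k + 1))) fun k => ?_
  have h1 := Dvd.dvd.mul_left (hF (m + 1) n t k) ϖ
  have h0 : (f m + ϖ • F (m + 1)) n t = f m n t + ϖ * F (m + 1) n t := by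
    rw [HomCont.add_apply, HomCont.smul_apply', LinDual.add_apply, LinDual.smul_apply,
      LinDual.map_smul, smul_eq_mul]
  have h2 : ∑ i ∈ Finset.range (k + 1), ϖ ^ i * f (m + i) n t =
      f m n t + ϖ * ∑ i ∈ Finset.range k, ϖ ^ i * f (m + 1 + i) n t := by
    rw [Finset.sum_range_succ', pow_zero, one_mul, add_zero, add_comm, Finset.mul_sum]
    congr 1
    refine Finset.sum_congr rfl fun i _ => ?_
    rw [pow_succ', mul_assoc, add_assoc, add_comm 1 i]
  rw [h0, h2, add_sub_add_left_eq_sub, ← mul_sub]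
  exact h1

omit [IsDomain O] [IsDiscreteValuationRing O] [IsTopologicalGroup K] [IsTopologicalAddGroup N] in
/-- If all multiples of `g` by the maximal ideal of `R` are divisible by `ϖ`, and the values of `g`
at generators of `N` are divisible by `ϖ`, then `g` is divisible by `ϖ`. -/
theorem HomCont.dvd_apply_of_generators
    (hk : Function.Surjective ((IsLocalRing.residue R).comp (algebraMap O R)))
    (g : HomCont O R K N (LinDual O Θ O) (contragredient O O ρ))
    (hg : ∀ r ∈ IsLocalRing.maximalIdeal R, ∃ y, r • g = ϖ • y)
    {s : Set N} (hs : Submodule.span (CompletedGroupAlgebra R K) s = ⊤)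
    (h : ∀ n ∈ s, ∀ t, ϖ ∣ g n t) (n : N) (t : Θ) : ϖ ∣ g n t := by
  -- Since O surjects onto the residue field of R, every r is a scalar plus an element of 𝔪, and 𝔪 g
  -- is divisible by ϖ; hence Z is R-stable. Being closed and K-stable, it is stable under the
  -- completed group algebra.
  let Z : Submodule R N :=
    { carrier := {n | ∀ t, ϖ ∣ g n t}
      zero_mem' := fun t => by rw [map_zero]; exact dvd_zero _
      add_mem' := fun {a b} ha hb t => by
        rw [map_add, LinDual.add_apply]; exact dvd_add (ha t) (hb t)
      smul_mem' := fun r n hn t => by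
        obtain ⟨a, ha⟩ := hk (IsLocalRing.residue R r)
        have h1 : r - algebraMap O R a ∈ IsLocalRing.maximalIdeal R := by
          rw [← IsLocalRing.residue_eq_zero_iff, map_sub, ← ha]
          exact sub_self _
        obtain ⟨y, hy⟩ := hg _ h1
        have h2 : g (r • n) = ϖ • y n + a • g n := by
          rw [← HomCont.smul_apply', ← hy, HomCont.smul_apply, ← HomCont.map_smul, ← map_add,
            ← algebraMap_smul R a n, ← add_smul, sub_add_cancel]
        rw [h2, LinDual.add_apply, LinDual.smul_apply, LinDual.smul_apply, LinDual.map_smul,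
          LinDual.map_smul]
        exact dvd_add (Dvd.intro _ rfl) (Dvd.dvd.mul_left (hn t) _) }
  have hZ : IsClosed (Z : Set N) := by
    have : (Z : Set N) = ⋂ t, (fun n => g n t) ⁻¹' Set.range (fun b => ϖ * b) := by
      ext n
      simp only [Set.mem_iInter, Set.mem_preimage, Set.mem_range]
      exact forall_congr' fun t => exists_congr fun b => eq_comm
    rw [this]
    refine isClosed_iInter fun t => IsClosed.preimage
      ((LinDual.continuous_apply t).comp g.continuous) ?_
    exact (isCompact_range (continuous_const.mul continuous_id)).isClosed
  have hn : n ∈ Submodule.span (CompletedGroupAlgebra R K) s := by rw [hs]; trivial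
  have hsm := smul_mem_of_isClosed (K := K) hZ (fun k y hy t => by
    rw [← groupRep_apply (O := O), g.apply_groupRep]
    exact hy _)
  suffices h : n ∈ Z from h t
  induction hn using Submodule.span_induction with
  | mem y hy => exact h y hy
  | zero => exact zero_mem _
  | add y z _ _ hy hz => exact add_mem hy hz
  | smul a y _ hy => exact hsm a hy

omit [IsTopologicalGroup K] [IsTopologicalAddGroup N] in
-- The topological nilpotence of 𝔪 is the uniform statement `exists_pow_smul_mem`, tested on
-- generators of Θ. For the finiteness condition, the finite invariant consists of the values modulo
-- ϖ on generators of N and Θ.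
theorem isAdmissible_homCont [CompactSpace N] [Module.Finite (CompletedGroupAlgebra R K) N]
    [Module.Finite O Θ] [Finite (O ⧸ Ideal.span {ϖ})] (hϖ : Irreducible ϖ)
    (hk : Function.Surjective ((IsLocalRing.residue R).comp (algebraMap O R)))
    (hO : (𝓝 (0 : O)).HasBasis (fun _ : ℕ => True) fun j => {a | ϖ ^ j ∣ a}) :
    IsAdmissible R ϖ (HomCont O R K N (LinDual O Θ O) (contragredient O O ρ)) := by
  obtain ⟨l, τ, hτ⟩ := Module.Finite.exists_fin (R := O) (M := Θ)
  have hτ' : ∀ (a : O) (φ : LinDual O Θ O), (∀ i, a ∣ φ (τ i)) → ∀ t, a ∣ φ t := by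
    intro a φ h t
    have ht : t ∈ Submodule.span O (Set.range τ) := by rw [hτ]; trivial
    induction ht using Submodule.span_induction with
    | mem x hx => obtain ⟨i, rfl⟩ := hx; exact h i
    | zero => rw [map_zero]; exact dvd_zero a
    | add x y _ _ hx hy => rw [map_add]; exact dvd_add hx hy
    | smul b x _ hx => rw [LinDual.map_smul]; exact Dvd.dvd.mul_left hx b
  refine ⟨fun f hf => HomCont.ext fun n => LinDual.ext fun t => ?_, fun f j => ?_,
    HomCont.exists_complete hϖ hO, ?_⟩
  · have h1 : (ϖ • f) n t = 0 := by rw [hf]; rfl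
    rw [HomCont.smul_apply', LinDual.smul_apply, LinDual.map_smul] at h1
    exact (mul_eq_zero.1 h1).resolve_left hϖ.ne_zero
  · have hU : {n : N | ∀ i, ϖ ^ j ∣ f n (τ i)} ∈ 𝓝 (0 : N) := by
      have : {n : N | ∀ i, ϖ ^ j ∣ f n (τ i)} = ⋂ i, {n : N | ϖ ^ j ∣ f n (τ i)} := by
        ext; simp
      rw [this, Filter.iInter_mem]
      intro i
      have hc : Continuous fun n : N => f n (τ i) := (LinDual.continuous_apply _).comp f.continuous
      have := hc.tendsto 0
      rw [map_zero, LinDual.zero_apply] at this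
      exact this (hO.mem_of_mem (i := j) trivial)
    obtain ⟨n, hn⟩ := exists_pow_smul_mem (R := R) K hU
    exact ⟨n, fun r hr => HomCont.exists_eq_smul_of_dvd (pow_ne_zero _ hϖ.ne_zero) (r • f)
      fun x => hτ' _ _ (hn r hr x)⟩
  · obtain ⟨q, x, hx⟩ := Module.Finite.exists_fin (R := CompletedGroupAlgebra R K) (M := N)
    refine ⟨Fin q × Fin l → O ⧸ Ideal.span {ϖ}, inferInstance,
      fun f i => Ideal.Quotient.mk _ (f (x i.1) (τ i.2)), fun f f' hf hf' heq => ?_⟩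
    refine HomCont.exists_eq_smul_of_dvd hϖ.ne_zero _
      (HomCont.dvd_apply_of_generators hk (f - f') (fun r hr => ?_) hx ?_)
    · obtain ⟨y, hy⟩ := hf r hr
      obtain ⟨y', hy'⟩ := hf' r hr
      exact ⟨y - y', by rw [smul_sub, hy, hy', smul_sub]⟩
    · rintro _ ⟨i, rfl⟩
      refine hτ' _ _ fun j => ?_
      have := congrFun heq (i, j)
      rwa [Ideal.Quotient.eq, Ideal.mem_span_singleton] at this

end Admissible


open Topology

/-! ### Transposes, and exactness of continuous equivariant maps. -/

namespace LinDual

section DualMap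

variable {O R T T' T'' Q : Type u} [CommRing O] [CommRing R] [Algebra O R]
  [AddCommGroup T] [Module O T] [Module R T] [IsScalarTower O R T]
  [AddCommGroup T'] [Module O T'] [Module R T'] [IsScalarTower O R T']
  [AddCommGroup T''] [Module O T''] [Module R T''] [IsScalarTower O R T'']
  [AddCommGroup Q] [Module O Q]

variable (O Q) in
/-- The transpose of a linear map. -/
def dualMap (i : T →ₗ[R] T') : LinDual O T' Q →ₗ[R] LinDual O T Q where
  toFun φ := mk (φ.toLin ∘ₗ i.restrictScalars O)
  map_add' _ _ := rfl
  map_smul' r φ := ext fun t => congrArg φ (i.map_smul r t).symm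

theorem dualMap_apply (i : T →ₗ[R] T') (φ : LinDual O T' Q) (t : T) :
    dualMap O Q i φ t = φ (i t) := rfl

theorem dualMap_injective {p : T →ₗ[R] T'} (hp : Function.Surjective p) :
    Function.Injective (dualMap O Q p) := by
  intro φ ψ h
  ext t'
  obtain ⟨t, rfl⟩ := hp t'
  exact congrArg (fun f : LinDual O T Q => f t) h

variable {L : Type u} [IsDomain O] [IsDiscreteValuationRing O] [Field L] [Algebra O L]
  [IsFractionRing O L]

theorem dualMap_surjective {i : T →ₗ[R] T'} (hi : Function.Injective i) :
    Function.Surjective (dualMap O (ModInt O L) i) := by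
  intro φ
  obtain ⟨Ψ, hΨ⟩ := exists_extend_modInt (L := L) (i.restrictScalars O) φ.toLin (fun t ht => by
    have : t = 0 := hi (by rw [map_zero]; exact ht)
    rw [this, _root_.map_zero])
  exact ⟨mk Ψ, ext hΨ⟩

theorem dualMap_exact {i : T →ₗ[R] T'} {p : T' →ₗ[R] T''} (h : Function.Exact i p) :
    Function.Exact (dualMap O (ModInt O L) p) (dualMap O (ModInt O L) i) := by
  intro φ
  constructor
  · intro hφ
    obtain ⟨Ψ, hΨ⟩ := exists_extend_modInt (L := L) (p.restrictScalars O) φ.toLin (fun t ht => by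
      obtain ⟨s, rfl⟩ := (h t).1 ht
      exact congrArg (fun f : LinDual O T (ModInt O L) => f s) hφ)
    exact ⟨mk Ψ, ext hΨ⟩
  · rintro ⟨ψ, rfl⟩
    ext t
    rw [dualMap_apply, dualMap_apply, h.apply_apply_eq_zero, _root_.map_zero]
    rfl

end DualMap

end LinDual

section HomContMap

variable {O R K N : Type u} [CommRing O] [CommRing R] [IsLocalRing R] [Algebra O R]
  [Group K] [TopologicalSpace K]
  [AddCommGroup N] [Module (CompletedGroupAlgebra R K) N]
  [Module R N] [IsScalarTower R (CompletedGroupAlgebra R K) N] [Module O N] [IsScalarTower O R N]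
  [TopologicalSpace N] [TopologicalSpace O] [ContinuousSMul (CompletedGroupAlgebra R K) N]
  {X Y Z : Type u} [AddCommGroup X] [Module O X] [TopologicalSpace X] [IsTopologicalAddGroup X]
  [AddCommGroup Y] [Module O Y] [TopologicalSpace Y] [IsTopologicalAddGroup Y]
  [AddCommGroup Z] [Module O Z] [TopologicalSpace Z] [IsTopologicalAddGroup Z]
  {ρX : Representation O K X} {ρY : Representation O K Y} {ρZ : Representation O K Z}

namespace HomCont

variable (R N) in
/-- Composition with a continuous equivariant map. -/
def map (q : X →ₗ[O] Y) (hq : Continuous q) (hg : ∀ g x, q (ρX g x) = ρY g (q x)) :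
    HomCont O R K N X ρX →ₗ[R] HomCont O R K N Y ρY where
  toFun f := mk (q ∘ₗ f.toLin) (hq.comp f.continuous) fun g n => by
    change q (f (groupRep O R K N g n)) = _
    rw [f.apply_groupRep, hg]
    rfl
  map_add' f f' := ext fun n => map_add q (f n) (f' n)
  map_smul' _ _ := rfl

omit [TopologicalSpace O] in
theorem map_apply (q : X →ₗ[O] Y) (hq : Continuous q) (hg : ∀ g x, q (ρX g x) = ρY g (q x))
    (f : HomCont O R K N X ρX) (n : N) : map R N q hq hg f n = q (f n) := rfl

omit [TopologicalSpace O] in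
theorem map_injective {q : X →ₗ[O] Y} (hq : Continuous q) (hg : ∀ g x, q (ρX g x) = ρY g (q x))
    (hi : Function.Injective q) : Function.Injective (map R N q hq hg) := by
  intro f f' h
  exact ext fun n => hi (congrArg (fun φ : HomCont O R K N Y ρY => φ n) h)

/-- Projectivity of N enters the argument only here. -/
theorem map_surjective [ContinuousSMul O X] [ContinuousSMul O Y] [CompactSpace X] [CompactSpace Y]
    [T2Space X] [T2Space Y] (ha : IsProjectivePro O R K N)
    (hX : Continuous fun z : K × X => ρX z.1 z.2) (hY : Continuous fun z : K × Y => ρY z.1 z.2)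
    {q : X →ₗ[O] Y} (hq : Continuous q) (hg : ∀ g x, q (ρX g x) = ρY g (q x))
    (hs : Function.Surjective q) : Function.Surjective (map R N q hq hg) := by
  intro f
  obtain ⟨h, h1, h2⟩ := ha X Y ρX ρY hX hY ⟨q, hq⟩ ⟨f.toLin, f.continuous⟩ hs hg f.apply_groupRep
  exact ⟨mk h.toLinearMap h.continuous h1, ext fun n => DFunLike.congr_fun h2 n⟩

omit [TopologicalSpace O] in
-- Left exactness needs no projectivity: i is a closed embedding, so factoring through it preserves
-- continuity.
theorem map_exact [CompactSpace X] [T2Space Y]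
    {i : X →ₗ[O] Y} (hi : Continuous i) (hgi : ∀ g x, i (ρX g x) = ρY g (i x))
    {p : Y →ₗ[O] Z} (hp : Continuous p) (hgp : ∀ g x, p (ρY g x) = ρZ g (p x))
    (hinj : Function.Injective i) (h : Function.Exact i p) :
    Function.Exact (map R N i hi hgi) (map R N p hp hgp) := by
  intro f
  constructor
  · intro hf
    have h1 : ∀ n, ∃ x, i x = f n := fun n =>
      (h _).1 (congrArg (fun φ : HomCont O R K N Z ρZ => φ n) hf)
    choose F hF using h1
    have he : IsClosedEmbedding i := hi.isClosedEmbedding hinj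
    refine ⟨mk ⟨⟨F, fun x y => hinj ?_⟩, fun b x => hinj ?_⟩ ?_ fun g n => hinj ?_, ext hF⟩
    · rw [_root_.map_add, hF, hF, hF, _root_.map_add]
    · change i (F _) = i (b • F x)
      rw [_root_.map_smul, hF, hF, HomCont.map_smul]
    · rw [he.isInducing.continuous_iff]
      have : i ∘ F = f := funext hF
      change Continuous (i ∘ F)
      rw [this]
      exact f.continuous
    · change i (F _) = i (ρX g (F n))
      rw [hgi, hF, hF, f.apply_groupRep]
  · rintro ⟨f', rfl⟩
    exact ext fun n => h.apply_apply_eq_zero _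

end HomCont

end HomContMap

/-! ### Pontryagin duals of finite smooth representations. -/

section Pontryagin

variable {O L K : Type u} [CommRing O] [IsDomain O] [IsDiscreteValuationRing O] [TopologicalSpace O]
  [IsTopologicalRing O]
  [Field L] [Algebra O L] [IsFractionRing O L] [TopologicalSpace L] [IsTopologicalRing L]
  [Group K] [TopologicalSpace K] [IsTopologicalGroup K] {ϖ : O}
  {X : Type u} [AddCommGroup X] [Module O X]

omit [TopologicalSpace O] [IsTopologicalRing O] [TopologicalSpace L] [IsTopologicalRing L] in
-- All values lie in ϖ⁻¹O/O, which is finite.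
theorem finite_linDual_modInt [Finite X] [Finite (O ⧸ Ideal.span {ϖ})] (hϖ : ϖ ≠ 0)
    (hX : ∀ x : X, ϖ • x = 0) : Finite (LinDual O X (ModInt O L)) := by
  have h1 : (Set.range (divMap L ϖ)).Finite := by
    have : Set.range (divMap L ϖ) ⊆
        Set.range fun q : O ⧸ Ideal.span {ϖ} => divMap L ϖ (Quotient.out q) := by
      rintro _ ⟨a, rfl⟩
      refine ⟨Ideal.Quotient.mk _ a, ?_⟩
      rw [← sub_eq_zero, ← map_sub, divMap_eq_zero hϖ, ← Ideal.mem_span_singleton,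
        ← Ideal.Quotient.eq]
      exact Quotient.out_eq _
    exact (Set.finite_range _).subset this
  have := h1.to_subtype
  refine Finite.of_injective (β := X → Set.range (divMap L ϖ)) (fun φ x => ⟨φ x, ?_⟩) ?_
  · obtain ⟨b, hb⟩ := exists_smul_of_modInt_smul_eq_zero (x := φ x) hϖ
      (by rw [← LinDual.map_smul, hX, map_zero])
    exact ⟨b, by rw [hb, divMap_apply]⟩
  · intro φ ψ h
    exact LinDual.ext fun x => congrArg Subtype.val (congrFun h x)

omit [IsDomain O] [IsDiscreteValuationRing O] [TopologicalSpace O]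
  [IsTopologicalRing O] [IsFractionRing O L] [IsTopologicalRing L] in
theorem discreteTopology_linDual [DiscreteTopology (ModInt O L)] [Finite X] :
    DiscreteTopology (LinDual O X (ModInt O L)) :=
  DiscreteTopology.of_continuous_injective
    (f := fun (f : LinDual O X (ModInt O L)) (t : X) => f t) continuous_induced_dom
    fun _ _ h => LinDual.ext fun t => congrFun h t

omit [IsDomain O] [IsDiscreteValuationRing O] [IsFractionRing O L] [IsTopologicalRing L] in
-- Scalars congruent modulo ϖ act in the same way, so the action is locally constant in the scalar.
theorem continuousSMul_linDual (hO : {a : O | ϖ ∣ a} ∈ 𝓝 0) (hX : ∀ x : X, ϖ • x = 0) :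
    ContinuousSMul O (LinDual O X (ModInt O L)) where
  continuous_smul := by
    refine LinDual.continuous_iff.2 fun t => continuous_iff_continuousAt.2 fun z₀ => ?_
    have h1 : ∀ᶠ z : O × LinDual O X (ModInt O L) in 𝓝 z₀, z.2 (z₀.1 • t) = (z.1 • z.2) t := by
      have hc : Filter.Tendsto (fun z : O × LinDual O X (ModInt O L) => z₀.1 - z.1) (𝓝 z₀) (𝓝 0) := by
        have : Continuous fun z : O × LinDual O X (ModInt O L) => z₀.1 - z.1 := by fun_prop
        simpa using this.tendsto z₀
      filter_upwards [hc hO] with z hz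
      obtain ⟨c, hc⟩ : ∃ c, z₀.1 - z.1 = ϖ * c := hz
      rw [LinDual.smul_apply, ← sub_eq_zero, ← map_sub, ← sub_smul, hc, mul_comm, mul_smul, hX,
        smul_zero, map_zero]
    exact (((LinDual.continuous_apply _).comp continuous_snd).tendsto z₀).congr' h1

omit [IsDomain O] [IsDiscreteValuationRing O] [TopologicalSpace O]
  [IsTopologicalRing O] [IsFractionRing O L] [IsTopologicalRing L] in
theorem continuous_contragredient_modInt {ρ : Representation O K X}
    (hρ : ∀ x, ∀ᶠ g in 𝓝 (1 : K), ρ g x = x) :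
    Continuous fun z : K × LinDual O X (ModInt O L) =>
      contragredient O (ModInt O L) ρ z.1 z.2 := by
  refine LinDual.continuous_iff.2 fun t => continuous_iff_continuousAt.2 fun z₀ => ?_
  have h1 : ∀ᶠ z : K × LinDual O X (ModInt O L) in 𝓝 z₀, z.2 (ρ z₀.1⁻¹ t) =
      (contragredient O (ModInt O L) ρ z.1 z.2) t := by
    have hc : Filter.Tendsto (fun z : K × LinDual O X (ModInt O L) => z.1⁻¹ * z₀.1) (𝓝 z₀) (𝓝 1) := by
      have : Continuous fun z : K × LinDual O X (ModInt O L) => z.1⁻¹ * z₀.1 := by fun_prop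
      simpa using this.tendsto z₀
    filter_upwards [hc.eventually (hρ (ρ z₀.1⁻¹ t))] with z hz
    change _ = z.2 (ρ z.1⁻¹ t)
    rw [← Module.End.mul_apply, ← map_mul, mul_inv_cancel_right] at hz
    rw [hz]
  exact (((LinDual.continuous_apply _).comp continuous_snd).tendsto z₀).congr' h1

end Pontryagin

/-! ### Exactness of M(·) and reduction of M(Θ) modulo ϖ. -/

section Exactness

variable {O R K N L : Type u} [CommRing O] [IsDomain O] [IsDiscreteValuationRing O]
  [CommRing R] [IsLocalRing R] [Algebra O R]
  [Group K] [TopologicalSpace K] [IsTopologicalGroup K]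
  [AddCommGroup N] [Module (CompletedGroupAlgebra R K) N]
  [Module R N] [IsScalarTower R (CompletedGroupAlgebra R K) N] [Module O N] [IsScalarTower O R N]
  [TopologicalSpace N] [TopologicalSpace O] [IsTopologicalRing O]
  [ContinuousSMul (CompletedGroupAlgebra R K) N]
  [Field L] [Algebra O L] [IsFractionRing O L] [TopologicalSpace L] [IsTopologicalRing L]
  [DiscreteTopology (ModInt O L)] {ϖ : O} [Finite (O ⧸ Ideal.span {ϖ})]

/-- The functor `M(·)` is exact on finite smooth representations killed by `ϖ`. -/
theorem exists_exact_mSmooth (ha : IsProjectivePro O R K N) (hϖ : Irreducible ϖ)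
    (hO : {a : O | ϖ ∣ a} ∈ 𝓝 0)
    {X X' X'' : Type u} [AddCommGroup X] [Module O X] [AddCommGroup X'] [Module O X']
    [AddCommGroup X''] [Module O X''] [Finite X] [Finite X'] [Finite X'']
    (hX : ∀ x : X, ϖ • x = 0) (hX' : ∀ x : X', ϖ • x = 0)
    {ρ : Representation O K X} {ρ' : Representation O K X'} {ρ'' : Representation O K X''}
    (hρ : ∀ x, ∀ᶠ g in 𝓝 (1 : K), ρ g x = x) (hρ' : ∀ x, ∀ᶠ g in 𝓝 (1 : K), ρ' g x = x)
    (i : X' →ₗ[O] X) (hgi : ∀ g x, i (ρ' g x) = ρ g (i x)) (hi : Function.Injective i)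
    (p : X →ₗ[O] X'') (hgp : ∀ g x, p (ρ g x) = ρ'' g (p x)) (hp : Function.Surjective p)
    (hip : Function.Exact i p) :
    ∃ (a : MSmooth O R K N L ρ' →ₗ[R] MSmooth O R K N L ρ)
      (b : MSmooth O R K N L ρ →ₗ[R] MSmooth O R K N L ρ''),
      Function.Injective a ∧ Function.Surjective b ∧ Function.Exact a b := by
  have := finite_linDual_modInt (L := L) hϖ.ne_zero hX
  have := finite_linDual_modInt (L := L) hϖ.ne_zero hX'
  have hX'' : ∀ x : X'', ϖ • x = 0 := fun x => by
    obtain ⟨y, rfl⟩ := hp x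
    rw [← map_smul, hX, map_zero]
  have := finite_linDual_modInt (L := L) hϖ.ne_zero hX''
  have := discreteTopology_linDual (O := O) (L := L) (X := X)
  have := discreteTopology_linDual (O := O) (L := L) (X := X')
  have := discreteTopology_linDual (O := O) (L := L) (X := X'')
  have := continuousSMul_linDual (L := L) hO hX
  have := continuousSMul_linDual (L := L) hO hX'
  let j : LinDual O X'' (ModInt O L) →ₗ[O] LinDual O X (ModInt O L) :=
    LinDual.dualMap (R := O) O (ModInt O L) p
  let q : LinDual O X (ModInt O L) →ₗ[O] LinDual O X' (ModInt O L) :=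
    LinDual.dualMap (R := O) O (ModInt O L) i
  have hj : Continuous j := continuous_of_discreteTopology
  have hq : Continuous q := continuous_of_discreteTopology
  have hgj : ∀ g x, j (contragredient O (ModInt O L) ρ'' g x) =
      contragredient O (ModInt O L) ρ g (j x) := fun g x => LinDual.ext fun t =>
    congrArg x (hgp g⁻¹ t).symm
  have hgq : ∀ g x, q (contragredient O (ModInt O L) ρ g x) =
      contragredient O (ModInt O L) ρ' g (q x) := fun g x => LinDual.ext fun t =>
    congrArg x (hgi g⁻¹ t).symm
  have hji : Function.Injective j := LinDual.dualMap_injective hp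
  have hqs : Function.Surjective q := LinDual.dualMap_surjective hi
  have hjq : Function.Exact j q := LinDual.dualMap_exact hip
  refine ⟨LinDual.dualMap O (ModInt O L) (HomCont.map R N q hq hgq),
    LinDual.dualMap O (ModInt O L) (HomCont.map R N j hj hgj), ?_, ?_, ?_⟩
  · exact LinDual.dualMap_injective (HomCont.map_surjective ha
      (continuous_contragredient_modInt hρ) (continuous_contragredient_modInt hρ') hq hgq hqs)
  · exact LinDual.dualMap_surjective (HomCont.map_injective hj hgj hji)
  · exact LinDual.dualMap_exact (HomCont.map_exact hj hgj hq hgq hji hjq)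

omit [IsDomain O] [IsDiscreteValuationRing O] [IsTopologicalGroup K] [TopologicalSpace O]
  [IsTopologicalRing O] [IsFractionRing O L] [DiscreteTopology (ModInt O L)] in
/-- An equivariant isomorphism of representations induces an isomorphism on `M(·)`. -/
theorem nonempty_mSmooth_equiv
    {X X' : Type u} [AddCommGroup X] [Module O X] [AddCommGroup X'] [Module O X']
    {ρ : Representation O K X} {ρ' : Representation O K X'}
    (e : X' ≃ₗ[O] X) (hge : ∀ g x, e (ρ' g x) = ρ g (e x)) :
    Nonempty (MSmooth O R K N L ρ' ≃ₗ[R] MSmooth O R K N L ρ) := by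
  have hge' : ∀ g x, e.symm (ρ g x) = ρ' g (e.symm x) := fun g x => by
    rw [LinearEquiv.symm_apply_eq, hge, LinearEquiv.apply_symm_apply]
  let j : LinDual O X (ModInt O L) →ₗ[O] LinDual O X' (ModInt O L) :=
    LinDual.dualMap (R := O) O (ModInt O L) e.toLinearMap
  let q : LinDual O X' (ModInt O L) →ₗ[O] LinDual O X (ModInt O L) :=
    LinDual.dualMap (R := O) O (ModInt O L) e.symm.toLinearMap
  have hj : Continuous j := LinDual.continuous_iff.2 fun t => LinDual.continuous_apply (e t)
  have hq : Continuous q := LinDual.continuous_iff.2 fun t => LinDual.continuous_apply (e.symm t)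
  have hgj : ∀ g x, j (contragredient O (ModInt O L) ρ g x) =
      contragredient O (ModInt O L) ρ' g (j x) := fun g x => LinDual.ext fun t =>
    congrArg x (hge g⁻¹ t).symm
  have hgq : ∀ g x, q (contragredient O (ModInt O L) ρ' g x) =
      contragredient O (ModInt O L) ρ g (q x) := fun g x => LinDual.ext fun t =>
    congrArg x (hge' g⁻¹ t).symm
  refine ⟨LinearEquiv.ofLinearMap
    (LinDual.dualMap O (ModInt O L) (HomCont.map R N j hj hgj))
    (LinDual.dualMap O (ModInt O L) (HomCont.map R N q hq hgq)) ?_ ?_⟩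
  · refine LinearMap.ext fun φ => LinDual.ext fun f => congrArg φ ?_
    refine HomCont.ext fun n => LinDual.ext fun t => congrArg (f n) ?_
    exact e.apply_symm_apply t
  · refine LinearMap.ext fun φ => LinDual.ext fun f => congrArg φ ?_
    refine HomCont.ext fun n => LinDual.ext fun t => congrArg (f n) ?_
    exact e.symm_apply_apply t

omit [IsDomain O] [IsDiscreteValuationRing O] [IsTopologicalGroup K] [TopologicalSpace O]
  [IsTopologicalRing O] [IsFractionRing O L] [DiscreteTopology (ModInt O L)] in
theorem subsingleton_mSmooth {X : Type u} [AddCommGroup X] [Module O X] [Subsingleton X]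
    (ρ : Representation O K X) : Subsingleton (MSmooth O R K N L ρ) := by
  refine ⟨fun φ ψ => LinDual.ext fun f => ?_⟩
  have : f = 0 := HomCont.ext fun n => LinDual.ext fun t => by
    rw [Subsingleton.elim t 0, map_zero, map_zero]
  rw [this, map_zero, map_zero]

omit [IsDomain O] [IsDiscreteValuationRing O] [TopologicalSpace O] [IsTopologicalRing O]
  [Finite (O ⧸ Ideal.span {ϖ})] in
theorem mem_span_singleton_smul_top {Θ : Type u} [AddCommGroup Θ] [Module O Θ] {x : Θ} :
    x ∈ (Ideal.span {ϖ} • ⊤ : Submodule O Θ) ↔ ∃ y, x = ϖ • y := by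
  rw [Submodule.ideal_span_singleton_smul, Submodule.mem_smul_pointwise_iff_exists]
  simp only [Submodule.mem_top, true_and, eq_comm]

omit [IsDomain O] [IsDiscreteValuationRing O] [TopologicalSpace O] [IsTopologicalRing O]
  [Finite (O ⧸ Ideal.span {ϖ})] in
theorem smul_reduction_eq_zero {Θ : Type u} [AddCommGroup Θ] [Module O Θ]
    (x : Θ ⧸ (Ideal.span {ϖ} • ⊤ : Submodule O Θ)) : ϖ • x = 0 := by
  obtain ⟨x, rfl⟩ := Submodule.Quotient.mk_surjective _ x
  rw [← Submodule.Quotient.mk_smul, Submodule.Quotient.mk_eq_zero, mem_span_singleton_smul_top]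
  exact ⟨x, rfl⟩

omit [IsDomain O] [IsDiscreteValuationRing O] [TopologicalSpace O] [IsTopologicalRing O]
  [Finite (O ⧸ Ideal.span {ϖ})] [IsTopologicalGroup K] in
theorem eventually_reduction_apply_eq {Θ : Type u} [AddCommGroup Θ] [Module O Θ]
    {ρ : Representation O K Θ} (hρ : ∀ t j, ∀ᶠ g in 𝓝 (1 : K), ∃ t', ρ g t - t = ϖ ^ j • t')
    (x : Θ ⧸ (Ideal.span {ϖ} • ⊤ : Submodule O Θ)) :
    ∀ᶠ g in 𝓝 (1 : K), reduction ρ ϖ g x = x := by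
  obtain ⟨x, rfl⟩ := Submodule.Quotient.mk_surjective _ x
  filter_upwards [hρ x 1] with g hg
  change Submodule.Quotient.mk (ρ g x) = _
  rw [Submodule.Quotient.eq, mem_span_singleton_smul_top]
  simpa using hg

/-- The reduction of `M(Θ)` modulo `ϖ` is `M(Θ/ϖΘ)`. -/
theorem exists_mLattice_mSmooth [CompactSpace O] [T2Space O] (ha : IsProjectivePro O R K N)
    (hϖ : Irreducible ϖ)
    (hO : (𝓝 (0 : O)).HasBasis (fun _ : ℕ => True) fun j => {a | ϖ ^ j ∣ a})
    {Θ : Type u} [AddCommGroup Θ] [Module O Θ] [Module.IsTorsionFree O Θ]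
    [Finite (Θ ⧸ (Ideal.span {ϖ} • ⊤ : Submodule O Θ))] {ρ : Representation O K Θ}
    (hρ : ∀ t j, ∀ᶠ g in 𝓝 (1 : K), ∃ t', ρ g t - t = ϖ ^ j • t') :
    ∃ Ψ : MLattice O R K N ρ →ₗ[R] MSmooth O R K N L (reduction ρ ϖ), Function.Surjective Ψ ∧
      ∀ φ, Ψ φ = 0 ↔ ∃ φ', φ = algebraMap O R ϖ • φ' := by
  have := isPrecomplete_of_compactSpace (O := O) (ϖ := ϖ)
  have hO1 : {a : O | ϖ ∣ a} ∈ 𝓝 0 := by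
    have := hO.mem_of_mem (i := 1) trivial
    simpa using this
  have hX := smul_reduction_eq_zero (O := O) (Θ := Θ) (ϖ := ϖ)
  have hρ' := eventually_reduction_apply_eq (ϖ := ϖ) hρ
  have := finite_linDual_modInt (L := L) hϖ.ne_zero hX
  have := discreteTopology_linDual (O := O) (L := L)
    (X := Θ ⧸ (Ideal.span {ϖ} • ⊤ : Submodule O Θ))
  have := continuousSMul_linDual (L := L) hO1 hX
  have htf : ∀ h : Θ, ϖ • h = 0 → h = 0 := fun h hh => (smul_eq_zero.1 hh).resolve_left hϖ.ne_zero
  -- First use of the duality, with O in place of R: the dual of Θ modulo ϖ is the Pontryagin dual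
  -- of Θ/ϖΘ.
  obtain ⟨q, hqs, hqk, hq⟩ := exists_linDual_modInt (R := O) hϖ L htf
    (Submodule.mkQ (Ideal.span {ϖ} • ⊤ : Submodule O Θ)) (Submodule.mkQ_surjective _)
    fun h => by rw [Submodule.mkQ_apply, Submodule.Quotient.mk_eq_zero, mem_span_singleton_smul_top]
  have hdiv : Continuous (divMap L ϖ) := by
    refine continuous_of_continuousAt_zero (divMap L ϖ).toAddMonoidHom ?_
    rw [ContinuousAt, map_zero]
    refine tendsto_const_nhds.congr' ?_
    filter_upwards [hO1] with a ha
    exact ((divMap_eq_zero hϖ.ne_zero).2 ha).symm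
  have hqc : Continuous q := by
    refine LinDual.continuous_iff.2 fun t => ?_
    obtain ⟨t, rfl⟩ := Submodule.mkQ_surjective _ t
    simp only [hq]
    exact hdiv.comp (LinDual.continuous_apply t)
  have hgq : ∀ g x, q (contragredient O O ρ g x) =
      contragredient O (ModInt O L) (reduction ρ ϖ) g (q x) := by
    intro g x
    ext t
    obtain ⟨t, rfl⟩ := Submodule.mkQ_surjective _ t
    rw [hq]
    exact (hq x (ρ g⁻¹ t)).symm
  have hsurj := HomCont.map_surjective (R := R) (N := N) ha (continuous_contragredient hO hρ)
    (continuous_contragredient_modInt hρ') hqc hgq hqs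
  -- Second use, for the maps from N: projectivity makes composition with q surjective, and its
  -- kernel consists of the multiples of ϖ.
  obtain ⟨Ψ, h1, h2, -⟩ := exists_linDual_modInt (R := R) hϖ L (fun h hh => HomCont.ext fun n =>
      LinDual.ext fun t => by
        have h1 : (ϖ • h) n t = 0 := by rw [hh]; rfl
        rw [HomCont.smul_apply', LinDual.smul_apply, LinDual.map_smul] at h1
        exact (mul_eq_zero.1 h1).resolve_left hϖ.ne_zero)
    (HomCont.map R N q hqc hgq) hsurj fun h => by
      constructor
      · intro hh
        refine HomCont.exists_eq_smul_of_dvd hϖ.ne_zero h fun n t => ?_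
        rw [← divMap_eq_zero (L := L) hϖ.ne_zero, ← hq, ← HomCont.map_apply q hqc hgq, hh]
        rfl
      · rintro ⟨y, rfl⟩
        refine HomCont.ext fun n => LinDual.ext fun t => ?_
        obtain ⟨t, rfl⟩ := Submodule.mkQ_surjective _ t
        rw [HomCont.map_apply, hq, HomCont.smul_apply', LinDual.smul_apply, LinDual.map_smul,
          smul_eq_mul, (divMap_eq_zero hϖ.ne_zero).2 (Dvd.intro _ rfl)]
        rfl
  exact ⟨Ψ, h1, h2⟩

end Exactness


open Topology

/-! ### Functionals factoring through one-dimensional quotients are evaluations. -/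

section Continuity

variable {O R : Type u} [CommRing O] [IsDomain O] [IsDiscreteValuationRing O]
  [CommRing R] [IsLocalRing R] [IsNoetherianRing R] [Algebra O R] {ϖ : O}
  {H : Type u} [AddCommGroup H] [Module O H] [Module R H] [IsScalarTower O R H]

theorem exists_mul_eq_algebraMap_of_finite {O L X : Type u} [CommRing O] [IsDomain O] [Field L]
    [Algebra O L] [IsFractionRing O L] [AddCommGroup X] [Module O X] [Module.Finite O X]
    (β : X →ₗ[O] L) : ∃ a : O, a ≠ 0 ∧ ∀ x, ∃ b : O, algebraMap O L b = algebraMap O L a * β x := by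
  obtain ⟨n, x, hx⟩ := Module.Finite.exists_fin (R := O) (M := X)
  obtain ⟨a, ha⟩ := IsLocalization.exist_integer_multiples (nonZeroDivisors O) Finset.univ
    fun i => β (x i)
  refine ⟨a, nonZeroDivisors.ne_zero a.2, fun y => ?_⟩
  have hy : y ∈ Submodule.span O (Set.range x) := by rw [hx]; trivial
  induction hy using Submodule.span_induction with
  | mem y hy =>
    obtain ⟨i, rfl⟩ := hy
    obtain ⟨b, hb⟩ := ha i (Finset.mem_univ i)
    exact ⟨b, by rw [hb, Algebra.smul_def]⟩
  | zero => exact ⟨0, by simp⟩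
  | add y z _ _ hy hz =>
    obtain ⟨b, hb⟩ := hy
    obtain ⟨c, hc⟩ := hz
    exact ⟨b + c, by rw [map_add, map_add, hb, hc, mul_add]⟩
  | smul c y _ hy =>
    obtain ⟨b, hb⟩ := hy
    exact ⟨c * b, by rw [map_smul, map_mul, hb, Algebra.smul_def]; ring⟩

/-- The only prime containing J and x is 𝔪, so J + (x ^ j) contains a power of 𝔪. -/
theorem exists_pow_le_sup (J : Ideal R) (x : R) (hx : ∀ Q : Ideal R, Q.IsPrime → J ≤ Q → x ∈ Q →
    Q = IsLocalRing.maximalIdeal R) (j : ℕ) :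
    ∃ n, IsLocalRing.maximalIdeal R ^ n ≤ J ⊔ Ideal.span {x ^ j} := by
  obtain ⟨n, hn⟩ := Ideal.exists_radical_pow_le_of_fg (J ⊔ Ideal.span {x ^ j})
    (IsNoetherian.noetherian _)
  refine ⟨n, le_trans (Ideal.pow_right_mono ?_ n) hn⟩
  rw [Ideal.radical_eq_sInf]
  refine le_sInf fun Q hQ => ?_
  rw [hx Q hQ.2 (le_sup_left.trans hQ.1)
    (hQ.2.mem_of_pow_mem j (hQ.1 (Ideal.mem_sup_right (Ideal.mem_span_singleton_self _))))]

/-- A functional on the dual of `H` that factors over a suitable quotient of `R` is, up to a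
scalar, the evaluation at an element of `H`. -/
theorem IsAdmissible.exists_mul_eq_apply (L : Type u) [Field L] [Algebra O L] [IsFractionRing O L]
    [IsPrecomplete (Ideal.span {ϖ}) O] [IsPrecomplete (IsLocalRing.maximalIdeal R) R]
    [Finite (O ⧸ Ideal.span {ϖ})] (hϖ : Irreducible ϖ)
    (hϖR : algebraMap O R ϖ ∈ IsLocalRing.maximalIdeal R)
    (hk : Function.Surjective ((IsLocalRing.residue R).comp (algebraMap O R)))
    (hH : IsAdmissible R ϖ H) (J : Ideal R)
    (hJ : ∀ Q : Ideal R, Q.IsPrime → J ≤ Q → algebraMap O R ϖ ∈ Q → Q = IsLocalRing.maximalIdeal R)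
    (β : LinDual O H O →ₗ[O] L) (hβ : ∀ r ∈ J, ∀ φ, β (r • φ) = 0) :
    ∃ (a : O) (h : H), a ≠ 0 ∧ ∀ φ, algebraMap O L (φ h) = algebraMap O L a * β φ := by
  have := hH.finite hϖ L hϖR
  -- β factors through the dual of H modulo J, which is finite over O; so its denominators are
  -- bounded and a nonzero multiple is O-valued.
  have h1 := finite_quotient_of_forall_isPrime hk ϖ hϖR J hJ
  have h2 : Module.Finite (R ⧸ J) (LinDual O H O ⧸ (J • ⊤ : Submodule R (LinDual O H O))) :=
    Module.Finite.of_restrictScalars_finite R _ _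
  have : IsScalarTower O (R ⧸ J) (LinDual O H O ⧸ (J • ⊤ : Submodule R (LinDual O H O))) := by
    refine ⟨fun a x y => ?_⟩
    obtain ⟨x, rfl⟩ := Ideal.Quotient.mk_surjective x
    obtain ⟨y, rfl⟩ := Submodule.Quotient.mk_surjective _ y
    change Submodule.Quotient.mk ((a • x) • y) = Submodule.Quotient.mk (a • x • y)
    rw [smul_assoc]
  have h3 : Module.Finite O (LinDual O H O ⧸ (J • ⊤ : Submodule R (LinDual O H O))) :=
    Module.Finite.trans (R ⧸ J) _
  have hker : ((J • ⊤ : Submodule R (LinDual O H O)).restrictScalars O) ≤ LinearMap.ker β := by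
    intro φ hφ
    have hφ' : φ ∈ (J • ⊤ : Submodule R (LinDual O H O)) := hφ
    induction hφ' using Submodule.smul_induction_on' with
    | smul r hr φ _ => exact hβ r hr φ
    | add x hx y hy ihx ihy => exact add_mem (ihx hx) (ihy hy)
  let β' : (LinDual O H O ⧸ (J • ⊤ : Submodule R (LinDual O H O))) →ₗ[O] L :=
    ((J • ⊤ : Submodule R (LinDual O H O)).restrictScalars O).liftQ β hker
  obtain ⟨a, ha, hb⟩ := exists_mul_eq_algebraMap_of_finite (L := L) β'
  replace hb : ∀ φ, ∃ b, algebraMap O L b = algebraMap O L a * β φ := fun φ =>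
    hb (Submodule.Quotient.mk φ)
  choose f hf using hb
  have hinj := IsFractionRing.injective O L
  let lam : LinDual O H O →ₗ[O] O :=
    { toFun := f
      map_add' := fun x y => hinj (by rw [map_add, hf, hf, hf, map_add, mul_add])
      map_smul' := fun c x => hinj (by
        rw [hf, map_smul, RingHom.id_apply, smul_eq_mul, map_mul, hf, Algebra.smul_def]; ring) }
  have hlam : ∀ φ, algebraMap O L (lam φ) = algebraMap O L a * β φ := hf
  -- Continuity: a power of 𝔪 lies in J + (ϖ ^ j), where J contributes zero and ϖ ^ j contributes
  -- divisible values.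
  obtain ⟨h, hh⟩ := hH.exists_eq_apply hϖ L lam fun j => by
    obtain ⟨n, hn⟩ := exists_pow_le_sup J (algebraMap O R ϖ) hJ j
    refine ⟨n, fun φ hφ => ?_⟩
    induction hφ using Submodule.smul_induction_on' with
    | smul r hr φ _ =>
      obtain ⟨s, hs, t, ht, rfl⟩ := Submodule.mem_sup.1 (hn hr)
      obtain ⟨c, rfl⟩ := Ideal.mem_span_singleton'.1 ht
      have h0 : lam (s • φ) = 0 := hinj (by rw [hlam, hβ s hs, mul_zero, map_zero])
      have h4 : (c * algebraMap O R ϖ ^ j) • φ = ϖ ^ j • c • φ := by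
        rw [mul_comm, mul_smul, ← map_pow, algebraMap_smul]
      rw [add_smul, map_add, h0, zero_add, h4, map_smul]
      exact Dvd.intro _ rfl
    | add x _ y _ hx hy => rw [map_add]; exact dvd_add hx hy
  exact ⟨a, h, ha, fun φ => by rw [← hh, hlam]⟩

end Continuity

section Extension

variable {O L V W : Type u} [CommRing O] [IsDomain O] [IsDiscreteValuationRing O] [Field L]
  [Algebra O L] [IsFractionRing O L] [AddCommGroup V] [Module L V] [Module O V]
  [IsScalarTower O L V] (Θ : Submodule O V) [Submodule.IsLattice L Θ] [AddCommGroup W] [Module L W]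

omit [IsDomain O] [IsDiscreteValuationRing O] [IsFractionRing O L] in
theorem eq_of_eq_on_lattice {f g : V →ₗ[L] W} (h : ∀ v ∈ Θ, f v = g v) : f = g :=
  LinearMap.ext_on (Submodule.IsLattice.span_eq_top (M := Θ)) h

theorem exists_extend_lattice (f : Θ →+ W) (hf : ∀ (a : O) v, f (a • v) = algebraMap O L a • f v) :
    ∃ F : V →ₗ[L] W, ∀ v : Θ, F v = f v := by
  have : Module.IsTorsionFree O L := inferInstance
  have : Module.Free O Θ := Submodule.IsLattice.free L Θ
  let b := Module.Free.chooseBasis O Θ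
  let B := b.extendOfIsLattice L
  let F : V →ₗ[L] W := B.constr L fun i => f (b i)
  refine ⟨F, fun v => ?_⟩
  have hv : v ∈ Submodule.span O (Set.range b) := by rw [b.span_eq]; trivial
  induction hv using Submodule.span_induction with
  | mem v hv =>
    obtain ⟨i, rfl⟩ := hv
    rw [← b.extendOfIsLattice_apply L i]
    exact B.constr_basis L _ i
  | zero => simp
  | add v w _ _ hv hw => rw [Submodule.coe_add, map_add, map_add, hv, hw]
  | smul a v _ hv =>
    rw [hf, ← hv, Submodule.coe_smul, ← map_smul F, algebraMap_smul]

end Extension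

/-! ### From functionals on m ⊗ M(Θ) to maps V → Π(m). -/

section Comparison

variable {O R K N L : Type u} [CommRing O] [IsDomain O] [IsDiscreteValuationRing O]
  [CommRing R] [IsLocalRing R] [IsNoetherianRing R] [Algebra O R]
  [Group K] [TopologicalSpace K]
  [AddCommGroup N] [Module (CompletedGroupAlgebra R K) N]
  [Module R N] [IsScalarTower R (CompletedGroupAlgebra R K) N] [Module O N] [IsScalarTower O R N]
  [TopologicalSpace N] [TopologicalSpace O] [IsTopologicalRing O]
  [ContinuousSMul (CompletedGroupAlgebra R K) N]
  [Field L] [Algebra O L] [IsFractionRing O L] [TopologicalSpace L] [IsTopologicalRing L]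

/-- The functional `h ↦ h(n)(v)` on `Hom^cont(N, Θ^d)`. -/
def evalAt {Θ : Type u} [AddCommGroup Θ] [Module O Θ] (ρ : Representation O K Θ) (v : Θ) :
    N →ₗ[R] MLattice O R K N ρ where
  toFun n := LinDual.mk
    { toFun := fun h => h n v
      map_add' := fun _ _ => rfl
      map_smul' := fun a h => by
        rw [HomCont.smul_apply', LinDual.smul_apply, LinDual.map_smul]
        rfl }
  map_add' n n' := LinDual.ext fun h => by
    change h (n + n') v = h n v + h n' v
    rw [map_add]
    rfl
  map_smul' _ _ := rfl

omit [IsDomain O] [IsDiscreteValuationRing O] [IsNoetherianRing R] in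
theorem evalAt_apply {Θ : Type u} [AddCommGroup Θ] [Module O Θ] (ρ : Representation O K Θ) (v : Θ)
    (n : N) (h : HomCont O R K N (LinDual O Θ O) (contragredient O O ρ)) :
    evalAt (R := R) ρ v n h = h n v := rfl

omit [IsDomain O] [IsDiscreteValuationRing O] [IsNoetherianRing R] in
theorem evalAt_groupRep {Θ : Type u} [AddCommGroup Θ] [Module O Θ] (ρ : Representation O K Θ)
    (v : Θ) (n : N) (g : K) :
    evalAt (O := O) (R := R) ρ (ρ g v) n = evalAt ρ v (CompletedGroupAlgebra.of R K g⁻¹ • n) := by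
  refine LinDual.ext fun h => ?_
  rw [evalAt_apply, evalAt_apply, ← groupRep_apply (O := O), h.apply_groupRep]
  change _ = h n (ρ g⁻¹⁻¹ v)
  rw [inv_inv]

variable {V : Type u} [AddCommGroup V] [Module L V] [Module O V]
  [IsScalarTower O L V] {ρV : Representation L K V}
  {Θ : Submodule O V} [Submodule.IsLattice L Θ] {hΘ : ∀ g, ∀ x ∈ Θ, ρV g x ∈ Θ}
  {m : Type u} [AddCommGroup m] [Module R m] [Module O m] [IsScalarTower O R m]

omit [IsDomain O] [IsDiscreteValuationRing O] [IsNoetherianRing R] [IsFractionRing O L] [TopologicalSpace O]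
  [IsTopologicalRing O] [Module O N] [IsScalarTower O R N] in
theorem homBanach_ext {f f' : HomBanach O R K N L m ρV}
    (h : ∀ v ∈ Θ, ∀ x n, (f.1 v).1 (x ⊗ₜ n) = (f'.1 v).1 (x ⊗ₜ n)) : f = f' := by
  refine Subtype.ext (eq_of_eq_on_lattice Θ fun v hv => Subtype.ext ?_)
  refine LinearMap.ext fun z => ?_
  induction z with
  | zero => rw [map_zero, map_zero]
  | add y z hy hz => rw [map_add, map_add, hy, hz]
  | tmul x n => exact h v hv x n

omit [IsNoetherianRing R] in
-- Pull β back along N → M(Θ), n ↦ (h ↦ h(n)(v)). The hypothesis writes β(x ⊗ ·) as a scaled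
-- evaluation at some h, and continuity of h gives continuity in n; the construction is then
-- extended from the lattice to V.
theorem exists_homBanach (hL : Continuous (algebraMap O L))
    (β : m ⊗[R] MLattice O R K N (latticeRep ρV Θ hΘ) →ₗ[O] L)
    (hβ : ∀ x : m, ∃ (a : O) (h : HomCont O R K N (LinDual O Θ O)
      (contragredient O O (latticeRep ρV Θ hΘ))), a ≠ 0 ∧
      ∀ φ : MLattice O R K N (latticeRep ρV Θ hΘ), algebraMap O L (φ h) =
        algebraMap O L a * β (x ⊗ₜ φ)) :
    ∃ f : HomBanach O R K N L m ρV, ∀ (v : Θ) x n, (f.1 v).1 (x ⊗ₜ n) =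
      β (x ⊗ₜ evalAt (latticeRep ρV Θ hΘ) v n) := by
  let ρ := latticeRep ρV Θ hΘ
  let F₀ : Θ → Banach O R N L m := fun v =>
    (⟨β ∘ₗ (LinearMap.lTensor m (evalAt (R := R) (N := N) ρ v)).restrictScalars O, fun x => by
      obtain ⟨a, h, ha, hh⟩ := hβ x
      have ha' : algebraMap O L a ≠ 0 := by simpa using ha
      have h1 : (fun n : N => (algebraMap O L a)⁻¹ * algebraMap O L (h n v)) = fun n : N =>
          (β ∘ₗ (LinearMap.lTensor m (evalAt (R := R) (N := N) ρ v)).restrictScalars O)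
            (x ⊗ₜ[R] n) := by
        ext n
        change _ = β (x ⊗ₜ evalAt ρ v n)
        rw [inv_mul_eq_iff_eq_mul₀ ha']
        exact hh (evalAt ρ v n)
      rw [← h1]
      exact continuous_const.mul (hL.comp ((LinDual.continuous_apply v).comp h.continuous))⟩ :
      banachSubmodule O R N L m)
  have hF₀ : ∀ v x n, (F₀ v).1 (x ⊗ₜ n) = β (x ⊗ₜ evalAt ρ v n) := fun _ _ _ => rfl
  have hext : ∀ y z : Banach O R N L m, (∀ x n, y.1 (x ⊗ₜ n) = z.1 (x ⊗ₜ n)) → y = z := by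
    intro y z h
    refine Subtype.ext (LinearMap.ext fun w => ?_)
    induction w with
    | zero => rw [map_zero, map_zero]
    | add y z hy hz => rw [map_add, map_add, hy, hz]
    | tmul x n => exact h x n
  have hadd : ∀ v w, F₀ (v + w) = F₀ v + F₀ w := by
    intro v w
    refine hext _ _ fun x n => ?_
    change _ = (F₀ v).1 (x ⊗ₜ n) + (F₀ w).1 (x ⊗ₜ n)
    rw [hF₀, hF₀, hF₀, ← map_add, ← TensorProduct.tmul_add]
    congr 2
    exact LinDual.ext fun h => map_add (h n) v w
  have hsmul : ∀ (a : O) v, F₀ (a • v) = algebraMap O L a • F₀ v := by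
    intro a v
    refine hext _ _ fun x n => ?_
    change _ = algebraMap O L a * (F₀ v).1 (x ⊗ₜ n)
    rw [hF₀, hF₀, ← Algebra.smul_def, ← map_smul, TensorProduct.smul_tmul', ← algebraMap_smul R a x,
      TensorProduct.smul_tmul, algebraMap_smul]
    congr 2
    refine LinDual.ext fun h => ?_
    rw [LinDual.smul_apply, evalAt_apply, evalAt_apply, HomCont.smul_apply', LinDual.smul_apply]
  obtain ⟨F, hF⟩ := exists_extend_lattice (L := L) Θ
    { toFun := F₀, map_add' := hadd, map_zero' := by simpa using hsmul 0 0 } hsmul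
  have hF' : ∀ v : Θ, F v = F₀ v := hF
  have hrep : ∀ g v, F (ρV g v) = banachRep O R K N L m g (F v) := by
    intro g v
    have : F ∘ₗ ρV g = (banachRep O R K N L m g) ∘ₗ F := by
      refine eq_of_eq_on_lattice Θ fun v hv => ?_
      refine hext _ _ fun x n => ?_
      have h1 : F (ρV g v) = F₀ (ρ g ⟨v, hv⟩) := hF' (ρ g ⟨v, hv⟩)
      have h2 : F v = F₀ ⟨v, hv⟩ := hF' ⟨v, hv⟩
      change (F (ρV g v)).1 _ = (F v).1 (x ⊗ₜ (CompletedGroupAlgebra.of R K g⁻¹ • n))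
      rw [h1, h2, hF₀, hF₀, evalAt_groupRep]
    exact LinearMap.congr_fun this v
  refine ⟨(⟨F, hrep⟩ : homBanachSubgroup O R K N L m ρV), fun v x n => ?_⟩
  change (F v).1 _ = _
  rw [hF', hF₀]

theorem rank_le_rank_dual {F X : Type u} [Field F] [AddCommGroup X] [Module F X] :
    Module.rank F X ≤ Module.rank F (Module.Dual F X) := by
  rcases lt_or_ge (Module.rank F X) Cardinal.aleph0 with h | h
  · have := Module.rank_lt_aleph0_iff.1 h
    rw [Module.dual_rank_eq, Cardinal.lift_id]
  · exact (rank_lt_rank_dual h).le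

variable [CompactSpace N] [Module.Finite (CompletedGroupAlgebra R K) N]
  [CompactSpace O] [T2Space O] {ϖ : O} [Finite (O ⧸ Ideal.span {ϖ})]

/-- The comparison of `M(Θ)` and `Hom_K(V, Π(m))`. -/
theorem rank_tensor_le_rank_homBanach [IsPrecomplete (IsLocalRing.maximalIdeal R) R]
    (hϖ : Irreducible ϖ) (hϖR : algebraMap O R ϖ ∈ IsLocalRing.maximalIdeal R)
    (hk : Function.Surjective ((IsLocalRing.residue R).comp (algebraMap O R)))
    (hO : (𝓝 (0 : O)).HasBasis (fun _ : ℕ => True) fun j => {a | ϖ ^ j ∣ a})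
    (hL : Continuous (algebraMap O L))
    {F : Type u} [Field F] [Algebra O F] (τ : F →ₗ[O] L) (hτ : τ ≠ 0)
    [Module F m] [IsScalarTower O F m] [SMulCommClass R F m] [SMulCommClass F O m]
    (J : Ideal R)
    (hJ : ∀ Q : Ideal R, Q.IsPrime → J ≤ Q → algebraMap O R ϖ ∈ Q → Q = IsLocalRing.maximalIdeal R)
    (hJm : ∀ r ∈ J, ∀ x : m, r • x = 0) :
    Module.rank F (m ⊗[R] MLattice O R K N (latticeRep ρV Θ hΘ)) ≤
      Module.rank F (HomBanach O R K N L m ρV) := by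
  have := isPrecomplete_of_compactSpace (O := O) (ϖ := ϖ)
  have : Module.Finite O Θ := Submodule.IsLattice.finite L Θ
  have hH : IsAdmissible R ϖ (HomCont O R K N (LinDual O Θ O)
    (contragredient O O (latticeRep ρV Θ hΘ))) := isAdmissible_homCont hϖ hk hO
  let X := m ⊗[R] MLattice O R K N (latticeRep ρV Θ hΘ)
  have hsO : ∀ (a : O) (z : X), a • z = algebraMap O F a • z := by
    intro a z
    induction z using TensorProduct.induction_on with
    | zero => rw [smul_zero, smul_zero]
    | add y z hy hz => rw [smul_add, smul_add, hy, hz]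
    | tmul x φ => rw [TensorProduct.smul_tmul', TensorProduct.smul_tmul', algebraMap_smul]
  -- F-linear functionals become L-valued ones by composition with the fixed nonzero τ.
  let B : Module.Dual F X → (X →ₗ[O] L) := fun ξ =>
    τ ∘ₗ { toFun := ξ
           map_add' := fun y z => map_add ξ y z
           map_smul' := fun a z => by
             rw [hsO, map_smul, RingHom.id_apply, smul_eq_mul, Algebra.smul_def] }
  have hB : ∀ ξ z, B ξ z = τ (ξ z) := fun _ _ => rfl
  clear_value B
  have hcont : ∀ ξ (x : m), ∃ (a : O) (h : HomCont O R K N (LinDual O Θ O)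
      (contragredient O O (latticeRep ρV Θ hΘ))), a ≠ 0 ∧
      ∀ φ : MLattice O R K N (latticeRep ρV Θ hΘ), algebraMap O L (φ h) =
        algebraMap O L a * B ξ (x ⊗ₜ φ) := by
    intro ξ x
    refine hH.exists_mul_eq_apply L hϖ hϖR hk J hJ
      { toFun := fun φ => B ξ (x ⊗ₜ φ)
        map_add' := fun φ ψ => by rw [TensorProduct.tmul_add, map_add]
        map_smul' := fun a φ => by
          rw [RingHom.id_apply, ← map_smul, ← algebraMap_smul R a φ, ← TensorProduct.smul_tmul,
            algebraMap_smul, TensorProduct.smul_tmul'] } fun r hr φ => ?_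
    change B ξ (x ⊗ₜ (r • φ)) = 0
    rw [← TensorProduct.smul_tmul, hJm r hr, TensorProduct.zero_tmul, map_zero]
  choose f hf using fun ξ => exists_homBanach hL (B ξ) (hcont ξ)
  let G : Module.Dual F X →ₗ[F] HomBanach O R K N L m ρV :=
    { toFun := f
      map_add' := fun ξ ξ' => homBanach_ext (Θ := Θ) fun v hv x n => by
        change _ = ((f ξ).1 v).1 (x ⊗ₜ n) + ((f ξ').1 v).1 (x ⊗ₜ n)
        rw [hf _ ⟨v, hv⟩, hf _ ⟨v, hv⟩, hf _ ⟨v, hv⟩, hB, hB, hB, LinearMap.add_apply, map_add]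
      map_smul' := fun s ξ => homBanach_ext (Θ := Θ) fun v hv x n => by
        change _ = ((f ξ).1 v).1 ((s • x) ⊗ₜ n)
        rw [hf _ ⟨v, hv⟩, hf _ ⟨v, hv⟩, hB, hB, LinearMap.smul_apply, ← map_smul,
          TensorProduct.smul_tmul'] }
  refine le_trans rank_le_rank_dual (LinearMap.rank_le_of_injective G ?_)
  rw [injective_iff_map_eq_zero]
  intro ξ hξ
  have h0 : ∀ z, B ξ z = 0 := by
    intro z
    induction z using TensorProduct.induction_on with
    | zero => rw [map_zero]
    | add y z hy hz => rw [map_add, hy, hz, add_zero]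
    | tmul x φ =>
      obtain ⟨a, h, ha, hh⟩ := hcont ξ x
      have ha' : algebraMap O L a ≠ 0 := by simpa using ha
      -- The evaluation point h is detected by its values h(n)(v), which the map V → Π(m) records.
      have hz : h = 0 := by
        refine HomCont.ext fun n => LinDual.ext fun v => ?_
        apply IsFractionRing.injective O L
        have h1 : ((f ξ).1 v).1 (x ⊗ₜ n) = 0 := by
          have h2 : f ξ = 0 := hξ
          rw [h2]
          rfl
        rw [hf] at h1
        have h2 := hh (evalAt (latticeRep ρV Θ hΘ) v n)
        rw [h1, mul_zero] at h2
        exact h2.trans (map_zero _).symm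
      have h3 := hh φ
      rw [hz, map_zero, map_zero] at h3
      exact (mul_eq_zero.1 h3.symm).resolve_left ha'
  ext z
  -- If ξ z ≠ 0, then ξ takes every value on the F-line through z, so τ would vanish identically.
  by_contra hne
  refine hτ (LinearMap.ext fun t => ?_)
  have h1 := h0 ((t * (ξ z)⁻¹) • z)
  rw [hB, map_smul, smul_eq_mul, inv_mul_cancel_right₀ hne] at h1
  exact h1

end Comparison


/-- If every B-scalar acts on each element like some A-scalar, then A-submodules are B-submodules.
-/
theorem length_le_of_forall_exists_smul {A B X : Type*} [Ring A] [Ring B] [AddCommGroup X]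
    [Module A X] [Module B X] (h : ∀ (b : B) (x : X), ∃ a : A, b • x = a • x) :
    Module.length A X ≤ Module.length B X := by
  rw [Module.length_eq_height, Module.length_eq_height]
  let f : Submodule A X → Submodule B X := fun Y =>
    { Y.toAddSubmonoid with
      smul_mem' := fun b x hx => by
        obtain ⟨a, ha⟩ := h b x
        rw [ha]
        exact Y.smul_mem a hx }
  have hf : StrictMono f := by
    intro Y Z hYZ
    exact ⟨fun x hx => hYZ.1 hx, fun hle => hYZ.2 fun x hx => hle hx⟩
  have h1 : f ⊤ = ⊤ := rfl
  rw [← h1]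
  exact Order.height_le_height_apply_of_strictMono f hf ⊤

/-! ### Local structure of M at a point. -/

section LocalAnalysis

variable {R E M : Type u} [CommRing R] [IsNoetherianRing R] [CommRing E] [IsLocalRing E]
  [Algebra R E] (q : Ideal R) [q.IsPrime] [IsLocalization.AtPrime E q]
  [AddCommGroup M] [Module R M]

omit [IsNoetherianRing R] [IsLocalRing E] in
theorem isLocalizedModule_tensorProduct : IsLocalizedModule q.primeCompl (TensorProduct.mk R E M 1) :=
  (isLocalizedModule_iff_isBaseChange q.primeCompl E _).2 (TensorProduct.isBaseChange R M E)

variable [Module.Finite R M]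

omit [IsNoetherianRing R] in
-- The fibre is spanned by the image of an element y of M itself; Nakayama over E then shows that
-- M/Ry vanishes after localization at q.
theorem exists_generator_of_rank_le_one
    (h : Module.rank (IsLocalRing.ResidueField E) (IsLocalRing.ResidueField E ⊗[R] M) ≤ 1) :
    ∃ y : M, ∀ x : M, ∃ s, s ∉ q ∧ s • x ∈ Submodule.span R {y} := by
  obtain ⟨v, hv⟩ := rank_le_one_iff.1 h
  have h1 : ∃ y : M, ∀ w : IsLocalRing.ResidueField E ⊗[R] M,
      ∃ c : IsLocalRing.ResidueField E, w = c ⊗ₜ y := by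
    by_cases hy : ∃ y : M, (1 : IsLocalRing.ResidueField E) ⊗ₜ[R] y ≠ 0
    · obtain ⟨y, hy⟩ := hy
      refine ⟨y, fun w => ?_⟩
      obtain ⟨a, ha⟩ := hv (1 ⊗ₜ y)
      obtain ⟨b, hb⟩ := hv w
      have ha0 : a ≠ 0 := by rintro rfl; exact hy (by rw [← ha, zero_smul])
      refine ⟨b * a⁻¹, ?_⟩
      have h2 : (b * a⁻¹) ⊗ₜ[R] y = (b * a⁻¹) • ((1 : IsLocalRing.ResidueField E) ⊗ₜ[R] y) := by
        rw [TensorProduct.smul_tmul', smul_eq_mul, mul_one]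
      rw [h2, ← ha, smul_smul, inv_mul_cancel_right₀ ha0, hb]
    · push Not at hy
      refine ⟨0, fun w => ⟨0, ?_⟩⟩
      rw [TensorProduct.zero_tmul]
      induction w with
      | zero => rfl
      | add x y hx hy => rw [hx, hy, add_zero]
      | tmul c x =>
        have h2 : c ⊗ₜ[R] x = c • ((1 : IsLocalRing.ResidueField E) ⊗ₜ[R] x) := by
          rw [TensorProduct.smul_tmul', smul_eq_mul, mul_one]
        rw [h2, hy, smul_zero]
  obtain ⟨y, hy⟩ := h1
  refine ⟨y, ?_⟩
  let M' := M ⧸ Submodule.span R {y}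
  have h2 : Subsingleton (IsLocalRing.ResidueField E ⊗[R] M') := by
    refine subsingleton_of_forall_eq 0 fun w => ?_
    induction w with
    | zero => rfl
    | add x y hx hy => rw [hx, hy, add_zero]
    | tmul c x =>
      obtain ⟨x, rfl⟩ := Submodule.mkQ_surjective _ x
      obtain ⟨d, hd⟩ := hy (c ⊗ₜ x)
      have h3 := congrArg (LinearMap.lTensor (IsLocalRing.ResidueField E)
        (Submodule.mkQ (Submodule.span R {y}))) hd
      rw [LinearMap.lTensor_tmul, LinearMap.lTensor_tmul] at h3
      have h4 : Submodule.mkQ (Submodule.span R {y}) y = 0 := by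
        rw [Submodule.mkQ_apply, Submodule.Quotient.mk_eq_zero]
        exact Submodule.mem_span_singleton_self y
      rw [h3, h4, TensorProduct.tmul_zero]
  have h3 : Subsingleton (IsLocalRing.ResidueField E ⊗[E] (E ⊗[R] M')) :=
    (TensorProduct.AlgebraTensorModule.cancelBaseChange R E E (IsLocalRing.ResidueField E)
      M').toEquiv.subsingleton
  have h4 : Subsingleton (E ⊗[R] M') := IsLocalRing.subsingleton_tensorProduct.1 h3
  intro x
  have h5 := isLocalizedModule_tensorProduct (E := E) (M := M') q
  obtain ⟨s, hs⟩ := (IsLocalizedModule.eq_zero_iff q.primeCompl (TensorProduct.mk R E M' 1)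
    (m := Submodule.Quotient.mk x)).1 (Subsingleton.elim _ _)
  refine ⟨s, s.2, ?_⟩
  rw [← Submodule.Quotient.mk_eq_zero]
  exact hs

omit [IsNoetherianRing R] [IsLocalRing E] in
-- E/PE is the localization of R/P at the prime q/P.
theorem le_ringKrullDim_quotient_map {P : Ideal R} [P.IsPrime] (hPq : P ≤ q) :
    ((q.map (Ideal.Quotient.mk P)).height : WithBot ℕ∞) ≤
      ringKrullDim (E ⧸ P.map (algebraMap R E)) := by
  have hp : (q.map (Ideal.Quotient.mk P)).IsPrime :=
    Ideal.map_isPrime_of_surjective Ideal.Quotient.mk_surjective (by rwa [Ideal.mk_ker])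
  have hc : (q.map (Ideal.Quotient.mk P)).comap (Ideal.Quotient.mk P) = q := by
    rw [Ideal.comap_map_of_surjective _ Ideal.Quotient.mk_surjective, ← RingHom.ker_eq_comap_bot,
      Ideal.mk_ker, sup_eq_left.2 hPq]
  have h1 : Algebra.algebraMapSubmonoid (R ⧸ P) q.primeCompl =
      (q.map (Ideal.Quotient.mk P)).primeCompl := by
    ext x
    constructor
    · rintro ⟨s, hs, rfl⟩ hx
      exact hs (by rw [← hc]; exact hx)
    · intro hx
      obtain ⟨s, rfl⟩ := Ideal.Quotient.mk_surjective x
      exact ⟨s, fun hs => hx (Ideal.mem_map_of_mem _ hs), rfl⟩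
  have h2 : IsLocalization (Algebra.algebraMapSubmonoid (R ⧸ P) q.primeCompl)
    (E ⧸ P.map (algebraMap R E)) := inferInstance
  rw [h1] at h2
  have h3 : IsLocalization.AtPrime (E ⧸ P.map (algebraMap R E)) (q.map (Ideal.Quotient.mk P)) := h2
  rw [IsLocalization.AtPrime.ringKrullDim_eq_height (q.map (Ideal.Quotient.mk P))
    (E ⧸ P.map (algebraMap R E))]

omit [IsNoetherianRing R] [Module.Finite R M] in
-- For cyclic E ⊗ M ≅ E/I, the right-hand module is E/I modulo the square of the maximal ideal of E,
-- and this surjects onto the module on the left.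
theorem length_quotient_sq_le (I : Ideal E) [IsLocalRing (E ⧸ I)] (e₁ : (E ⧸ I) ≃ₗ[E] E ⊗[R] M) :
    Module.length (E ⧸ I) ((E ⧸ I) ⧸ (IsLocalRing.maximalIdeal (E ⧸ I) ^ 2)) ≤
      Module.length E ((E ⧸ IsLocalRing.maximalIdeal E ^ 2) ⊗[R] M) := by
  let e₂ := TensorProduct.AlgebraTensorModule.cancelBaseChange R E E
    (E ⧸ IsLocalRing.maximalIdeal E ^ 2) M
  let e₃ := TensorProduct.AlgebraTensorModule.congr
    (LinearEquiv.refl E (E ⧸ IsLocalRing.maximalIdeal E ^ 2)) e₁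
  let e₄ := TensorProduct.quotTensorEquivQuotSMul (E ⧸ I) (IsLocalRing.maximalIdeal E ^ 2)
  rw [← e₂.length_eq, ← e₃.length_eq, e₄.length_eq]
  have hmax : (IsLocalRing.maximalIdeal (E ⧸ I)).comap (Ideal.Quotient.mk I) =
      IsLocalRing.maximalIdeal E :=
    IsLocalRing.eq_maximalIdeal
      (Ideal.comap_isMaximal_of_surjective _ Ideal.Quotient.mk_surjective)
  let f : (E ⧸ I) →ₗ[E] (E ⧸ I) ⧸ (IsLocalRing.maximalIdeal (E ⧸ I) ^ 2) :=
    (Ideal.Quotient.mkₐ E (IsLocalRing.maximalIdeal (E ⧸ I) ^ 2)).toLinearMap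
  have hle : (IsLocalRing.maximalIdeal E ^ 2 • ⊤ : Submodule E (E ⧸ I)) ≤ LinearMap.ker f := by
    rw [Submodule.smul_le]
    intro r hr x _
    have h6 : Ideal.Quotient.mk I r ∈ IsLocalRing.maximalIdeal (E ⧸ I) ^ 2 := by
      have := Ideal.mem_map_of_mem (Ideal.Quotient.mk I) hr
      rw [Ideal.map_pow] at this
      exact Ideal.pow_right_mono (Ideal.map_le_iff_le_comap.2 hmax.ge) 2 this
    exact Ideal.Quotient.eq_zero_iff_mem.2 (Ideal.mul_mem_right x _ h6)
  refine le_trans (length_le_of_forall_exists_smul fun e x => ⟨Ideal.Quotient.mk I e, ?_⟩)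
    (Module.length_le_of_surjective (Submodule.liftQ _ f hle) fun x => ?_)
  · obtain ⟨x, rfl⟩ := Ideal.Quotient.mk_surjective x
    rfl
  · obtain ⟨x, rfl⟩ := Ideal.Quotient.mk_surjective x
    exact ⟨Submodule.Quotient.mk x, rfl⟩

/-- E ⊗ M is cyclic, equal to E/I. The length bound limits the embedding dimension of E/I to n,
while I ⊆ PE gives dimension at least n. So E/I is regular and I is prime; its contraction to R
contains the annihilator and lies in P, so it equals P by minimality. -/
theorem exists_generic_generator {P : Ideal R} [P.IsPrime] (hPq : P ≤ q)
    (hP : P ∈ (Module.annihilator R M).minimalPrimes) (n : ℕ)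
    (h₁ : Module.rank (IsLocalRing.ResidueField E) (IsLocalRing.ResidueField E ⊗[R] M) ≤ 1)
    (h₂ : Module.length E ((E ⧸ IsLocalRing.maximalIdeal E ^ 2) ⊗[R] M) ≤ n + 1)
    (h₃ : (n : ℕ∞) ≤ (q.map (Ideal.Quotient.mk P)).height) :
    ∃ y : M, (∀ x : M, ∃ s, s ∉ P ∧ s • x ∈ Submodule.span R {y}) ∧
      ∀ t ∈ P, ∃ s, s ∉ P ∧ s * t ∈ Module.annihilator R M := by
  obtain ⟨y, hy⟩ := exists_generator_of_rank_le_one (E := E) q h₁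
  have : IsNoetherianRing E := IsLocalization.isNoetherianRing q.primeCompl E inferInstance
  let g : E →ₗ[E] E ⊗[R] M := LinearMap.toSpanSingleton E _ (1 ⊗ₜ y)
  have hg1 : ∀ e, g e = e ⊗ₜ y := fun e => by
    rw [LinearMap.toSpanSingleton_apply, TensorProduct.smul_tmul', smul_eq_mul, mul_one]
  have hg : Function.Surjective g := by
    intro w
    induction w with
    | zero => exact ⟨0, map_zero g⟩
    | add x y hx hy =>
      obtain ⟨a, rfl⟩ := hx
      obtain ⟨b, rfl⟩ := hy
      exact ⟨a + b, map_add g a b⟩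
    | tmul e x =>
      obtain ⟨s, hs, hx⟩ := hy x
      obtain ⟨c, hc⟩ := Submodule.mem_span_singleton.1 hx
      obtain ⟨u, hu⟩ := (IsLocalization.map_units E (⟨s, hs⟩ : q.primeCompl)).exists_right_inv
      refine ⟨e * u * algebraMap R E c, ?_⟩
      have h1 : e * u * algebraMap R E c = c • (e * u) := by rw [Algebra.smul_def, mul_comm]
      have h2 : e = s • (e * u) := by
        rw [Algebra.smul_def, mul_left_comm]
        change e = e * (algebraMap R E s * u)
        rw [hu, mul_one]
      rw [hg1, h1, TensorProduct.smul_tmul, hc, ← TensorProduct.smul_tmul, ← h2]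
  set I : Ideal E := LinearMap.ker g with hI
  -- I is the annihilator of E ⊗ M, and M is finitely generated; so one denominator outside q works
  -- for all of M.
  have hIann : ∀ r : R, algebraMap R E r ∈ I → ∃ s, s ∉ q ∧ s * r ∈ Module.annihilator R M := by
    intro r hr
    have h1 : ∀ x : M, ∃ s : q.primeCompl, s • r • x = 0 := by
      intro x
      have h5 := isLocalizedModule_tensorProduct (E := E) (M := M) q
      refine (IsLocalizedModule.eq_zero_iff q.primeCompl (TensorProduct.mk R E M 1)).1 ?_
      obtain ⟨e, he⟩ := hg (1 ⊗ₜ x)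
      have h2 : g (algebraMap R E r) = 0 := hr
      change (1 : E) ⊗ₜ[R] (r • x) = 0
      rw [TensorProduct.tmul_smul, ← he, ← algebraMap_smul E, ← map_smul, smul_eq_mul, mul_comm,
        ← smul_eq_mul, map_smul, h2, smul_zero]
    obtain ⟨k, x, hx⟩ := Module.Finite.exists_fin (R := R) (M := M)
    choose s hs using fun i => h1 (x i)
    refine ⟨((∏ i, s i : q.primeCompl) : R), (∏ i, s i).2, ?_⟩
    rw [Module.mem_annihilator]
    intro m
    have hm : m ∈ Submodule.span R (Set.range x) := by rw [hx]; trivial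
    induction hm using Submodule.span_induction with
    | mem m hm =>
      obtain ⟨i, rfl⟩ := hm
      rw [mul_smul, ← Finset.prod_erase_mul _ _ (Finset.mem_univ i), Submonoid.coe_mul, mul_smul]
      have := hs i
      rw [Submonoid.smul_def] at this
      rw [this, smul_zero]
    | zero => rw [smul_zero]
    | add a b _ _ ha hb => rw [smul_add, ha, hb, add_zero]
    | smul c a _ ha => rw [smul_comm, ha, smul_zero]
  have hIP : I ≤ P.map (algebraMap R E) := by
    intro e he
    obtain ⟨⟨r, s⟩, hrs⟩ := IsLocalization.surj q.primeCompl e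
    have hr : algebraMap R E r ∈ I := by rw [← hrs]; exact I.mul_mem_right _ he
    obtain ⟨t, ht, htr⟩ := hIann r hr
    have hrP : r ∈ P := (Ideal.IsPrime.mem_or_mem inferInstance (hP.1.2 htr)).resolve_left
      fun h => ht (hPq h)
    have h1 : e * algebraMap R E s ∈ P.map (algebraMap R E) := by
      rw [hrs]; exact Ideal.mem_map_of_mem _ hrP
    exact (Ideal.unit_mul_mem_iff_mem _ (IsLocalization.map_units E s)).1 (by rwa [mul_comm])
  have hPtop : P.map (algebraMap R E) ≠ ⊤ := by
    intro h
    have h1 : P.map (algebraMap R E) ≤ IsLocalRing.maximalIdeal E := by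
      rw [Ideal.map_le_iff_le_comap, ← Ideal.under_def,
        IsLocalization.AtPrime.under_maximalIdeal E q]
      exact hPq
    rw [h, top_le_iff] at h1
    exact (IsLocalRing.maximalIdeal.isMaximal E).ne_top h1
  have : Nontrivial (E ⧸ I) := Ideal.Quotient.nontrivial_iff.2 fun h => hPtop (top_le_iff.1 (h ▸ hIP))
  have : IsLocalRing (E ⧸ I) := IsLocalRing.of_surjective' (Ideal.Quotient.mk I)
    Ideal.Quotient.mk_surjective
  have hdom : IsDomain (E ⧸ I) := by
    refine isDomain_of_length_quotient_sq_le n (E ⧸ I) ?_ ?_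
    · exact (length_quotient_sq_le I (g.quotKerEquivOfSurjective hg)).trans h₂
    · refine le_trans (by exact_mod_cast h₃) ((le_ringKrullDim_quotient_map (E := E) q hPq).trans ?_)
      exact ringKrullDim_le_of_surjective (Ideal.Quotient.factor hIP)
        (Ideal.Quotient.factor_surjective hIP)
  have hIprime : I.IsPrime := (Ideal.Quotient.isDomain_iff_prime I).1 hdom
  have hann : Module.annihilator R M ≤ I.comap (algebraMap R E) := by
    intro r hr
    change g (algebraMap R E r) = 0
    rw [hg1, Algebra.algebraMap_eq_smul_one, TensorProduct.smul_tmul,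
      Module.mem_annihilator.1 hr, TensorProduct.tmul_zero]
  have hcomapq : ∀ r, algebraMap R E r ∈ P.map (algebraMap R E) → r ∈ P := by
    intro r hr
    have h1 : Disjoint (q.primeCompl : Set R) (P : Set R) :=
      Set.disjoint_left.2 fun x hx hxP => hx (hPq hxP)
    have h2 := IsLocalization.under_map_of_isPrime_disjoint q.primeCompl E
      (I := P) inferInstance h1
    rw [← h2]
    exact hr
  have hle : P ≤ I.comap (algebraMap R E) :=
    hP.2 ⟨hIprime.comap _, hann⟩ fun r hr => hcomapq r (hIP hr)
  refine ⟨y, fun x => ?_, fun t ht => ?_⟩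
  · obtain ⟨s, hs, hx⟩ := hy x
    exact ⟨s, fun h => hs (hPq h), hx⟩
  · obtain ⟨s, hs, hst⟩ := hIann t (hle ht)
    exact ⟨s, fun h => hs (hPq h), hst⟩

end LocalAnalysis


open Topology

/-! ### Sections of R_n/n² → κ(n) and functionals on κ(n). -/

section Section

variable {O L A : Type u} [CommRing O] [IsDomain O] [Field L] [CharZero L] [Algebra O L]
  [IsFractionRing O L] [CommRing A] [Algebra O A] (n : MaximalSpectrum A)

theorem modSqToKappa_mk (a : Localization.AtPrime n.asIdeal) :
    modSqToKappa n (Ideal.Quotient.mk _ a) = IsLocalRing.residue _ a := rfl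

theorem modSqToKappa_surjective : Function.Surjective (modSqToKappa n) := fun x => by
  obtain ⟨a, rfl⟩ := IsLocalRing.residue_surjective x
  exact ⟨Ideal.Quotient.mk _ a, rfl⟩

theorem ker_modSqToKappa_sq : RingHom.ker (modSqToKappa n) ^ 2 = ⊥ := by
  rw [eq_bot_iff, show RingHom.ker (modSqToKappa n) ^ 2 =
    RingHom.ker (modSqToKappa n) * RingHom.ker (modSqToKappa n) from pow_two _, Ideal.mul_le]
  intro x hx y hy
  obtain ⟨a, rfl⟩ := Ideal.Quotient.mk_surjective x
  obtain ⟨b, rfl⟩ := Ideal.Quotient.mk_surjective y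
  rw [RingHom.mem_ker, modSqToKappa_mk, IsLocalRing.residue_eq_zero_iff] at hx hy
  rw [← map_mul]
  refine Ideal.Quotient.eq_zero_iff_mem.2 ?_
  exact (pow_two (IsLocalRing.maximalIdeal (Localization.AtPrime n.asIdeal))).symm ▸
    Ideal.mul_mem_mul hx hy

variable (L) in
include L in
-- L is a localization of O, hence formally smooth over it, and κ(n) is separable algebraic over L
-- in characteristic zero, hence formally étale. The identity of κ(n) therefore lifts across the
-- square-zero kernel.
theorem exists_section (hinj : Function.Injective (algebraMap O (Kappa n)))
    [Algebra.IsAlgebraic O (Kappa n)] :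
    ∃ s : Kappa n →ₐ[O] ModSq n, ∀ x, modSqToKappa n (s x) = x := by
  let _ : Algebra L (Kappa n) := (IsFractionRing.lift hinj).toAlgebra
  have : IsScalarTower O L (Kappa n) := IsScalarTower.of_algebraMap_eq fun a =>
    (IsFractionRing.lift_algebraMap hinj a).symm
  have : Algebra.FormallySmooth O L := Algebra.FormallySmooth.of_isLocalization (nonZeroDivisors O)
  have : Algebra.IsAlgebraic L (Kappa n) := Algebra.IsAlgebraic.extendScalars (IsFractionRing.injective O L)
  have : Algebra.FormallyEtale L (Kappa n) := Algebra.FormallyEtale.of_isSeparable L (Kappa n)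
  have : Algebra.FormallySmooth O (Kappa n) := Algebra.FormallySmooth.comp O L (Kappa n)
  let g : ModSq n →ₐ[O] Kappa n := { modSqToKappa n with commutes' := fun _ => rfl }
  have hg : Function.Surjective g := modSqToKappa_surjective n
  refine ⟨Algebra.FormallySmooth.liftOfSurjective (AlgHom.id O (Kappa n)) g hg
    ⟨2, ker_modSqToKappa_sq n⟩, fun x => ?_⟩
  exact Algebra.FormallySmooth.liftOfSurjective_apply (AlgHom.id O (Kappa n)) g hg
    ⟨2, ker_modSqToKappa_sq n⟩ x

omit [IsDomain O] [CharZero L] in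
-- F contains L, and the inclusion of L splits as a map of vector spaces.
theorem exists_linearMap_ne_zero {F : Type u} [Field F] [Algebra O F]
    (hinj : Function.Injective (algebraMap O F)) : ∃ τ : F →ₗ[O] L, τ ≠ 0 := by
  let _ : Algebra L F := (IsFractionRing.lift hinj).toAlgebra
  have : IsScalarTower O L F := IsScalarTower.of_algebraMap_eq fun a =>
    (IsFractionRing.lift_algebraMap hinj a).symm
  obtain ⟨g, hg⟩ := (Algebra.linearMap L F).exists_leftInverse_of_injective
    (LinearMap.ker_eq_bot.2 (algebraMap L F).injective)
  refine ⟨g.restrictScalars O, fun h => ?_⟩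
  have h1 := LinearMap.congr_fun hg 1
  have h2 : g (Algebra.linearMap L F 1) = 0 := LinearMap.congr_fun h _
  rw [LinearMap.comp_apply, h2] at h1
  exact zero_ne_one h1

end Section

/-! ### Maximal ideals of R[1/p] viewed as primes of R. -/

section Points

variable {R : Type u} [CommRing R] {a : R} (n : MaximalSpectrum (Localization.Away a))

theorem isPrime_comap_point : (n.asIdeal.comap (algebraMap R (Localization.Away a))).IsPrime :=
  have := n.isMaximal.isPrime
  Ideal.IsPrime.comap _

theorem notMem_comap_point : a ∉ n.asIdeal.comap (algebraMap R (Localization.Away a)) := fun h =>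
  n.isMaximal.ne_top (Ideal.eq_top_of_isUnit_mem _ h
    (IsLocalization.Away.algebraMap_isUnit a))

/-- A larger prime missing a would survive in R[1/a] and properly contain a maximal ideal. -/
theorem mem_of_comap_point_lt (Q : Ideal R) [Q.IsPrime]
    (hQ : n.asIdeal.comap (algebraMap R (Localization.Away a)) < Q) : a ∈ Q := by
  by_contra ha
  have hd : Disjoint (Submonoid.powers a : Set R) (Q : Set R) :=
    (Ideal.disjoint_powers_iff_notMem_of_isPrime a).2 ha
  have h1 := IsLocalization.isPrime_of_isPrime_disjoint (Submonoid.powers a) (Localization.Away a) Q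
    inferInstance hd
  have h2 := IsLocalization.under_map_of_isPrime_disjoint (Submonoid.powers a) (Localization.Away a)
    (I := Q) inferInstance hd
  have h3 : n.asIdeal ≤ Q.map (algebraMap R (Localization.Away a)) := by
    rw [← IsLocalization.map_under (Submonoid.powers a) (Localization.Away a) n.asIdeal]
    exact Ideal.map_mono hQ.le
  have h4 := n.isMaximal.eq_of_le h1.ne_top h3
  rw [h4] at hQ
  change Ideal.comap _ _ < _ at hQ
  exact hQ.ne h2

theorem isLocalization_point :
    have := isPrime_comap_point n
    IsLocalization.AtPrime (Localization.AtPrime n.asIdeal)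
      (n.asIdeal.comap (algebraMap R (Localization.Away a))) :=
  IsLocalization.isLocalization_isLocalization_atPrime_isLocalization (Submonoid.powers a)
    (Localization.AtPrime n.asIdeal) n.asIdeal

theorem smul_modSq_eq_zero {r : R}
    (hr : r ∈ n.asIdeal.comap (algebraMap R (Localization.Away a)) ^ 2) (x : ModSq n) :
    r • x = 0 := by
  have h1 : n.asIdeal.comap (algebraMap R (Localization.Away a)) ≤
      (IsLocalRing.maximalIdeal (Localization.AtPrime n.asIdeal)).comap
        (algebraMap R (Localization.AtPrime n.asIdeal)) := by
    intro y hy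
    rw [Ideal.mem_comap, IsScalarTower.algebraMap_apply R (Localization.Away a)
      (Localization.AtPrime n.asIdeal)]
    exact (IsLocalization.AtPrime.to_map_mem_maximal_iff (Localization.AtPrime n.asIdeal)
      n.asIdeal _).2 hy
  have h2 : algebraMap R (Localization.AtPrime n.asIdeal) r ∈
      IsLocalRing.maximalIdeal (Localization.AtPrime n.asIdeal) ^ 2 := by
    have := Ideal.mem_map_of_mem (algebraMap R (Localization.AtPrime n.asIdeal)) hr
    rw [Ideal.map_pow] at this
    exact Ideal.pow_right_mono (Ideal.map_le_iff_le_comap.2 h1) 2 this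
  obtain ⟨x, rfl⟩ := Ideal.Quotient.mk_surjective x
  change Ideal.Quotient.mk _ (r • x) = 0
  rw [Algebra.smul_def]
  exact Ideal.Quotient.eq_zero_iff_mem.2 (Ideal.mul_mem_right _ _ h2)

theorem smul_kappa_eq_zero {r : R}
    (hr : r ∈ n.asIdeal.comap (algebraMap R (Localization.Away a)) ^ 2) (x : Kappa n) :
    r • x = 0 := by
  obtain ⟨y, rfl⟩ := modSqToKappa_surjective n x
  obtain ⟨y, rfl⟩ := Ideal.Quotient.mk_surjective y
  have h := congrArg (modSqToKappa n) (smul_modSq_eq_zero n hr (Ideal.Quotient.mk _ y))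
  rw [map_zero] at h
  rw [← h]
  rfl

/-- κ(n) consists of fractions of elements of R/q, which is finite over O. -/
theorem isAlgebraic_kappa {O : Type u} [CommRing O] [IsDomain O] [Algebra O R]
    [Module.Finite O (R ⧸ n.asIdeal.comap (algebraMap R (Localization.Away a)))] :
    Algebra.IsAlgebraic O (Kappa n) := by
  have h1 : ∀ r : R, IsAlgebraic O (algebraMap R (Kappa n) r) := by
    intro r
    have h2 : ∀ t ∈ n.asIdeal.comap (algebraMap R (Localization.Away a)),
        algebraMap R (Kappa n) t = 0 := by
      intro t ht
      rw [IsScalarTower.algebraMap_apply R (Localization.Away a) (Kappa n)]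
      exact (Ideal.algebraMap_residueField_eq_zero (I := n.asIdeal)).2 ht
    let f : (R ⧸ n.asIdeal.comap (algebraMap R (Localization.Away a))) →ₐ[O] Kappa n :=
      Ideal.Quotient.liftₐ _ (IsScalarTower.toAlgHom O R (Kappa n)) h2
    have h3 : IsIntegral O (f (Ideal.Quotient.mk _ r)) :=
      (Algebra.IsIntegral.isIntegral (R := O) (Ideal.Quotient.mk _ r)).map f
    have : Nontrivial O := inferInstance
    exact h3.isAlgebraic
  refine ⟨fun x => ?_⟩
  obtain ⟨y, rfl⟩ := IsLocalRing.residue_surjective x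
  have := isPrime_comap_point n
  have := isLocalization_point n
  obtain ⟨⟨r, s⟩, hrs⟩ := IsLocalization.surj
    (n.asIdeal.comap (algebraMap R (Localization.Away a))).primeCompl y
  have h4 := congrArg (IsLocalRing.residue (Localization.AtPrime n.asIdeal)) hrs
  rw [map_mul] at h4
  have h5 : IsLocalRing.residue (Localization.AtPrime n.asIdeal)
      (algebraMap R (Localization.AtPrime n.asIdeal) s) ≠ 0 :=
    ((IsLocalization.map_units (Localization.AtPrime n.asIdeal) s).map
      (IsLocalRing.residue _)).ne_zero
  rw [(eq_div_iff h5).2 h4, div_eq_mul_inv]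
  exact (h1 r).mul (h1 s).inv

end Points

/-- This converts a dimension over κ(n), acting through the section, into a length over R_n: each
scalar acts as a lift of its image. -/
theorem length_tensorProduct_le {R E F X M : Type*} [CommRing R] [CommRing E] [Field F]
    [AddCommGroup X] [Module R X] [Module E X] [Module F X] [SMulCommClass R E X]
    [SMulCommClass R F X] [AddCommGroup M] [Module R M]
    (h : ∀ b : F, ∃ e : E, ∀ x : X, b • x = e • x) :
    Module.length E (X ⊗[R] M) ≤ Cardinal.toENat (Module.rank F (X ⊗[R] M)) := by
  rw [← Module.length_eq_rank]
  refine length_le_of_forall_exists_smul fun b w => ?_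
  obtain ⟨e, he⟩ := h b
  refine ⟨e, ?_⟩
  induction w with
  | zero => rw [smul_zero, smul_zero]
  | add x y hx hy => rw [smul_add, smul_add, hx, hy]
  | tmul x y => rw [TensorProduct.smul_tmul', TensorProduct.smul_tmul', he]

/-- A nonzero non-unit is a unit times a positive power of ϖ, so p and ϖ lie in the same primes. -/
theorem natCast_mem_iff {O R : Type u} [CommRing O] [IsDomain O] [IsDiscreteValuationRing O]
    [CommRing R] [Algebra O R] {ϖ c : O} (hϖ : Irreducible ϖ) (hc : c ≠ 0) (hcu : ¬ IsUnit c)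
    (Q : Ideal R) [Q.IsPrime] : algebraMap O R c ∈ Q ↔ algebraMap O R ϖ ∈ Q := by
  obtain ⟨k, u, rfl⟩ := IsDiscreteValuationRing.eq_unit_mul_pow_irreducible hc hϖ
  rw [map_mul, Ideal.unit_mul_mem_iff_mem _ (u.isUnit.map (algebraMap O R)), map_pow]
  refine ⟨fun h => Ideal.IsPrime.mem_of_pow_mem inferInstance _ h, fun h => Ideal.pow_mem_of_mem _ h _ ?_⟩
  rcases Nat.eq_zero_or_pos k with rfl | hk
  · exact (hcu (by simp)).elim
  · exact hk

/-! ### The multiplicity hypotheses at a point. -/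

section Comparison

variable {O R K N L : Type u} [CommRing O] [IsDomain O] [IsDiscreteValuationRing O]
  [CommRing R] [IsLocalRing R] [IsNoetherianRing R] [Algebra O R]
  [Group K] [TopologicalSpace K]
  [AddCommGroup N] [Module (CompletedGroupAlgebra R K) N]
  [Module R N] [IsScalarTower R (CompletedGroupAlgebra R K) N] [Module O N] [IsScalarTower O R N]
  [TopologicalSpace N] [TopologicalSpace O] [IsTopologicalRing O]
  [ContinuousSMul (CompletedGroupAlgebra R K) N]
  [Field L] [CharZero L] [Algebra O L] [IsFractionRing O L] [TopologicalSpace L]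
  [IsTopologicalRing L]
  {V : Type u} [AddCommGroup V] [Module L V] [Module O V]
  [IsScalarTower O L V] {ρV : Representation L K V}
  {Θ : Submodule O V} [Submodule.IsLattice L Θ] {hΘ : ∀ g, ∀ x ∈ Θ, ρV g x ∈ Θ}
  [CompactSpace N] [Module.Finite (CompletedGroupAlgebra R K) N]
  [CompactSpace O] [T2Space O] {ϖ : O} [Finite (O ⧸ Ideal.span {ϖ})]

/-- The comparison turns the two dimension hypotheses into a fibre of rank at most one and the
length bound d + 1; the height bound comes from Noether normalization of R/P. -/
theorem exists_generic_generator_of_point [IsPrecomplete (IsLocalRing.maximalIdeal R) R]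
    (hϖ : Irreducible ϖ) (hϖR : algebraMap O R ϖ ∈ IsLocalRing.maximalIdeal R)
    (hk : Function.Surjective ((IsLocalRing.residue R).comp (algebraMap O R)))
    (hO : (𝓝 (0 : O)).HasBasis (fun _ : ℕ => True) fun j => {a | ϖ ^ j ∣ a})
    (hL : Continuous (algebraMap O L)) {c : O} (hc : c ≠ 0) (hcu : ¬ IsUnit c)
    {a : R} (hca : algebraMap O R c = a)
    (n : MaximalSpectrum (Localization.Away a))
    (h₁ : Module.rank (Kappa n) (HomBanach O R K N L (Kappa n) ρV) = 1) (d : ℕ)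
    (h₂ : ∀ s : Kappa n →ₐ[O] ModSq n, (∀ x, modSqToKappa n (s x) = x) →
      dimAlong (HomBanach O R K N L (ModSq n) ρV) (s : Kappa n →+* ModSq n) ≤ (d + 1 : ℕ∞))
    {P : Ideal R} (hPq : P ≤ n.asIdeal.comap (algebraMap R (Localization.Away a)))
    (hP : P ∈ (Module.annihilator R (MLattice O R K N (latticeRep ρV Θ hΘ))).minimalPrimes)
    (hPd : ringKrullDim (R ⧸ P) = d + 1) :
    ∃ y : MLattice O R K N (latticeRep ρV Θ hΘ),
      (∀ x, ∃ s, s ∉ P ∧ s • x ∈ Submodule.span R {y}) ∧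
      ∀ t ∈ P, ∃ s, s ∉ P ∧ s * t ∈
        Module.annihilator R (MLattice O R K N (latticeRep ρV Θ hΘ)) := by
  set q := n.asIdeal.comap (algebraMap R (Localization.Away a)) with hq
  have hqp : q.IsPrime := isPrime_comap_point n
  have hPp : P.IsPrime := hP.1.1
  have := isPrecomplete_of_compactSpace (O := O) (ϖ := ϖ)
  have : Module.Finite O Θ := Submodule.IsLattice.finite L Θ
  have hH : IsAdmissible R ϖ (HomCont O R K N (LinDual O Θ O)
    (contragredient O O (latticeRep ρV Θ hΘ))) := isAdmissible_homCont hϖ hk hO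
  have hfin : Module.Finite R (MLattice O R K N (latticeRep ρV Θ hΘ)) := hH.finite hϖ L hϖR
  have hmem : ∀ Q : Ideal R, Q.IsPrime → (a ∈ Q ↔ algebraMap O R ϖ ∈ Q) := fun Q hQ => by
    rw [← hca]
    exact natCast_mem_iff hϖ hc hcu Q
  have hϖq : algebraMap O R ϖ ∉ q := fun h => notMem_comap_point n ((hmem q hqp).2 h)
  have hqQ : ∀ Q : Ideal R, Q.IsPrime → q ≤ Q → algebraMap O R ϖ ∈ Q →
      Q = IsLocalRing.maximalIdeal R := fun Q hQ h1 h2 =>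
    eq_maximalIdeal_of_forall_lt_mem hϖq
      (fun Q' hQ' h => (hmem Q' hQ').1 (mem_of_comap_point_lt n Q' h)) Q hQ h1 h2
  -- q² kills both κ(n) and R_n/n², and it lies in the same primes as q.
  have hJ : ∀ Q : Ideal R, Q.IsPrime → q ^ 2 ≤ Q → algebraMap O R ϖ ∈ Q →
      Q = IsLocalRing.maximalIdeal R := fun Q hQ h1 h2 =>
    hqQ Q hQ (hQ.le_of_pow_le h1) h2
  have hinj : Function.Injective (algebraMap O (Kappa n)) := by
    rw [injective_iff_map_eq_zero]
    intro b hb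
    by_contra hb0
    obtain ⟨k, u, rfl⟩ := IsDiscreteValuationRing.eq_unit_mul_pow_irreducible hb0 hϖ
    rw [map_mul, (u.isUnit.map _).mul_right_eq_zero, map_pow] at hb
    have h1 := eq_zero_of_pow_eq_zero hb
    apply hϖq
    rw [IsScalarTower.algebraMap_apply O R (Kappa n),
      IsScalarTower.algebraMap_apply R (Localization.Away a) (Kappa n)] at h1
    have h2 : algebraMap R (Localization.Away a) (algebraMap O R ϖ) ∈ n.asIdeal :=
      (Ideal.algebraMap_residueField_eq_zero (I := n.asIdeal)).1 h1
    exact h2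
  obtain ⟨τ, hτ⟩ := exists_linearMap_ne_zero (L := L) hinj
  have : IsAdicComplete (IsLocalRing.maximalIdeal R) R := { }
  have : Module.Finite O (R ⧸ q) := finite_quotient_of_forall_isPrime hk ϖ hϖR q hqQ
  have : Algebra.IsAlgebraic O (Kappa n) := isAlgebraic_kappa n
  obtain ⟨s, hs⟩ := exists_section L n hinj
  have hloc : IsLocalization.AtPrime (Localization.AtPrime n.asIdeal) q := isLocalization_point n
  have hrank := rank_tensor_le_rank_homBanach (N := N) (ρV := ρV) (hΘ := hΘ) (m := Kappa n) hϖ hϖR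
    hk hO hL τ hτ (q ^ 2) hJ fun r hr x => smul_kappa_eq_zero n hr x
  rw [h₁] at hrank
  let _ : Module (Kappa n) (ModSq n) := Module.compHom (ModSq n) (s : Kappa n →+* ModSq n)
  have hsm : ∀ (b : Kappa n) (x : ModSq n), b • x = s b * x := fun _ _ => rfl
  have : IsScalarTower O (Kappa n) (ModSq n) := ⟨fun b c x => by
    rw [hsm, hsm, map_smul, smul_mul_assoc]⟩
  have : SMulCommClass R (Kappa n) (ModSq n) := ⟨fun r b x => by
    rw [hsm, hsm, mul_smul_comm]⟩
  have : SMulCommClass (Kappa n) O (ModSq n) := ⟨fun b r x => by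
    rw [hsm, hsm, mul_smul_comm]⟩
  have hrank₂ := rank_tensor_le_rank_homBanach (N := N) (ρV := ρV) (hΘ := hΘ) (m := ModSq n)
    (F := Kappa n) hϖ hϖR hk hO hL τ hτ (q ^ 2) hJ fun r hr x => smul_modSq_eq_zero n hr x
  have hdim : Cardinal.toENat (Module.rank (Kappa n) (HomBanach O R K N L (ModSq n) ρV)) ≤ d + 1 :=
    h₂ s hs
  refine exists_generic_generator (E := Localization.AtPrime n.asIdeal) q hPq hP d hrank ?_ ?_
  · refine (length_tensorProduct_le (F := Kappa n) fun b => ?_).trans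
      ((OrderHomClass.mono Cardinal.toENat hrank₂).trans hdim)
    obtain ⟨e, he⟩ := Ideal.Quotient.mk_surjective (s b)
    refine ⟨e, fun x => ?_⟩
    rw [hsm, ← he]
    rfl
  · exact le_height_map_quotientMk hk hϖ hϖR hPq hϖq hqQ hPd

end Comparison


/-! ### Local lengths and associated primes. -/

section LocalLength

variable {R : Type*} [CommRing R] (q : Ideal R) [q.IsPrime]

/-- The length of `M_q` over `R_q`. -/
noncomputable def localLength (M : Type*) [AddCommGroup M] [Module R M] : ℕ∞ :=
  Module.length (Localization.AtPrime q) (LocalizedModule q.primeCompl M)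

variable {M M' M'' : Type*} [AddCommGroup M] [Module R M] [AddCommGroup M'] [Module R M']
  [AddCommGroup M''] [Module R M'']

theorem localLength_eq_add_of_exact (f : M' →ₗ[R] M) (g : M →ₗ[R] M'')
    (hf : Function.Injective f) (hg : Function.Surjective g) (H : Function.Exact f g) :
    localLength q M = localLength q M' + localLength q M'' :=
  Module.length_eq_add_of_exact (LocalizedModule.map q.primeCompl f)
    (LocalizedModule.map q.primeCompl g) (LocalizedModule.map_injective _ f hf)
    (LocalizedModule.map_surjective _ g hg) (IsLocalizedModule.map_exact q.primeCompl _ _ _ f g H)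

theorem localLength_congr (e : M ≃ₗ[R] M') : localLength q M = localLength q M' := by
  refine le_antisymm ?_ ?_
  · exact Module.length_le_of_injective (LocalizedModule.map q.primeCompl e.toLinearMap)
      (LocalizedModule.map_injective _ _ e.injective)
  · exact Module.length_le_of_injective (LocalizedModule.map q.primeCompl e.symm.toLinearMap)
      (LocalizedModule.map_injective _ _ e.symm.injective)

theorem annihilator_le_of_localLength_ne_zero (h : localLength q M ≠ 0) :
    Module.annihilator R M ≤ q := by
  intro r hr
  by_contra hrq
  apply h
  rw [localLength, Module.length_eq_zero_iff]
  refine subsingleton_of_forall_eq 0 fun x => ?_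
  induction x with
  | h m s =>
    have : r • LocalizedModule.mk m s = 0 := by
      rw [LocalizedModule.smul'_mk, Module.mem_annihilator.1 hr, LocalizedModule.zero_mk]
    refine (IsLocalizedModule.smul_injective (LocalizedModule.mkLinearMap q.primeCompl M)
      (⟨r, hrq⟩ : q.primeCompl)) ?_
    simp only [smul_zero]
    exact this

/-- By hypothesis the localized ring modulo the annihilator of the localized module has dimension
zero, so it is Artinian. -/
theorem localLength_ne_top [IsNoetherianRing R] [Module.Finite R M]
    (h : ∀ Q : Ideal R, Q.IsPrime → Module.annihilator R M ≤ Q → Q ≤ q → Q = q) :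
    localLength q M ≠ ⊤ := by
  let A := Localization.AtPrime q
  let X := LocalizedModule q.primeCompl M
  let J := Module.annihilator A X
  let _ : Module (A ⧸ J) X := Module.quotientAnnihilator
  have : IsScalarTower A (A ⧸ J) X := ⟨fun a b x => by
    obtain ⟨b, rfl⟩ := Ideal.Quotient.mk_surjective b
    change (a * b) • x = a • b • x
    rw [mul_smul]⟩
  have : IsNoetherianRing A := IsLocalization.isNoetherianRing q.primeCompl A inferInstance
  have : Module.Finite A X := Module.Finite.of_isLocalizedModule q.primeCompl
    (LocalizedModule.mkLinearMap q.primeCompl M)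
  have : Module.Finite (A ⧸ J) X := Module.Finite.of_restrictScalars_finite A (A ⧸ J) X
  have hJ : ∀ r ∈ Module.annihilator R M, algebraMap R A r ∈ J := by
    intro r hr
    rw [Module.mem_annihilator]
    intro x
    induction x using LocalizedModule.induction_on with
    | h m s =>
      rw [algebraMap_smul, LocalizedModule.smul'_mk, Module.mem_annihilator.1 hr,
        LocalizedModule.zero_mk]
  have : Ring.KrullDimLE 0 (A ⧸ J) := Ring.KrullDimLE.mk₀ fun p hp => by
    have hp' : (p.comap (Ideal.Quotient.mk J)).IsPrime := Ideal.IsPrime.comap _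
    have h1 : (p.comap (Ideal.Quotient.mk J)).comap (algebraMap R A) = q := by
      refine h _ (Ideal.IsPrime.comap _) (fun r hr => ?_) fun r hr => ?_
      · rw [Ideal.mem_comap, Ideal.mem_comap, Ideal.Quotient.eq_zero_iff_mem.2 (hJ r hr)]
        exact p.zero_mem
      · by_contra hrq
        exact hp'.ne_top (Ideal.eq_top_of_isUnit_mem _ hr
          (IsLocalization.map_units A (⟨r, hrq⟩ : q.primeCompl)))
    have h2 : p.comap (Ideal.Quotient.mk J) = IsLocalRing.maximalIdeal A := by
      rw [← IsLocalization.map_under q.primeCompl A (p.comap (Ideal.Quotient.mk J)), Ideal.under_def,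
        h1, Localization.AtPrime.map_eq_maximalIdeal]
    rw [← Ideal.map_comap_of_surjective _ Ideal.Quotient.mk_surjective p]
    have h3 : (p.comap (Ideal.Quotient.mk J)).IsMaximal := h2 ▸ inferInstance
    refine Ideal.IsMaximal.map_of_surjective_of_ker_le Ideal.Quotient.mk_surjective ?_
    exact Ideal.comap_mono bot_le
  have : IsArtinianRing (A ⧸ J) := IsNoetherianRing.isArtinianRing_of_krullDimLE_zero
  have : IsArtinian A X := isArtinian_of_surjective_algebraMap (R := A ⧸ J)
    Ideal.Quotient.mk_surjective
  exact Module.length_ne_top (R := A) (M := X)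

end LocalLength

/-- An element of Q outside P is a nonzerodivisor on the domain R/P, and dividing by it lowers the
dimension. -/
theorem ringKrullDim_quotient_add_one_le {R : Type*} [CommRing R] {P Q : Ideal R} [P.IsPrime]
    (h : P < Q) : ringKrullDim (R ⧸ Q) + 1 ≤ ringKrullDim (R ⧸ P) := by
  obtain ⟨r, hrQ, hrP⟩ := Set.exists_of_ssubset h
  have h1 : Ideal.Quotient.mk P r ≠ 0 := fun h => hrP (Ideal.Quotient.eq_zero_iff_mem.1 h)
  refine le_trans (add_le_add_left ?_ 1)
    (ringKrullDim_quotient_succ_le_of_nonZeroDivisor (mem_nonZeroDivisors_of_ne_zero h1))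
  refine ringKrullDim_le_of_surjective (Ideal.Quotient.lift _ (Ideal.Quotient.factor h.le) ?_) ?_
  · intro a ha
    obtain ⟨b, rfl⟩ := Ideal.mem_span_singleton.1 ha
    rw [map_mul, Ideal.Quotient.factor_mk, Ideal.Quotient.eq_zero_iff_mem.2 hrQ, zero_mul]
  · exact Ideal.Quotient.lift_surjective_of_surjective _ _ (Ideal.Quotient.factor_surjective h.le)

/-- The annihilator of the class of t lies in an associated prime, which is minimal by hypothesis.
This is how generic statements become global. -/
theorem exists_minimalPrimes_mem_of_smul_notMem {R : Type*} [CommRing R] [IsNoetherianRing R]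
    {I : Ideal R} (h : associatedPrimes R (R ⧸ I) ⊆ I.minimalPrimes) {t : R} (ht : t ∉ I) :
    ∃ P ∈ I.minimalPrimes, ∀ s, s * t ∈ I → s ∈ P := by
  have hx : Ideal.Quotient.mk I t ≠ 0 := fun h => ht (Ideal.Quotient.eq_zero_iff_mem.1 h)
  obtain ⟨P, hP, hle⟩ := exists_le_isAssociatedPrime_of_isNoetherianRing R _ hx
  refine ⟨P, h hP, fun s hs => hle ?_⟩
  rw [Submodule.mem_colon_singleton, Submodule.mem_bot]
  exact Ideal.Quotient.eq_zero_iff_mem.2 hs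

theorem associatedPrimes_quotient_subset {R : Type*} [CommRing R] [IsNoetherianRing R] {I : Ideal R}
    (h : associatedPrimes (R ⧸ I) (R ⧸ I) ⊆ minimalPrimes (R ⧸ I)) :
    associatedPrimes R (R ⧸ I) ⊆ I.minimalPrimes := by
  intro P hP
  obtain ⟨hPp, x, hx⟩ := isAssociatedPrime_iff.1 hP
  have hIP : I ≤ P := fun r hr => by
    obtain ⟨y, rfl⟩ := Ideal.Quotient.mk_surjective x
    rw [hx, Submodule.mem_colon_singleton, Submodule.mem_bot]
    exact Ideal.Quotient.eq_zero_iff_mem.2 (I.mul_mem_right y hr)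
  have hker : RingHom.ker (Ideal.Quotient.mk I) ≤ P := by rwa [Ideal.mk_ker]
  have hc : (P.map (Ideal.Quotient.mk I)).comap (Ideal.Quotient.mk I) = P := by
    rw [Ideal.comap_map_of_surjective _ Ideal.Quotient.mk_surjective, ← RingHom.ker_eq_comap_bot,
      sup_eq_left.2 hker]
  have h1 : P.map (Ideal.Quotient.mk I) ∈ associatedPrimes (R ⧸ I) (R ⧸ I) := by
    refine isAssociatedPrime_iff.2 ⟨Ideal.map_isPrime_of_surjective Ideal.Quotient.mk_surjective hker,
      x, ?_⟩
    ext y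
    obtain ⟨y, rfl⟩ := Ideal.Quotient.mk_surjective y
    rw [← Ideal.mem_comap, hc, hx, Submodule.mem_colon_singleton, Submodule.mem_colon_singleton]
    rfl
  have h2 := h h1
  rw [← hc, Ideal.minimalPrimes_eq_comap]
  exact ⟨_, h2, rfl⟩

/-! ### From generic cyclicity to equality of lengths. -/

section GenericGenerator

variable {R M : Type*} [CommRing R] [IsNoetherianRing R] [AddCommGroup M] [Module R M]
  [Module.Finite R M]

omit [IsNoetherianRing R] in
theorem exists_notMem_smul_eq_zero {P : Ideal R} [P.IsPrime] (h : ∀ x : M, ∃ s, s ∉ P ∧ s • x = 0) :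
    ∃ s ∉ P, s ∈ Module.annihilator R M := by
  obtain ⟨k, x, hx⟩ := Module.Finite.exists_fin (R := R) (M := M)
  choose s hs hsx using fun i => h (x i)
  refine ⟨∏ i, s i, fun h => ?_, ?_⟩
  · obtain ⟨i, _, hi⟩ := (Ideal.IsPrime.prod_mem_iff).1 h
    exact hs i hi
  rw [Module.mem_annihilator]
  intro m
  have hm : m ∈ Submodule.span R (Set.range x) := by rw [hx]; trivial
  induction hm using Submodule.span_induction with
  | mem m hm =>
    obtain ⟨i, rfl⟩ := hm
    rw [← Finset.prod_erase_mul _ _ (Finset.mem_univ i), mul_smul, hsx, smul_zero]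
  | zero => rw [smul_zero]
  | add a b _ _ ha hb => rw [smul_add, ha, hb, add_zero]
  | smul c a _ ha => rw [smul_comm, ha, smul_zero]

/-- A nilpotent t lies in every minimal prime, so it vanishes generically on each component; without
embedded primes it is zero. -/
theorem isReduced_of_generic {I : Ideal R}
    (hass : associatedPrimes R (R ⧸ I) ⊆ I.minimalPrimes)
    (hg : ∀ P ∈ I.minimalPrimes, ∀ t ∈ P, ∃ s, s ∉ P ∧ s * t ∈ I) : IsReduced (R ⧸ I) := by
  refine ⟨fun x ⟨n, hn⟩ => ?_⟩
  obtain ⟨t, rfl⟩ := Ideal.Quotient.mk_surjective x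
  rw [← map_pow, Ideal.Quotient.eq_zero_iff_mem] at hn
  rw [Ideal.Quotient.eq_zero_iff_mem]
  by_contra ht
  obtain ⟨P, hP, hs⟩ := exists_minimalPrimes_mem_of_smul_notMem hass ht
  obtain ⟨s, hsP, hst⟩ := hg P hP t (hP.1.1.mem_of_pow_mem n (hP.1.2 hn))
  exact hsP (hs s hst)

/-- Take m = ∑ c_P y_P, where c_P lies in every minimal prime except P. Near P the other terms
vanish because 𝔞 and P agree there. If r m = 0, then r M vanishes at every minimal prime, so r ∈ 𝔞
by the absence of embedded primes. -/
theorem exists_generator_of_generic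
    (hass : associatedPrimes R (R ⧸ Module.annihilator R M) ⊆ (Module.annihilator R M).minimalPrimes)
    (hg : ∀ P ∈ (Module.annihilator R M).minimalPrimes, ∃ y : M,
      (∀ x : M, ∃ s, s ∉ P ∧ s • x ∈ Submodule.span R {y}) ∧
      ∀ t ∈ P, ∃ s, s ∉ P ∧ s * t ∈ Module.annihilator R M) :
    ∃ m : M, (∀ r : R, r • m = 0 → r ∈ Module.annihilator R M) ∧
      ∀ P ∈ (Module.annihilator R M).minimalPrimes, ∀ x : M,
        ∃ s, s ∉ P ∧ s • x ∈ Submodule.span R {m} := by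
  classical
  set I := Module.annihilator R M
  have hfin := I.finite_minimalPrimes_of_isNoetherianRing
  have := hfin.fintype
  have hp : ∀ P : I.minimalPrimes, P.1.IsPrime := fun P => P.2.1.1
  choose y hy ht using fun P : I.minimalPrimes => hg P.1 P.2
  have h1 : ∀ P : I.minimalPrimes, ∃ c, c ∉ P.1 ∧ ∀ Q : I.minimalPrimes, Q ≠ P → c ∈ Q.1 := by
    intro P
    have h2 : ∀ Q : I.minimalPrimes, ∃ c, c ∉ P.1 ∧ (Q ≠ P → c ∈ Q.1) := by
      intro Q
      by_cases hQ : Q = P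
      · exact ⟨1, fun h => (hp P).ne_top ((Ideal.eq_top_iff_one _).2 h), fun h => (h hQ).elim⟩
      · have h3 : ¬ Q.1 ≤ P.1 := fun h => hQ (Subtype.ext (le_antisymm h (P.2.2 Q.2.1 h)))
        obtain ⟨c, hc, hcP⟩ := SetLike.not_le_iff_exists.1 h3
        exact ⟨c, hcP, fun _ => hc⟩
    choose c hc hcQ using h2
    refine ⟨∏ Q, c Q, fun h => ?_, fun Q hQ => ?_⟩
    · obtain ⟨Q, _, hQ⟩ := (hp P).prod_mem_iff.1 h
      exact hc Q hQ
    · rw [← Finset.prod_erase_mul _ _ (Finset.mem_univ Q)]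
      exact Q.1.mul_mem_left _ (hcQ Q hQ)
  choose c hc hcQ using h1
  let m := ∑ P, c P • y P
  have hm : ∀ P ∈ I.minimalPrimes, ∀ x : M, ∃ s, s ∉ P ∧ s • x ∈ Submodule.span R {m} := by
    intro P hP x
    lift P to I.minimalPrimes using hP
    have h2 : ∀ Q : I.minimalPrimes, ∃ s, s ∉ P.1 ∧ (Q ≠ P → s * c Q ∈ I) := by
      intro Q
      by_cases hQ : Q = P
      · exact ⟨1, fun h => (hp P).ne_top ((Ideal.eq_top_iff_one _).2 h), fun h => (h hQ).elim⟩
      · obtain ⟨s, hs, hsc⟩ := ht P (c Q) (hcQ Q P (Ne.symm hQ))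
        exact ⟨s, hs, fun _ => hsc⟩
    choose s hs hsc using h2
    have hsP : ∏ Q, s Q ∉ P.1 := fun h => by
      obtain ⟨Q, _, hQ⟩ := (hp P).prod_mem_iff.1 h
      exact hs Q hQ
    have hsm : (∏ Q, s Q) • m = (∏ Q, s Q) • c P • y P := by
      rw [Finset.smul_sum, Finset.sum_eq_single P]
      · intro Q _ hQ
        rw [smul_smul, ← Finset.prod_erase_mul _ _ (Finset.mem_univ Q), mul_assoc]
        exact Module.mem_annihilator.1 (I.mul_mem_left _ (hsc Q hQ)) _
      · exact fun h => (h (Finset.mem_univ P)).elim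
    obtain ⟨s', hs', hx⟩ := hy P x
    obtain ⟨a, ha⟩ := Submodule.mem_span_singleton.1 hx
    refine ⟨((∏ Q, s Q) * c P) * s', fun h => ?_, Submodule.mem_span_singleton.2
      ⟨a * ∏ Q, s Q, ?_⟩⟩
    · rcases (hp P).mem_or_mem h with h | h
      · exact ((hp P).mem_or_mem h).elim hsP (hc P)
      · exact hs' h
    · rw [mul_smul, hsm, mul_smul, ← ha, smul_comm _ a, mul_smul]
  refine ⟨m, fun r hr => ?_, hm⟩
  by_contra hrI
  obtain ⟨P, hP, hs⟩ := exists_minimalPrimes_mem_of_smul_notMem hass hrI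
  have := hP.1.1
  have h3 : ∀ x : (Submodule.map (LinearMap.lsmul R M r) ⊤), ∃ s, s ∉ P ∧ s • x = 0 := by
    rintro ⟨_, x, -, rfl⟩
    obtain ⟨s, hs, hx⟩ := hm P hP x
    obtain ⟨a, ha⟩ := Submodule.mem_span_singleton.1 hx
    refine ⟨s, hs, Subtype.ext ?_⟩
    change s • r • x = 0
    rw [smul_comm, ← ha, smul_comm, hr, smul_zero]
  obtain ⟨s, hsP, hsr⟩ := exists_notMem_smul_eq_zero h3
  refine hsP (hs s (Module.mem_annihilator.2 fun x => ?_))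
  rw [mul_smul]
  exact congrArg Subtype.val (Module.mem_annihilator.1 hsr ⟨r • x, x, trivial, rfl⟩)

/-- Let T = Rm ≅ R/I. The module M/xT is an extension of M/T by T/xT ≅ R/(x, I). It is also an
extension of M/xM by M/T, embedded by multiplication by x. The length of M/T at q is finite, so it
cancels. -/
theorem localLength_quotient_eq {I : Ideal R} (hI : I = Module.annihilator R M) {x : R}
    (hx : ∀ m : M, x • m = 0 → m = 0) {M' : Type*} [AddCommGroup M'] [Module R M']
    (Ψ : M →ₗ[R] M') (hΨ : Function.Surjective Ψ) (hker : ∀ m, Ψ m = 0 ↔ ∃ m', m = x • m')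
    {m : M} (hm : ∀ r : R, r • m = 0 → r ∈ I)
    (hgen : ∀ P ∈ I.minimalPrimes, ∀ x : M, ∃ s, s ∉ P ∧ s • x ∈ Submodule.span R {m})
    (q : Ideal R) [q.IsPrime] {n : ℕ} (hq : ringKrullDim (R ⧸ q) = n)
    (hdim : ∀ P ∈ I.minimalPrimes, ringKrullDim (R ⧸ P) ≤ n + 1) :
    localLength q (R ⧸ (Ideal.span {x} ⊔ I)) = localLength q M' := by
  let T : Submodule R M := Submodule.span R {m}
  let T' : Submodule R M := Submodule.span R {x • m}
  have hT' : T' ≤ T := Submodule.span_le.2 (Set.singleton_subset_iff.2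
    (T.smul_mem x (Submodule.mem_span_singleton_self m)))
  -- M/T vanishes at the minimal primes of I, so a prime in its support properly contains one and
  -- has dimension at most n. Such a prime inside q equals q.
  have hfin : localLength q (M ⧸ T) ≠ ⊤ := by
    refine localLength_ne_top q fun Q hQ hle hQq => ?_
    have hIQ : I ≤ Q := by
      refine le_trans (fun r hr => ?_) hle
      rw [hI] at hr
      rw [Module.mem_annihilator]
      intro y
      obtain ⟨y, rfl⟩ := Submodule.mkQ_surjective _ y
      rw [← map_smul, Module.mem_annihilator.1 hr, map_zero]
    obtain ⟨P, hP, hPQ⟩ := Ideal.exists_minimalPrimes_le hIQ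
    have hPp : P.IsPrime := hP.1.1
    have hne : P ≠ Q := by
      rintro rfl
      obtain ⟨s, hs, hs'⟩ := exists_notMem_smul_eq_zero (P := P) (M := M ⧸ T) fun y => by
        obtain ⟨y, rfl⟩ := Submodule.mkQ_surjective _ y
        obtain ⟨s, hs, hy⟩ := hgen P hP y
        refine ⟨s, hs, ?_⟩
        rw [← map_smul, Submodule.mkQ_apply, Submodule.Quotient.mk_eq_zero]
        exact hy
      exact hs (hle hs')
    by_contra hQne
    have h1 := ringKrullDim_quotient_add_one_le (lt_of_le_of_ne hQq hQne)
    have h2 := ringKrullDim_quotient_add_one_le (lt_of_le_of_ne hPQ hne)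
    rw [hq] at h1
    have h3 : ((n + 1 + 1 : ℕ) : WithBot ℕ∞) ≤ ((n + 1 : ℕ) : WithBot ℕ∞) := by
      push_cast
      exact ((add_le_add_left h1 1).trans h2).trans (hdim P hP)
    have h4 : n + 1 + 1 ≤ n + 1 := by exact_mod_cast h3
    omega
  have h1 : localLength q (M ⧸ T') =
      localLength q (R ⧸ (Ideal.span {x} ⊔ I)) + localLength q (M ⧸ T) := by
    have hle : (Ideal.span {x} ⊔ I : Ideal R) ≤ LinearMap.ker (T'.mkQ.comp
        (LinearMap.toSpanSingleton R M m)) := by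
      refine sup_le (Ideal.span_le.2 (Set.singleton_subset_iff.2 ?_)) fun r hr => ?_
      · rw [SetLike.mem_coe, LinearMap.mem_ker, LinearMap.comp_apply,
          LinearMap.toSpanSingleton_apply, Submodule.mkQ_apply, Submodule.Quotient.mk_eq_zero]
        exact Submodule.mem_span_singleton_self _
      · rw [hI] at hr
        rw [LinearMap.mem_ker, LinearMap.comp_apply,
          LinearMap.toSpanSingleton_apply, Module.mem_annihilator.1 hr, map_zero]
    refine localLength_eq_add_of_exact q (Submodule.liftQ _ _ hle) (Submodule.factor hT') ?_
      (Submodule.factor_surjective hT') ?_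
    · rw [injective_iff_map_eq_zero]
      intro r hr
      obtain ⟨r, rfl⟩ := Submodule.mkQ_surjective _ r
      rw [Submodule.mkQ_apply, Submodule.liftQ_apply, LinearMap.comp_apply,
        LinearMap.toSpanSingleton_apply, Submodule.mkQ_apply, Submodule.Quotient.mk_eq_zero] at hr
      obtain ⟨a, ha⟩ := Submodule.mem_span_singleton.1 hr
      rw [Submodule.mkQ_apply, Submodule.Quotient.mk_eq_zero]
      have h2 : r - a * x ∈ I := hm _ (by rw [sub_smul, mul_smul, ha, sub_self])
      have h3 : r = a * x + (r - a * x) := by ring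
      rw [h3]
      exact Submodule.add_mem_sup (Ideal.mul_mem_left _ _ (Ideal.mem_span_singleton_self x)) h2
    · intro y
      obtain ⟨y, rfl⟩ := Submodule.mkQ_surjective _ y
      constructor
      · intro hy
        have hy' : y ∈ T := (Submodule.Quotient.mk_eq_zero T).1 hy
        obtain ⟨a, rfl⟩ := Submodule.mem_span_singleton.1 hy'
        exact ⟨Submodule.Quotient.mk a, rfl⟩
      · rintro ⟨a, ha⟩
        obtain ⟨a, rfl⟩ := Submodule.mkQ_surjective _ a
        rw [← ha]
        exact (Submodule.Quotient.mk_eq_zero T).2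
          (T.smul_mem a (Submodule.mem_span_singleton_self m))
  have h2 : localLength q (M ⧸ T') = localLength q (M ⧸ T) + localLength q M' := by
    have hle₁ : T ≤ T'.comap (LinearMap.lsmul R M x) := by
      refine Submodule.span_le.2 (Set.singleton_subset_iff.2 ?_)
      exact Submodule.mem_span_singleton_self _
    have hle₂ : T' ≤ LinearMap.ker Ψ := by
      refine Submodule.span_le.2 (Set.singleton_subset_iff.2 ?_)
      exact (hker _).2 ⟨m, rfl⟩
    refine localLength_eq_add_of_exact q (Submodule.mapQ T T' _ hle₁) (Submodule.liftQ _ Ψ hle₂)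
      ?_ ?_ ?_
    · rw [injective_iff_map_eq_zero]
      intro y hy
      obtain ⟨y, rfl⟩ := Submodule.mkQ_surjective _ y
      have hy' : x • y ∈ T' := (Submodule.Quotient.mk_eq_zero T').1 hy
      obtain ⟨a, ha⟩ := Submodule.mem_span_singleton.1 hy'
      refine (Submodule.Quotient.mk_eq_zero T).2 (Submodule.mem_span_singleton.2 ⟨a, ?_⟩)
      rw [← sub_eq_zero]
      exact hx _ (by rw [smul_sub, smul_comm, ha, sub_self])
    · intro y
      obtain ⟨y, rfl⟩ := hΨ y
      exact ⟨Submodule.Quotient.mk y, rfl⟩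
    · intro y
      obtain ⟨y, rfl⟩ := Submodule.mkQ_surjective _ y
      constructor
      · intro hy
        obtain ⟨y', rfl⟩ := (hker y).1 hy
        exact ⟨Submodule.Quotient.mk y', rfl⟩
      · rintro ⟨a, ha⟩
        obtain ⟨a, rfl⟩ := Submodule.mkQ_surjective _ a
        rw [← ha]
        exact (hker _).2 ⟨a, rfl⟩
  rw [h1, add_comm] at h2
  exact (ENat.add_right_injective_of_ne_top hfin) h2

end GenericGenerator


/-! ### Additivity of cycles. -/

section Cycle

variable {R : Type*} [CommRing R] {e : WithBot ℕ∞}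

theorem cycle_eq (M : Type*) [AddCommGroup M] [Module R M] :
    (cycle e M : Cycles R e) = ∑ᶠ q : {q : PrimeSpectrum R // ringKrullDim (R ⧸ q.asIdeal) = e},
      Finsupp.single q ((localLength q.1.asIdeal M).toNat : ℤ) := rfl

theorem cycle_congr {M M' : Type*} [AddCommGroup M] [Module R M] [AddCommGroup M'] [Module R M']
    (h : ∀ (q : Ideal R) [q.IsPrime], ringKrullDim (R ⧸ q) = e →
      localLength q M = localLength q M') : cycle e M = (cycle e M' : Cycles R e) := by
  rw [cycle_eq, cycle_eq]
  exact finsum_congr fun q => by rw [h q.1.asIdeal q.2]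

theorem cycle_congr_equiv {M M' : Type*} [AddCommGroup M] [Module R M] [AddCommGroup M']
    [Module R M'] (f : M ≃ₗ[R] M') : cycle e M = (cycle e M' : Cycles R e) :=
  cycle_congr fun q _ _ => localLength_congr q f

theorem cycle_eq_zero_of_subsingleton {M : Type*} [AddCommGroup M] [Module R M] [Subsingleton M] :
    cycle e M = (0 : Cycles R e) := by
  have h : ∀ q : {q : PrimeSpectrum R // ringKrullDim (R ⧸ q.asIdeal) = e},
      Finsupp.single q ((localLength q.1.asIdeal M).toNat : ℤ) = 0 := fun q => by
    by_contra h
    have h1 : localLength q.1.asIdeal M ≠ 0 := fun h1 => h (by rw [h1]; simp)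
    have h2 := annihilator_le_of_localLength_ne_zero q.1.asIdeal h1
    rw [Module.annihilator_eq_top_iff.2 inferInstance, top_le_iff] at h2
    exact q.1.isPrime.ne_top h2
  rw [cycle_eq, finsum_congr h, finsum_zero]

variable [IsNoetherianRing R] (he : e ≠ ⊤)
include he

omit [IsNoetherianRing R] in
-- A prime of the maximal allowed dimension is minimal over the annihilator if it contains it. This
-- yields finite lengths and finitely many terms.
theorem eq_of_supportDim_le {M : Type*} [AddCommGroup M] [Module R M] [Module.Finite R M]
    (hM : Module.supportDim R M ≤ e) {q : Ideal R} [q.IsPrime] (hq : ringKrullDim (R ⧸ q) = e)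
    {Q : Ideal R} [Q.IsPrime] (hQ : Module.annihilator R M ≤ Q) (hQq : Q ≤ q) : Q = q := by
  by_contra hne
  have h1 := ringKrullDim_quotient_add_one_le (lt_of_le_of_ne hQq hne)
  have h2 : ringKrullDim (R ⧸ Q) ≤ e :=
    (ringKrullDim_le_of_surjective (Ideal.Quotient.factor hQ)
      (Ideal.Quotient.factor_surjective hQ)).trans
      ((Module.supportDim_eq_ringKrullDim_quotient_annihilator (R := R) (M := M)).symm.trans_le hM)
  have h3 : ringKrullDim (R ⧸ q) ≠ ⊥ := fun h =>
    absurd (ringKrullDim_nonneg_of_nontrivial (R := R ⧸ q)) (by rw [h]; simp)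
  rw [hq] at h1 h3
  have h4 := h1.trans h2
  cases e with
  | bot => exact h3 rfl
  | coe e =>
    cases e with
    | top => exact he rfl
    | coe e =>
      have h5 : e + 1 ≤ e := by exact_mod_cast h4
      omega

theorem finite_setOf_localLength_ne_zero {M : Type*} [AddCommGroup M] [Module R M]
    [Module.Finite R M] (hM : Module.supportDim R M ≤ e) :
    {q : {q : PrimeSpectrum R // ringKrullDim (R ⧸ q.asIdeal) = e} |
      localLength q.1.asIdeal M ≠ 0}.Finite := by
  refine Set.Finite.of_finite_image (f := fun q => q.1.asIdeal)
    ((Module.annihilator R M).finite_minimalPrimes_of_isNoetherianRing.subset ?_)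
    fun q _ q' _ h => Subtype.ext (PrimeSpectrum.ext h)
  rintro _ ⟨q, hq, rfl⟩
  refine ⟨⟨q.1.isPrime, annihilator_le_of_localLength_ne_zero _ hq⟩, fun Q hQ hle => ?_⟩
  have := hQ.1
  exact (eq_of_supportDim_le he hM q.2 hQ.2 hle).ge

theorem finite_support_cycle {M : Type*} [AddCommGroup M] [Module R M]
    [Module.Finite R M] (hM : Module.supportDim R M ≤ e) :
    (Function.support fun q : {q : PrimeSpectrum R // ringKrullDim (R ⧸ q.asIdeal) = e} =>
      Finsupp.single q ((localLength q.1.asIdeal M).toNat : ℤ)).Finite := by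
  refine (finite_setOf_localLength_ne_zero he hM).subset fun q hq h => hq ?_
  change Finsupp.single q _ = 0
  rw [h]
  simp

theorem cycle_eq_add_of_exact {M M' M'' : Type*} [AddCommGroup M] [Module R M] [AddCommGroup M']
    [Module R M'] [AddCommGroup M''] [Module R M''] [Module.Finite R M]
    (hM : Module.supportDim R M ≤ e) (f : M' →ₗ[R] M) (g : M →ₗ[R] M'')
    (hf : Function.Injective f) (hg : Function.Surjective g) (H : Function.Exact f g) :
    cycle e M = (cycle e M' + cycle e M'' : Cycles R e) := by
  have : Module.Finite R M' := Module.Finite.of_injective f hf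
  have : Module.Finite R M'' := Module.Finite.of_surjective g hg
  have hM' : Module.supportDim R M' ≤ e := (Module.supportDim_le_of_injective f hf).trans hM
  have hM'' : Module.supportDim R M'' ≤ e := (Module.supportDim_le_of_surjective g hg).trans hM
  rw [cycle_eq, cycle_eq, cycle_eq, ← finsum_add_distrib (finite_support_cycle he hM')
    (finite_support_cycle he hM'')]
  refine finsum_congr fun q => ?_
  rw [← Finsupp.single_add]
  have h1 := localLength_eq_add_of_exact q.1.asIdeal f g hf hg H
  have h2 : localLength q.1.asIdeal M' ≠ ⊤ := localLength_ne_top _ fun Q hQ hle hQq =>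
    eq_of_supportDim_le he hM' q.2 hle hQq
  have h3 : localLength q.1.asIdeal M'' ≠ ⊤ := localLength_ne_top _ fun Q hQ hle hQq =>
    eq_of_supportDim_le he hM'' q.2 hle hQq
  rw [h1, ENat.toNat_add h2 h3, Nat.cast_add]

end Cycle

theorem sum_eq_finsum_card_nsmul {ι α A : Type*} [Fintype ι] [AddCommMonoid A] (γ : ι → α)
    (F : α → A) : ∑ i, F (γ i) = ∑ᶠ c, Nat.card {i // γ i = c} • F c := by
  classical
  rw [finsum_eq_sum_of_support_subset (s := Finset.univ.image γ)]
  · rw [Finset.sum_comp]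
    refine Finset.sum_congr rfl fun c _ => ?_
    rw [Nat.card_eq_fintype_card, Fintype.card_subtype]
  · intro c hc
    rw [Function.mem_support] at hc
    have h1 : Nat.card {i // γ i = c} ≠ 0 := fun h => hc (by rw [h, zero_smul])
    obtain ⟨⟨⟨i, hi⟩⟩, _⟩ := Nat.card_ne_zero.1 h1
    exact Finset.mem_coe.2 (Finset.mem_image.2 ⟨i, Finset.mem_univ i, hi⟩)

theorem eq_sum_of_succ_eq_add {A : Type*} [AddCommMonoid A] {n : ℕ} (f : Fin (n + 1) → A)
    (g : Fin n → A) (h0 : f 0 = 0) (h : ∀ i : Fin n, f i.succ = f i.castSucc + g i) :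
    f (Fin.last n) = ∑ i, g i := by
  induction n with
  | zero => simpa using h0
  | succ n ih =>
    rw [← Fin.succ_last, h, Fin.sum_univ_castSucc]
    congr 1
    exact ih (fun i => f i.castSucc) (fun i => g i.castSucc) h0 fun i => h i.castSucc

/-! ### Jordan–Hölder multiplicities and irreducible representations. -/

section JordanHolder

variable {A K X Y : Type*} [CommRing A] [Group K] [AddCommGroup X] [Module A X]
  [AddCommGroup Y] [Module A Y]

/-- By Jordan–Hölder all composition series give the same count, so the supremum is taken over a
single value. -/
theorem jhMultiplicity_eq_card (ρ : Representation A K X) (σ : Representation A K Y)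
    (s : CompositionSeries (Submodule A[K] ρ.asModule)) (h₀ : s.head = ⊥) (h₁ : s.last = ⊤) :
    jhMultiplicity ρ σ = Nat.card {i : Fin s.length //
      Nonempty ((s i.succ ⧸ (s i.castSucc).submoduleOf (s i.succ)) ≃ₗ[A[K]] σ.asModule)} := by
  have h : {n : ℕ | ∃ s : CompositionSeries (Submodule A[K] ρ.asModule),
      RelSeries.head s = ⊥ ∧ RelSeries.last s = ⊤ ∧
      n = Nat.card {i : Fin s.length //
        Nonempty ((s i.succ ⧸ (s i.castSucc).submoduleOf (s i.succ)) ≃ₗ[A[K]] σ.asModule)}} =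
      {Nat.card {i : Fin s.length //
        Nonempty ((s i.succ ⧸ (s i.castSucc).submoduleOf (s i.succ)) ≃ₗ[A[K]] σ.asModule)}} := by
    ext n
    constructor
    · rintro ⟨t, ht₀, ht₁, rfl⟩
      obtain ⟨f, hf⟩ := CompositionSeries.jordan_holder t s (ht₀.trans h₀.symm) (ht₁.trans h₁.symm)
      refine Nat.card_congr (f.subtypeEquiv fun i => ?_)
      have ε := (hf i).linearEquiv
      exact ⟨fun ⟨δ⟩ => ⟨ε.symm.trans δ⟩, fun ⟨δ⟩ => ⟨ε.trans δ⟩⟩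
    · rintro rfl
      exact ⟨s, h₀, h₁, rfl⟩
  rw [jhMultiplicity, h, csSup_singleton]

end JordanHolder


open Topology

section GroupAlgebra

variable {O K W T : Type u} [CommRing O] [Group K] [AddCommGroup W] [Module O[K] W]
  [AddCommGroup T] [Module O T]

theorem nonempty_linearEquiv_asModule (ρ : Representation O K T) (e : W ≃+ T)
    (h₁ : ∀ (a : O) x, e (algebraMap O O[K] a • x) = a • e x)
    (h₂ : ∀ g x, e (MonoidAlgebra.of O K g • x) = ρ g (e x)) :
    Nonempty (W ≃ₗ[O[K]] ρ.asModule) := by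
  refine ⟨{ e.trans ρ.asModuleEquiv.symm.toAddEquiv with map_smul' := fun b x => ?_ }⟩
  change (e (b • x) : T) = ρ.asAlgebraHom b (e x)
  induction b using MonoidAlgebra.induction_on generalizing x with
  | of g => rw [h₂, Representation.asAlgebraHom_of]
  | add b c hb hc => rw [add_smul, map_add, map_add, LinearMap.add_apply, hb, hc]
  | smul r b hb => rw [Algebra.smul_def, mul_smul, h₁, hb, ← Algebra.smul_def, map_smul,
      LinearMap.smul_apply]

theorem exists_linearEquiv_of_asModule (ρ : Representation O K T) (ε : W ≃ₗ[O[K]] ρ.asModule) :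
    ∃ e : W ≃+ T, (∀ (a : O) x, e (algebraMap O O[K] a • x) = a • e x) ∧
      ∀ g x, e (MonoidAlgebra.of O K g • x) = ρ g (e x) := by
  refine ⟨ε.toAddEquiv.trans ρ.asModuleEquiv.toAddEquiv, fun a x => ?_, fun g x => ?_⟩
  · change ρ.asModuleEquiv (ε (algebraMap O O[K] a • x)) = a • ρ.asModuleEquiv (ε x)
    rw [map_smul, Representation.asModuleEquiv_map_smul, AlgHom.commutes]
    rfl
  · change ρ.asModuleEquiv (ε (MonoidAlgebra.of O K g • x)) = ρ g (ρ.asModuleEquiv (ε x))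
    rw [map_smul, Representation.asModuleEquiv_map_smul, Representation.asAlgebraHom_of]

end GroupAlgebra

section Irrep

variable {O K : Type u} [CommRing O] [IsLocalRing O] [Group K] [TopologicalSpace K]

/-- O surjects onto k, so O[K]-linear and k-linear equivariant isomorphisms agree. -/
theorem nonempty_equiv_iff (σ τ : SmoothIrrep (IsLocalRing.ResidueField O) K) :
    σ ≈ τ ↔ Nonempty ((σ.restrict O).asModule ≃ₗ[O[K]] (τ.restrict O).asModule) := by
  constructor
  · rintro ⟨φ⟩
    refine nonempty_linearEquiv_asModule (W := (σ.restrict O).asModule) (τ.restrict O)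
      ((σ.restrict O).asModuleEquiv.toAddEquiv.trans φ.toLinearEquiv.toAddEquiv)
      (fun a x => ?_) fun g x => ?_
    · change φ ((σ.restrict O).asModuleEquiv (algebraMap O O[K] a • x)) =
        IsLocalRing.residue O a • (φ ((σ.restrict O).asModuleEquiv x) : τ.carrier)
      rw [Representation.asModuleEquiv_map_smul, AlgHom.commutes]
      exact φ.toLinearEquiv.map_smul (IsLocalRing.residue O a) _
    · change φ ((σ.restrict O).asModuleEquiv (MonoidAlgebra.of O K g • x)) =
        τ.ρ g (φ ((σ.restrict O).asModuleEquiv x))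
      rw [Representation.asModuleEquiv_map_smul, Representation.asAlgebraHom_of]
      exact LinearMap.congr_fun (φ.isIntertwining' g) _
  · rintro ⟨ε⟩
    obtain ⟨e, h₁, h₂⟩ := exists_linearEquiv_of_asModule (τ.restrict O) ε
    let e' : σ.carrier ≃+ τ.carrier := (σ.restrict O).asModuleEquiv.symm.toAddEquiv.trans e
    let e'' : σ.carrier ≃ₗ[IsLocalRing.ResidueField O] τ.carrier :=
      { e' with
        map_smul' := fun c x => by
          obtain ⟨a, rfl⟩ := IsLocalRing.residue_surjective c
          refine Eq.trans ?_ (h₁ a x)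
          change e _ = e _
          congr 1
          exact (Representation.asModuleEquiv_symm_map_smul (σ.restrict O) a x) }
    refine ⟨Representation.Equiv.mk e'' fun g => LinearMap.ext fun x => ?_⟩
    refine Eq.trans ?_ (h₂ g x)
    change e _ = e _
    congr 1
    exact (Representation.asModuleEquiv_symm_map_rho (σ.restrict O) g x)

/-- W is a k-vector space because 𝔪 kills it; its k-subrepresentations are its O[K]-submodules, and
stabilizers containing a neighbourhood of 1 are open. -/
theorem exists_smoothIrrep [IsTopologicalGroup K] {W : Type u} [AddCommGroup W] [Module O[K] W]
    [IsSimpleModule O[K] W]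
    (hW : ∀ a ∈ IsLocalRing.maximalIdeal O, ∀ x : W, algebraMap O O[K] a • x = 0)
    (hsm : ∀ x : W, ∀ᶠ g in 𝓝 (1 : K), MonoidAlgebra.of O K g • x = x) :
    ∃ τ : SmoothIrrep (IsLocalRing.ResidueField O) K,
      Nonempty (W ≃ₗ[O[K]] (τ.restrict O).asModule) := by
  let _ : Module O W := Module.compHom W (algebraMap O O[K])
  have hO : ∀ (a : O) (x : W), a • x = algebraMap O O[K] a • x := fun _ _ => rfl
  let _ : Module (IsLocalRing.ResidueField O) W := Module.IsTorsionBySet.module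
    (I := IsLocalRing.maximalIdeal O) fun x a => hW a.1 a.2 x
  have hk : ∀ (a : O) (x : W), IsLocalRing.residue O a • x = algebraMap O O[K] a • x :=
    fun _ _ => rfl
  let ρ : Representation (IsLocalRing.ResidueField O) K W :=
    { toFun := fun g =>
        { toFun := fun x => MonoidAlgebra.of O K g • x
          map_add' := smul_add _
          map_smul' := fun c x => by
            obtain ⟨a, rfl⟩ := IsLocalRing.residue_surjective c
            rw [RingHom.id_apply, hk, hk, smul_smul, smul_smul, Algebra.commutes] }
      map_one' := LinearMap.ext fun x => by
        change MonoidAlgebra.of O K 1 • x = x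
        rw [map_one, one_smul]
      map_mul' := fun g h => LinearMap.ext fun x => by
        change MonoidAlgebra.of O K (g * h) • x = MonoidAlgebra.of O K g • MonoidAlgebra.of O K h • x
        rw [map_mul, mul_smul] }
  have hρ : ∀ g x, ρ g x = MonoidAlgebra.of O K g • x := fun _ _ => rfl
  have hirr : ρ.IsIrreducible := by
    have hs := (isSimpleModule_iff O[K] W).1 inferInstance
    have hnt : Nontrivial W := IsSimpleModule.nontrivial O[K] W
    refine { exists_pair_ne := ⟨⊥, ⊤, fun h => ?_⟩, eq_bot_or_eq_top := fun p => ?_ }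
    · have h1 := congrArg Subrepresentation.toSubmodule h
      exact bot_ne_top (α := Submodule (IsLocalRing.ResidueField O) W) h1
    · let p' : Submodule O[K] W :=
        { p.toSubmodule.toAddSubmonoid with
          smul_mem' := fun b x hx => by
            change b • x ∈ p.toSubmodule
            change x ∈ p.toSubmodule at hx
            induction b using MonoidAlgebra.induction_on generalizing x with
            | of g => exact p.apply_mem_toSubmodule g hx
            | add b c hb hc => rw [add_smul]; exact add_mem (hb x hx) (hc x hx)
            | smul r b hb =>
              rw [Algebra.smul_def, mul_smul, ← hk]
              exact p.toSubmodule.smul_mem _ (hb x hx) }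
      have hp' : ∀ x, x ∈ p' ↔ x ∈ p.toSubmodule := fun _ => Iff.rfl
      rcases eq_bot_or_eq_top p' with h | h
      · left
        apply Subrepresentation.toSubmodule_injective
        ext x
        rw [← hp', h]
        rfl
      · right
        apply Subrepresentation.toSubmodule_injective
        ext x
        rw [← hp', h]
        exact iff_of_true trivial trivial
  have hsmooth : IsSmooth ρ := by
    intro x
    let U : Subgroup K :=
      { carrier := {g | ρ g x = x}
        mul_mem' := fun {g h} hg hh => by
          change ρ (g * h) x = x
          rw [map_mul, Module.End.mul_apply, show ρ h x = x from hh, show ρ g x = x from hg]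
        one_mem' := by
          change ρ 1 x = x
          rw [map_one]
          rfl
        inv_mem' := fun {g} hg => by
          change ρ g⁻¹ x = x
          have h1 : ρ g⁻¹ (ρ g x) = x := by
            rw [← Module.End.mul_apply, ← map_mul, inv_mul_cancel, map_one]
            rfl
          rwa [show ρ g x = x from hg] at h1 }
    exact ⟨⟨U, Subgroup.isOpen_of_mem_nhds U (g := 1) (hsm x)⟩, fun g hg => hg⟩
  refine ⟨⟨W, ρ, hirr, hsmooth⟩, ?_⟩
  exact nonempty_linearEquiv_asModule _ (AddEquiv.refl W) (fun _ _ => rfl) fun _ _ => rfl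

end Irrep


open Topology

/-! ### Cycles of M(·) along a composition series. -/

section Underlying

/-- The `O`-module underlying an `O[K]`-module. -/
@[nolint unusedArguments]
def Underlying (O K : Type u) [CommRing O] [Group K] (W : Type u) [AddCommGroup W]
    [Module O[K] W] : Type u := W

variable (O K : Type u) [CommRing O] [Group K] (W : Type u) [AddCommGroup W] [Module O[K] W]

instance : AddCommGroup (Underlying O K W) := inferInstanceAs (AddCommGroup W)

noncomputable instance : Module O (Underlying O K W) := Module.compHom W (algebraMap O O[K])

/-- The representation of `K` on an `O[K]`-module. -/
noncomputable def underlyingRep : Representation O K (Underlying O K W) where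
  toFun g :=
    { toFun := fun x : W => MonoidAlgebra.of O K g • x
      map_add' := fun x y : W => smul_add _ x y
      map_smul' := fun a (x : W) => by
        change MonoidAlgebra.of O K g • algebraMap O O[K] a • x =
          algebraMap O O[K] a • MonoidAlgebra.of O K g • x
        rw [smul_smul, smul_smul, Algebra.commutes] }
  map_one' := LinearMap.ext fun x : W => by
    change MonoidAlgebra.of O K 1 • x = x
    rw [map_one, one_smul]
  map_mul' g h := LinearMap.ext fun x : W => by
    change MonoidAlgebra.of O K (g * h) • x = MonoidAlgebra.of O K g • MonoidAlgebra.of O K h • x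
    rw [map_mul, mul_smul]

end Underlying

section Controlled

variable (O R K N L : Type u) [CommRing O] [IsDomain O] [IsDiscreteValuationRing O]
  [CommRing R] [IsLocalRing R] [IsNoetherianRing R] [Algebra O R]
  [Group K] [TopologicalSpace K]
  [AddCommGroup N] [Module (CompletedGroupAlgebra R K) N]
  [Module R N] [IsScalarTower R (CompletedGroupAlgebra R K) N] [Module O N] [IsScalarTower O R N]
  [TopologicalSpace N] [TopologicalSpace O] [IsTopologicalRing O]
  [ContinuousSMul (CompletedGroupAlgebra R K) N]
  [Field L] [Algebra O L] [IsFractionRing O L] [TopologicalSpace L] [IsTopologicalRing L]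

/-- `M(W)`, for an `O[K]`-module `W`. -/
abbrev MModule (W : Type u) [AddCommGroup W] [Module O[K] W] : Type u :=
  MSmooth O R K N L (underlyingRep O K W)

/-- The finite smooth `O[K]`-modules `W` killed by `ϖ` for which `M(W)` is finitely generated of
dimension at most `e`. -/
structure IsControlled (ϖ : O) (e : WithBot ℕ∞) (W : Type u) [AddCommGroup W] [Module O[K] W] :
    Prop where
  finite : Finite W
  smul_eq_zero (x : W) : algebraMap O O[K] ϖ • x = 0
  smooth (x : W) : ∀ᶠ g in 𝓝 (1 : K), MonoidAlgebra.of O K g • x = x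
  module_finite : Module.Finite R (MModule O R K N L W)
  supportDim_le : Module.supportDim R (MModule O R K N L W) ≤ e

variable {O R K N L} [DiscreteTopology (ModInt O L)] {ϖ : O} [Finite (O ⧸ Ideal.span {ϖ})]
  [CompactSpace N] [IsTopologicalAddGroup N] [T2Space N]
  {e : WithBot ℕ∞}

theorem cycle_mModule_eq_zero {W : Type u} [AddCommGroup W] [Module O[K] W] {Y : Submodule O[K] W}
    (hY : Y = ⊥) : (cycle e (MModule O R K N L Y) : Cycles R e) = 0 := by
  subst hY
  have : Subsingleton (Underlying O K (⊥ : Submodule O[K] W)) :=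
    inferInstanceAs (Subsingleton (⊥ : Submodule O[K] W))
  have : Subsingleton (MModule O R K N L (⊥ : Submodule O[K] W)) := subsingleton_mSmooth _
  exact cycle_eq_zero_of_subsingleton

theorem nonempty_mModule_equiv {W T : Type u} [AddCommGroup W] [Module O[K] W] [AddCommGroup T]
    [Module O T] (ρ : Representation O K T) (ε : W ≃ₗ[O[K]] ρ.asModule) :
    Nonempty (MModule O R K N L W ≃ₗ[R] MSmooth O R K N L ρ) := by
  obtain ⟨f, h₁, h₂⟩ := exists_linearEquiv_of_asModule ρ ε
  let f' : Underlying O K W ≃ₗ[O] T := { f with map_smul' := fun a x => h₁ a x }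
  exact nonempty_mSmooth_equiv f' fun g x => h₂ g x

theorem cycle_mModule_eq {W T : Type u} [AddCommGroup W] [Module O[K] W] [AddCommGroup T]
    [Module O T] (ρ : Representation O K T) (ε : Nonempty (W ≃ₗ[O[K]] ρ.asModule)) :
    (cycle e (MModule O R K N L W) : Cycles R e) = cycle e (MSmooth O R K N L ρ) := by
  obtain ⟨ε⟩ := ε
  obtain ⟨E⟩ := nonempty_mModule_equiv (R := R) (N := N) (L := L) ρ ε
  exact cycle_congr_equiv E

/-- Control passes to submodules and quotients by exactness of M(·), so it holds for every
composition factor. -/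
theorem IsControlled.exists_exact [IsTopologicalGroup K] (ha : IsProjectivePro O R K N) (hϖ : Irreducible ϖ)
    (hO : {a : O | ϖ ∣ a} ∈ 𝓝 0)
    {W W' W'' : Type u} [AddCommGroup W] [Module O[K] W] [AddCommGroup W'] [Module O[K] W']
    [AddCommGroup W''] [Module O[K] W''] (h : IsControlled O R K N L ϖ e W)
    (i : W' →ₗ[O[K]] W) (hi : Function.Injective i) (p : W →ₗ[O[K]] W'')
    (hp : Function.Surjective p) (hip : Function.Exact i p) :
    IsControlled O R K N L ϖ e W' ∧ IsControlled O R K N L ϖ e W'' ∧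
    ∃ (a : MModule O R K N L W' →ₗ[R] MModule O R K N L W)
      (b : MModule O R K N L W →ₗ[R] MModule O R K N L W''),
      Function.Injective a ∧ Function.Surjective b ∧ Function.Exact a b := by
  have := h.finite
  have : Finite W' := Finite.of_injective i hi
  have : Finite W'' := Finite.of_surjective p hp
  have : Finite (Underlying O K W) := h.finite
  have : Finite (Underlying O K W') := ‹Finite W'›
  have : Finite (Underlying O K W'') := ‹Finite W''›
  let i' : Underlying O K W' →ₗ[O] Underlying O K W :=
    { toFun := i, map_add' := i.map_add, map_smul' := fun a x => i.map_smul (algebraMap O O[K] a) x }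
  let p' : Underlying O K W →ₗ[O] Underlying O K W'' :=
    { toFun := p, map_add' := p.map_add, map_smul' := fun a x => p.map_smul (algebraMap O O[K] a) x }
  have hz' : ∀ x : W', algebraMap O O[K] ϖ • x = 0 := fun x => hi (by
    rw [map_smul, h.smul_eq_zero, map_zero])
  have hs' : ∀ x : W', ∀ᶠ g in 𝓝 (1 : K), MonoidAlgebra.of O K g • x = x := fun x =>
    (h.smooth (i x)).mono fun g hg => hi (by rw [map_smul, hg])
  obtain ⟨a, b, haI, hbS, hab⟩ := exists_exact_mSmooth (R := R) (N := N) (L := L)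
    (X := Underlying O K W) (X' := Underlying O K W') (X'' := Underlying O K W'')
    (ρ := underlyingRep O K W)
    (ρ' := underlyingRep O K W')
    (ρ'' := underlyingRep O K W'') ha hϖ hO
    (fun x => h.smul_eq_zero x) (fun x => hz' x)
    (fun x => h.smooth x) (fun x => hs' x) i' (fun g x => i.map_smul (MonoidAlgebra.of O K g) x) hi
    p' (fun g x => p.map_smul (MonoidAlgebra.of O K g) x) hp hip
  have := h.module_finite
  refine ⟨⟨‹_›, hz', hs', Module.Finite.of_injective a haI,
    (Module.supportDim_le_of_injective a haI).trans h.supportDim_le⟩,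
    ⟨‹_›, fun x => ?_, fun x => ?_, Module.Finite.of_surjective b hbS,
    (Module.supportDim_le_of_surjective b hbS).trans h.supportDim_le⟩, a, b, haI, hbS, hab⟩
  · obtain ⟨y, rfl⟩ := hp x
    rw [← map_smul, h.smul_eq_zero, map_zero]
  · obtain ⟨y, rfl⟩ := hp x
    exact (h.smooth y).mono fun g hg => by rw [← map_smul, hg]

/-- Additivity along a composition series writes the cycle as a sum over the factors. Each factor is
simple, smooth and killed by ϖ, so it is an irreducible k-representation; grouping by isomorphism
class produces the multiplicities. -/
theorem cycle_mSmooth_eq [IsTopologicalGroup K] (ha : IsProjectivePro O R K N) (hϖ : Irreducible ϖ)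
    (hO : {a : O | ϖ ∣ a} ∈ 𝓝 0) (he : e ≠ ⊤) {X : Type u} [AddCommGroup X] [Module O X] [Finite X]
    (hX : ∀ x : X, ϖ • x = 0) {ρ : Representation O K X}
    (hρ : ∀ x, ∀ᶠ g in 𝓝 (1 : K), ρ g x = x) [Module.Finite R (MSmooth O R K N L ρ)]
    (hdim : Module.supportDim R (MSmooth O R K N L ρ) ≤ e) :
    {c : IrrepClass (IsLocalRing.ResidueField O) K |
      jhMultiplicity ρ (c.out.restrict O) ≠ 0}.Finite ∧
    (∀ c : IrrepClass (IsLocalRing.ResidueField O) K,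
      jhMultiplicity ρ (c.out.restrict O) ≠ 0 →
        Module.Finite R (MSmooth O R K N L (c.out.restrict O)) ∧
        Module.supportDim R (MSmooth O R K N L (c.out.restrict O)) ≤ e) ∧
    cycle e (MSmooth O R K N L ρ) = ∑ᶠ c : IrrepClass (IsLocalRing.ResidueField O) K,
      jhMultiplicity ρ (c.out.restrict O) •
        cycle (R := R) e (MSmooth O R K N L (c.out.restrict O)) := by
  have hfin : Finite ρ.asModule := ‹Finite X›
  have hnoeth : IsNoetherian O[K] ρ.asModule := inferInstance
  have hart : IsArtinian O[K] ρ.asModule := inferInstance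
  obtain ⟨s, h₀, h₁⟩ := exists_compositionSeries_of_isNoetherian_isArtinian O[K] ρ.asModule
  obtain ⟨E₀⟩ := nonempty_mModule_equiv (R := R) (N := N) (L := L) ρ (LinearEquiv.refl _ _)
  have hc₀ : IsControlled O R K N L ϖ e ρ.asModule := by
    refine ⟨hfin, fun x => ?_, fun x => ?_, Module.Finite.equiv E₀.symm,
      (Module.supportDim_eq_of_equiv E₀).trans_le hdim⟩
    · change ρ.asModuleEquiv (algebraMap O O[K] ϖ • x) = 0
      rw [Representation.asModuleEquiv_map_smul, AlgHom.commutes]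
      exact hX _
    · refine (hρ (ρ.asModuleEquiv x)).mono fun g hg => ?_
      change ρ.asModuleEquiv (MonoidAlgebra.of O K g • x) = ρ.asModuleEquiv x
      rw [Representation.asModuleEquiv_map_smul, Representation.asAlgebraHom_of, hg]
  have hc₁ : ∀ Y : Submodule O[K] ρ.asModule, IsControlled O R K N L ϖ e Y := fun Y =>
    (hc₀.exists_exact ha hϖ hO Y.subtype Y.injective_subtype Y.mkQ (Submodule.mkQ_surjective Y)
      (LinearMap.exact_subtype_mkQ Y)).1
  let F : Fin s.length → Type u := fun i => s i.succ ⧸ (s i.castSucc).submoduleOf (s i.succ)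
  have hstep : ∀ i : Fin s.length, IsControlled O R K N L ϖ e (F i) ∧
      cycle e (MModule O R K N L (s i.succ)) =
        cycle (R := R) e (MModule O R K N L (s i.castSucc)) + cycle e (MModule O R K N L (F i)) := by
    intro i
    have hle : s i.castSucc ≤ s i.succ := (s.step i).le
    obtain ⟨-, h2, a, b, haI, hbS, hab⟩ := (hc₁ (s i.succ)).exists_exact ha hϖ hO
      (Submodule.inclusion hle) (Submodule.inclusion_injective hle)
      ((s i.castSucc).submoduleOf (s i.succ)).mkQ (Submodule.mkQ_surjective _) (by
        rw [LinearMap.exact_iff, Submodule.ker_mkQ, Submodule.range_inclusion]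
        rfl)
    have := (hc₁ (s i.succ)).module_finite
    exact ⟨h2, cycle_eq_add_of_exact he (hc₁ (s i.succ)).supportDim_le a b haI hbS hab⟩
  have hsimple : ∀ i, IsSimpleModule O[K] (F i) := fun i =>
    (covBy_iff_quot_is_simple (s.step i).le).1 (s.step i)
  have hirr : ∀ i, ∃ c : IrrepClass (IsLocalRing.ResidueField O) K,
      Nonempty (F i ≃ₗ[O[K]] (c.out.restrict O).asModule) := by
    intro i
    have := hsimple i
    obtain ⟨τ, ⟨ε⟩⟩ := exists_smoothIrrep (O := O) (W := F i) (fun a ha x => by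
      rw [hϖ.maximalIdeal_eq] at ha
      obtain ⟨b, rfl⟩ := Ideal.mem_span_singleton.1 ha
      rw [mul_comm, map_mul, mul_smul, (hstep i).1.smul_eq_zero, smul_zero]) (hstep i).1.smooth
    refine ⟨Quotient.mk _ τ, ?_⟩
    obtain ⟨δ⟩ := (nonempty_equiv_iff (O := O) _ _).1 (Quotient.mk_out τ)
    exact ⟨ε.trans δ.symm⟩
  choose γ hγ using hirr
  have hγ' : ∀ i c, Nonempty (F i ≃ₗ[O[K]] (c.out.restrict O).asModule) ↔ γ i = c := by
    intro i c
    refine ⟨fun ⟨ε⟩ => ?_, fun h => h ▸ hγ i⟩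
    obtain ⟨δ⟩ := hγ i
    have h1 := (nonempty_equiv_iff (O := O) _ _).2 ⟨δ.symm.trans ε⟩
    rw [← Quotient.out_eq (γ i), ← Quotient.out_eq c]
    exact Quotient.sound h1
  have hmult : ∀ c : IrrepClass (IsLocalRing.ResidueField O) K,
      jhMultiplicity ρ (c.out.restrict O) = Nat.card {i // γ i = c} := by
    intro c
    rw [jhMultiplicity_eq_card ρ _ s h₀ h₁]
    exact Nat.card_congr (Equiv.subtypeEquivRight fun i => hγ' i c)
  have hex : ∀ c : IrrepClass (IsLocalRing.ResidueField O) K,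
      jhMultiplicity ρ (c.out.restrict O) ≠ 0 → ∃ i, γ i = c := by
    intro c hc
    rw [hmult] at hc
    obtain ⟨⟨⟨i, hi⟩⟩, _⟩ := Nat.card_ne_zero.1 hc
    exact ⟨i, hi⟩
  refine ⟨(Set.finite_range γ).subset fun c hc => hex c hc, fun c hc => ?_, ?_⟩
  · obtain ⟨i, rfl⟩ := hex c hc
    obtain ⟨δ⟩ := hγ i
    obtain ⟨E⟩ := nonempty_mModule_equiv (R := R) (N := N) (L := L) _ δ
    have := (hstep i).1.module_finite
    exact ⟨Module.Finite.equiv E,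
      (Module.supportDim_eq_of_equiv E).symm.trans_le (hstep i).1.supportDim_le⟩
  · have hsum := eq_sum_of_succ_eq_add (fun i => (cycle e (MModule O R K N L (s i)) : Cycles R e))
      (fun i => cycle e (MModule O R K N L (F i))) ?_ fun i => (hstep i).2
    · have hlast : (cycle e (MModule O R K N L (s (Fin.last s.length))) : Cycles R e) =
          cycle e (MSmooth O R K N L ρ) := by
        exact cycle_mModule_eq ρ ⟨(LinearEquiv.ofEq _ _ h₁).trans Submodule.topEquiv⟩
      rw [← hlast]
      refine hsum.trans ?_
      have hF : ∀ i, (cycle e (MModule O R K N L (F i)) : Cycles R e) =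
          cycle e (MSmooth O R K N L ((γ i).out.restrict O)) := fun i => cycle_mModule_eq _ (hγ i)
      simp only [hF, hmult]
      exact sum_eq_finsum_card_nsmul γ fun c => cycle e (MSmooth O R K N L (c.out.restrict O))
    · exact cycle_mModule_eq_zero h₀

end Controlled


open Topology

/-! ### Density of points, and dimension modulo ϖ. -/

section Density

open scoped Pointwise

variable {R M : Type*} [CommRing R] [IsNoetherianRing R] [AddCommGroup M] [Module R M]
  [Module.Finite R M]

/-- Sort the points by the minimal primes below them and intersect within each class. By density the
finite intersection of these ideals lies in P, so one of them does, and minimality makes it the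
class of P. That class is non-empty, since an empty intersection is the unit ideal. -/
theorem exists_le_of_support_subset_closure {Z : Set (PrimeSpectrum R)}
    (hZ : Z ⊆ Module.support R M) (hZ' : Module.support R M ⊆ closure Z) {P : Ideal R}
    (hP : P ∈ (Module.annihilator R M).minimalPrimes) : ∃ q ∈ Z, P ≤ q.asIdeal := by
  classical
  have hfin := (Module.annihilator R M).finite_minimalPrimes_of_isNoetherianRing
  have hPp := hP.1.1
  have h1 : (⟨P, hPp⟩ : PrimeSpectrum R) ∈ closure Z := hZ' (by
    rw [Module.support_eq_zeroLocus]
    exact hP.1.2)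
  rw [← PrimeSpectrum.zeroLocus_vanishingIdeal_eq_closure] at h1
  have h2 : hfin.toFinset.inf (fun P' => sInf {I | ∃ q ∈ Z, P' ≤ q.asIdeal ∧ I = q.asIdeal}) ≤ P := by
    intro x hx
    refine h1 ((PrimeSpectrum.mem_vanishingIdeal _ _).2 fun q hq => ?_)
    have hle : Module.annihilator R M ≤ q.asIdeal := by
      have := hZ hq
      rwa [Module.support_eq_zeroLocus] at this
    obtain ⟨P', hP', hP'q⟩ := Ideal.exists_minimalPrimes_le hle
    have h3 := (Finset.inf_le (hfin.mem_toFinset.2 hP') : hfin.toFinset.inf (fun P' =>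
      sInf {I | ∃ q ∈ Z, P' ≤ q.asIdeal ∧ I = q.asIdeal}) ≤ _) hx
    exact (Submodule.mem_sInf.1 h3) _ ⟨q, hq, hP'q, rfl⟩
  obtain ⟨P', hP', hle⟩ := (Ideal.IsPrime.inf_le' hPp).1 h2
  have hP'' := hfin.mem_toFinset.1 hP'
  have h4 : P' ≤ P := (le_sInf (by rintro I ⟨q, _, h, rfl⟩; exact h)).trans hle
  by_contra h
  push Not at h
  refine hPp.ne_top (top_le_iff.1 (le_trans (le_sInf ?_) hle))
  rintro I ⟨q, hq, h5, -⟩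
  exact (h q hq ((hP.2 hP''.1 h4).trans h5)).elim

omit [IsNoetherianRing R] in
theorem ringKrullDim_quotient_eq_of_isEquidimensional {I : Ideal R} (hI : IsEquidimensional (R ⧸ I))
    {P : Ideal R} (hP : P ∈ I.minimalPrimes) : ringKrullDim (R ⧸ P) = ringKrullDim (R ⧸ I) := by
  rw [Ideal.minimalPrimes_eq_comap] at hP
  obtain ⟨q, hq, rfl⟩ := hP
  rw [← hI q hq]
  refine ringKrullDim_eq_of_ringEquiv (RingEquiv.ofBijective
    (Ideal.quotientMap q (Ideal.Quotient.mk I) le_rfl)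
    ⟨Ideal.quotientMap_injective, Ideal.quotientMap_surjective Ideal.Quotient.mk_surjective⟩)

omit [IsNoetherianRing R] in
theorem supportDim_quotient_sup_annihilator {x : R} {M' : Type*} [AddCommGroup M'] [Module R M']
    (Ψ : M →ₗ[R] M') (hΨ : Function.Surjective Ψ) (hker : ∀ m, Ψ m = 0 ↔ ∃ m', m = x • m') :
    Module.supportDim R (R ⧸ (Ideal.span {x} ⊔ Module.annihilator R M)) =
      Module.supportDim R M' := by
  have h1 : LinearMap.ker Ψ = Ideal.span {x} • ⊤ := by
    ext m
    rw [LinearMap.mem_ker, hker, Submodule.ideal_span_singleton_smul,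
      Submodule.mem_smul_pointwise_iff_exists]
    simp [eq_comm]
  have e := (Submodule.quotEquivOfEq _ _ h1).symm.trans (Ψ.quotKerEquivOfSurjective hΨ)
  rw [← Module.supportDim_eq_of_equiv e, Module.supportDim, Module.supportDim,
    Module.support_quotient, Module.support_eq_zeroLocus, Module.support_eq_zeroLocus,
    Ideal.annihilator_quotient, ← PrimeSpectrum.zeroLocus_sup, sup_comm]

theorem supportDim_add_one_eq [IsLocalRing R] {x : R} (hx : x ∈ IsLocalRing.maximalIdeal R)
    (hreg : ∀ m : M, x • m = 0 → m = 0) {M' : Type*} [AddCommGroup M'] [Module R M']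
    (Ψ : M →ₗ[R] M') (hΨ : Function.Surjective Ψ) (hker : ∀ m, Ψ m = 0 ↔ ∃ m', m = x • m') :
    Module.supportDim R M' + 1 = Module.supportDim R M := by
  have h1 : LinearMap.ker Ψ = x • ⊤ := by
    ext m
    rw [LinearMap.mem_ker, hker, Submodule.mem_smul_pointwise_iff_exists]
    simp [eq_comm]
  have e := (Submodule.quotEquivOfEq _ _ h1).symm.trans (Ψ.quotKerEquivOfSurjective hΨ)
  rw [← Module.supportDim_eq_of_equiv e]
  refine Module.supportDim_quotSMulTop_succ_eq_supportDim (fun a b hab => ?_) hx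
  rw [← sub_eq_zero]
  exact hreg _ (by rw [smul_sub, sub_eq_zero]; exact hab)

end Density

/-! ### Assembly over a general complete discrete valuation ring. -/

section Main

variable {O R K N L : Type u} [CommRing O] [IsDomain O] [IsDiscreteValuationRing O]
  [CommRing R] [IsLocalRing R] [IsNoetherianRing R] [Algebra O R]
  [Group K] [TopologicalSpace K] [IsTopologicalGroup K]
  [AddCommGroup N] [Module (CompletedGroupAlgebra R K) N]
  [Module R N] [IsScalarTower R (CompletedGroupAlgebra R K) N] [Module O N] [IsScalarTower O R N]
  [TopologicalSpace N] [IsTopologicalAddGroup N] [T2Space N] [TopologicalSpace O]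
  [IsTopologicalRing O] [ContinuousSMul (CompletedGroupAlgebra R K) N]
  [Field L] [CharZero L] [Algebra O L] [IsFractionRing O L] [TopologicalSpace L]
  [IsTopologicalRing L] [DiscreteTopology (ModInt O L)]
  {V : Type u} [AddCommGroup V] [Module L V] [Module O V]
  [IsScalarTower O L V] {ρV : Representation L K V}
  {Θ : Submodule O V} [Submodule.IsLattice L Θ] {hΘ : ∀ g, ∀ x ∈ Θ, ρV g x ∈ Θ}
  [CompactSpace N] [Module.Finite (CompletedGroupAlgebra R K) N]
  [CompactSpace O] [T2Space O] {ϖ : O} [Finite (O ⧸ Ideal.span {ϖ})]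

/-- The dimension of M(Θ/ϖΘ) serves as e: ϖ is regular on M(Θ), so e + 1 = d, and R/(ϖ, 𝔞) has the
same support as M(Θ)/ϖM(Θ). -/
theorem isReduced_and_cycle_eq [IsPrecomplete (IsLocalRing.maximalIdeal R) R]
    (hϖ : Irreducible ϖ) (hϖR : algebraMap O R ϖ ∈ IsLocalRing.maximalIdeal R)
    (hk : Function.Surjective ((IsLocalRing.residue R).comp (algebraMap O R)))
    (hO : (𝓝 (0 : O)).HasBasis (fun _ : ℕ => True) fun j => {a | ϖ ^ j ∣ a})
    (hL : Continuous (algebraMap O L)) {c : O} (hc₀ : c ≠ 0) (hcu : ¬ IsUnit c)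
    {a : R} (hca : algebraMap O R c = a) [Module.IsTorsionFree O Θ]
    [Finite (Θ ⧸ (Ideal.span {ϖ} • ⊤ : Submodule O Θ))]
    (hρ : ∀ t j, ∀ᶠ g in 𝓝 (1 : K), ∃ t', latticeRep ρV Θ hΘ g t - t = ϖ ^ j • t')
    (𝔞 : Ideal R) (h𝔞 : 𝔞 = Module.annihilator R (MLattice O R K N (latticeRep ρV Θ hΘ)))
    (d : WithBot ℕ∞) (hd : d = Module.supportDim R (MLattice O R K N (latticeRep ρV Θ hΘ)))
    (ha : IsProjectivePro O R K N) (hb : IsEquidimensional (R ⧸ 𝔞))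
    (hb' : associatedPrimes (R ⧸ 𝔞) (R ⧸ 𝔞) ⊆ minimalPrimes (R ⧸ 𝔞))
    (S : Set (MaximalSpectrum (Localization.Away a)))
    (hS : (fun n => PrimeSpectrum.comap (algebraMap R (Localization.Away a))
      n.toPrimeSpectrum) '' S ⊆ Module.support R (MLattice O R K N (latticeRep ρV Θ hΘ)))
    (hS' : Module.support R (MLattice O R K N (latticeRep ρV Θ hΘ)) ⊆
      closure ((fun n => PrimeSpectrum.comap (algebraMap R (Localization.Away a))
        n.toPrimeSpectrum) '' S))
    (hc : ∀ n ∈ S, Module.rank (Kappa n) (HomBanach O R K N L (Kappa n) ρV) = 1)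
    (hc' : ∀ n ∈ S, ∀ s : Kappa n →ₐ[O] ModSq n, (∀ x, modSqToKappa n (s x) = x) →
      (dimAlong (HomBanach O R K N L (ModSq n) ρV) (s : Kappa n →+* ModSq n) : WithBot ℕ∞) ≤ d) :
    IsReduced (R ⧸ 𝔞) ∧ ringKrullDim (R ⧸ 𝔞) = d ∧
    ∃ e : WithBot ℕ∞, e + 1 = d ∧
      Module.supportDim R (R ⧸ (Ideal.span {algebraMap O R ϖ} ⊔ 𝔞)) ≤ e ∧
      {c : IrrepClass (IsLocalRing.ResidueField O) K |
        jhMultiplicity (reduction (latticeRep ρV Θ hΘ) ϖ) (c.out.restrict O) ≠ 0}.Finite ∧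
      (∀ c : IrrepClass (IsLocalRing.ResidueField O) K,
        jhMultiplicity (reduction (latticeRep ρV Θ hΘ) ϖ) (c.out.restrict O) ≠ 0 →
          Module.Finite R (MSmooth O R K N L (c.out.restrict O)) ∧
          Module.supportDim R (MSmooth O R K N L (c.out.restrict O)) ≤ e) ∧
      cycle e (R ⧸ (Ideal.span {algebraMap O R ϖ} ⊔ 𝔞)) =
        ∑ᶠ c : IrrepClass (IsLocalRing.ResidueField O) K,
          jhMultiplicity (reduction (latticeRep ρV Θ hΘ) ϖ) (c.out.restrict O) •
            cycle (R := R) e (MSmooth O R K N L (c.out.restrict O)) := by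
  have := isPrecomplete_of_compactSpace (O := O) (ϖ := ϖ)
  have : Module.Finite O Θ := Submodule.IsLattice.finite L Θ
  have hO1 : {a : O | ϖ ∣ a} ∈ 𝓝 0 := by
    have := hO.mem_of_mem (i := 1) trivial
    simpa using this
  have hH : IsAdmissible R ϖ (HomCont O R K N (LinDual O Θ O)
    (contragredient O O (latticeRep ρV Θ hΘ))) := isAdmissible_homCont hϖ hk hO
  have hfin : Module.Finite R (MLattice O R K N (latticeRep ρV Θ hΘ)) := hH.finite hϖ L hϖR
  obtain ⟨Ψ, hΨ, hker⟩ := exists_mLattice_mSmooth (R := R) (N := N) (L := L) ha hϖ hO hρ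
  have hfin' : Module.Finite R (MSmooth O R K N L (reduction (latticeRep ρV Θ hΘ) ϖ)) :=
    Module.Finite.of_surjective Ψ hΨ
  have hreg : ∀ m : MLattice O R K N (latticeRep ρV Θ hΘ), algebraMap O R ϖ • m = 0 → m = 0 := by
    intro m hm
    refine LinDual.ext fun h => ?_
    have h1 : m (ϖ • h) = 0 := by
      have := DFunLike.congr_fun hm h
      rw [LinDual.smul_apply, algebraMap_smul] at this
      exact this
    rw [LinDual.map_smul] at h1
    exact (smul_eq_zero.1 h1).resolve_left hϖ.ne_zero
  have hdim := supportDim_add_one_eq hϖR hreg Ψ hΨ hker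
  have hdim' := supportDim_quotient_sup_annihilator Ψ hΨ hker
  rw [← hd] at hdim
  rw [← h𝔞] at hdim'
  have hRd : ringKrullDim (R ⧸ 𝔞) = d := by
    rw [hd, Module.supportDim_eq_ringKrullDim_quotient_annihilator, ← h𝔞]
  have hass := associatedPrimes_quotient_subset hb'
  have he : Module.supportDim R (MSmooth O R K N L (reduction (latticeRep ρV Θ hΘ) ϖ)) ≠ ⊤ :=
    ((Module.supportDim_le_ringKrullDim R _).trans_lt ringKrullDim_lt_top).ne
  have hnat : d ≠ ⊥ → ∃ n : ℕ,
      Module.supportDim R (MSmooth O R K N L (reduction (latticeRep ρV Θ hΘ) ϖ)) = n := by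
    intro h
    rw [← hdim] at h
    obtain ⟨k, hk⟩ := WithBot.ne_bot_iff_exists.1 (WithBot.add_ne_bot.1 h).1
    rw [← hk] at he
    obtain ⟨n, hn⟩ := ENat.ne_top_iff_exists.1 fun h : k = ⊤ => he (by rw [h]; rfl)
    exact ⟨n, by rw [← hk, ← hn]; rfl⟩
  have hgen : ∀ P ∈ 𝔞.minimalPrimes, ∃ y : MLattice O R K N (latticeRep ρV Θ hΘ),
      (∀ x, ∃ s, s ∉ P ∧ s • x ∈ Submodule.span R {y}) ∧ ∀ t ∈ P, ∃ s, s ∉ P ∧ s * t ∈ 𝔞 := by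
    intro P hP
    obtain ⟨_, ⟨p, hp, rfl⟩, hPq⟩ := exists_le_of_support_subset_closure hS hS' (h𝔞 ▸ hP)
    have hPd := ringKrullDim_quotient_eq_of_isEquidimensional hb hP
    obtain ⟨n, hn⟩ := hnat fun h => by
      have := hP.1.1
      have h1 := ringKrullDim_nonneg_of_nontrivial (R := R ⧸ P)
      rw [hPd, hRd, h] at h1
      simp at h1
    rw [h𝔞]
    refine exists_generic_generator_of_point hϖ hϖR hk hO hL hc₀ hcu hca p (hc p hp) n
      (fun s hs => ?_) hPq (h𝔞 ▸ hP) ?_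
    · have h1 := hc' p hp s hs
      rw [← hdim, hn] at h1
      exact_mod_cast h1
    · rw [hPd, hRd, ← hdim, hn]
  have hred : IsReduced (R ⧸ 𝔞) := isReduced_of_generic hass fun P hP => (hgen P hP).choose_spec.2
  refine ⟨hred, hRd, _, hdim, hdim'.le, ?_⟩
  obtain ⟨h1, h2, h3⟩ := cycle_mSmooth_eq ha hϖ hO1 he
    (X := Θ ⧸ (Ideal.span {ϖ} • ⊤ : Submodule O Θ)) smul_reduction_eq_zero
    (eventually_reduction_apply_eq hρ) (R := R) (N := N) (L := L) le_rfl
  refine ⟨h1, h2, Eq.trans ?_ h3⟩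
  -- When M(Θ) = 0, both modules are zero and so are both cycles.
  by_cases hbot : d = ⊥
  · have h4 : Module.supportDim R (MSmooth O R K N L (reduction (latticeRep ρV Θ hΘ) ϖ)) = ⊥ := by
      by_contra h
      rw [hbot] at hdim
      exact (WithBot.add_ne_bot.2 ⟨h, WithBot.one_ne_bot⟩) hdim
    have h5 := (Module.supportDim_eq_bot_iff_subsingleton ..).1 h4
    have h6 := (Module.supportDim_eq_bot_iff_subsingleton ..).1 (hdim'.trans h4)
    rw [cycle_eq_zero_of_subsingleton, cycle_eq_zero_of_subsingleton]
  · obtain ⟨n, hn⟩ := hnat hbot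
    obtain ⟨m, hm, hm'⟩ := exists_generator_of_generic (h𝔞 ▸ hass) (h𝔞 ▸ hgen)
    rw [← h𝔞] at hm hm'
    refine cycle_congr fun q _ hq => localLength_quotient_eq h𝔞 hreg Ψ hΨ hker hm hm' q (n := n)
      (hq.trans hn) fun P hP => ?_
    rw [ringKrullDim_quotient_eq_of_isEquidimensional hb hP, hRd, ← hdim, hn]

end Main


open Topology

/-! ### The ring of integers of a p-adic field and its lattices. -/

section Integers

variable {L : Type u} [NontriviallyNormedField L] [IsUltrametricDist L] {ϖ : 𝒪[L]}

theorem integer_pow_dvd_iff (j : ℕ) (a : 𝒪[L]) : ϖ ^ j ∣ a ↔ ‖(a : L)‖ ≤ ‖(ϖ : L)‖ ^ j := by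
  rw [← Ideal.mem_span_singleton, ← SetLike.mem_coe,
    Valued.integer.coe_span_singleton_eq_closedBall, mem_closedBall_zero_iff, ← norm_pow]
  rfl

theorem hasBasis_nhds_zero_integer (hϖ : Irreducible ϖ) :
    (𝓝 (0 : 𝒪[L])).HasBasis (fun _ : ℕ => True) fun j => {a | ϖ ^ j ∣ a} := by
  have h0 : 0 < ‖(ϖ : L)‖ := Valued.integer.norm_irreducible_pos hϖ
  have h1 : ‖(ϖ : L)‖ < 1 := Valued.integer.norm_irreducible_lt_one hϖ
  refine Metric.nhds_basis_closedBall.to_hasBasis (fun ε hε => ?_) fun j _ => ?_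
  · obtain ⟨j, hj⟩ := exists_pow_lt_of_lt_one hε h1
    refine ⟨j, trivial, fun a ha => ?_⟩
    rw [mem_closedBall_zero_iff]
    exact ((integer_pow_dvd_iff j a).1 ha).trans hj.le
  · refine ⟨‖(ϖ : L)‖ ^ j, pow_pos h0 j, fun a ha => ?_⟩
    rw [mem_closedBall_zero_iff] at ha
    exact (integer_pow_dvd_iff j a).2 ha

/-- The ring of integers is the closed unit ball, which is open by the ultrametric inequality. -/
theorem discreteTopology_modInt : DiscreteTopology (ModInt 𝒪[L] L) := by
  have h : IsOpen ((LinearMap.range (Algebra.linearMap 𝒪[L] L)).toAddSubgroup : Set L) := by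
    have h1 : ((LinearMap.range (Algebra.linearMap 𝒪[L] L)).toAddSubgroup : Set L) =
        Metric.closedBall 0 1 := by
      ext x
      rw [mem_closedBall_zero_iff, ← Valued.integer.mem_iff]
      exact ⟨fun ⟨y, hy⟩ => hy ▸ y.2, fun hx => ⟨⟨x, hx⟩, rfl⟩⟩
    rw [h1]
    exact IsUltrametricDist.isOpen_closedBall _ one_ne_zero
  exact QuotientAddGroup.discreteTopology h

variable [ProperSpace L]

instance compactSpace_integer : CompactSpace 𝒪[L] := by
  refine isCompact_iff_compactSpace.1 ?_
  have h1 : ((𝒪[L] : Subring L) : Set L) = Metric.closedBall 0 1 := by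
    ext x
    rw [mem_closedBall_zero_iff, ← Valued.integer.mem_iff]
    rfl
  rw [h1]
  exact isCompact_closedBall 0 1

theorem isDiscreteValuationRing_integer (hϖ : Irreducible ϖ) : IsDiscreteValuationRing 𝒪[L] := by
  have := Valued.integer.isPrincipalIdealRing_of_compactSpace (K := L)
  exact
    { not_a_field' := fun h => hϖ.ne_zero (by
        have h1 : ϖ ∈ IsLocalRing.maximalIdeal 𝒪[L] :=
          (IsLocalRing.mem_maximalIdeal _).2 hϖ.not_isUnit
        rwa [h] at h1) }

theorem finite_integer_quotient (hϖ : Irreducible ϖ) : Finite (𝒪[L] ⧸ Ideal.span {ϖ}) := by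
  have h : IsOpen ((Ideal.span {ϖ}).toAddSubgroup : Set 𝒪[L]) := by
    refine AddSubgroup.isOpen_of_mem_nhds _ (g := 0) ?_
    have h1 := (hasBasis_nhds_zero_integer hϖ).mem_of_mem (i := 1) trivial
    refine Filter.mem_of_superset h1 fun a ha => ?_
    rw [Set.mem_ofPred_eq, pow_one] at ha
    exact Ideal.mem_span_singleton.2 ha
  exact AddSubgroup.quotient_finite_of_isOpen _ h

variable {V : Type u} [AddCommGroup V] [Module L V] (Θ : Submodule 𝒪[L] V) [Submodule.IsLattice L Θ]

omit [ProperSpace L] [Submodule.IsLattice L Θ] in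
theorem isTorsionFree_lattice : Module.IsTorsionFree 𝒪[L] Θ := by
  have : Module.IsTorsionFree 𝒪[L] L := inferInstance
  have : Module.IsTorsionFree 𝒪[L] V := Module.IsTorsionFree.trans_faithfulSMul 𝒪[L] L V
  infer_instance

theorem finite_lattice_quotient (hϖ : Irreducible ϖ) :
    Finite (Θ ⧸ (Ideal.span {ϖ} • ⊤ : Submodule 𝒪[L] Θ)) := by
  have := finite_integer_quotient hϖ
  have : Module.Finite 𝒪[L] Θ := Submodule.IsLattice.finite L Θ
  have : Module.Finite (𝒪[L] ⧸ Ideal.span {ϖ}) (Θ ⧸ (Ideal.span {ϖ} • ⊤ : Submodule 𝒪[L] Θ)) :=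
    Module.Finite.of_restrictScalars_finite 𝒪[L] _ _
  exact Module.finite_of_finite (𝒪[L] ⧸ Ideal.span {ϖ})

/-- In an O-basis of Θ, which is also an L-basis of V, the coordinates of g t - t are continuous in
g and vanish at g = 1. -/
theorem eventually_latticeRep_sub_mem {K : Type u} [Group K] [TopologicalSpace K]
    [FiniteDimensional L V] [TopologicalSpace V] [IsTopologicalAddGroup V] [ContinuousSMul L V]
    [T2Space V] {ρV : Representation L K V} (hρV : Continuous fun z : K × V => ρV z.1 z.2)
    (hΘ : ∀ g, ∀ x ∈ Θ, ρV g x ∈ Θ) (hϖ : Irreducible ϖ) (t : Θ) (j : ℕ) :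
    ∀ᶠ g in 𝓝 (1 : K), ∃ t', latticeRep ρV Θ hΘ g t - t = ϖ ^ j • t' := by
  have := isDiscreteValuationRing_integer hϖ
  have : Module.IsTorsionFree 𝒪[L] L := inferInstance
  have : Module.Free 𝒪[L] Θ := Submodule.IsLattice.free L Θ
  have : Module.Finite 𝒪[L] Θ := Submodule.IsLattice.finite L Θ
  have h0 : (ϖ : L) ≠ 0 := fun h => hϖ.ne_zero (Subtype.ext h)
  let b := Module.Free.chooseBasis 𝒪[L] Θ
  let B := b.extendOfIsLattice L
  have h1 : ∀ i, ∀ᶠ g in 𝓝 (1 : K), ‖B.coord i (ρV g t - t)‖ ≤ ‖(ϖ : L)‖ ^ j := by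
    intro i
    have hc : Continuous fun g : K => B.coord i (ρV g t - t) :=
      (LinearMap.continuous_of_finiteDimensional (B.coord i)).comp
        ((hρV.comp (continuous_id.prodMk continuous_const)).sub continuous_const)
    have h2 : Filter.Tendsto (fun g : K => ‖B.coord i (ρV g t - t)‖) (𝓝 1) (𝓝 0) := by
      have := (hc.norm).tendsto 1
      simpa using this
    exact (h2.eventually (gt_mem_nhds (pow_pos (norm_pos_iff.2 h0) j))).mono fun g hg => hg.le
  filter_upwards [Filter.eventually_all.2 h1] with g hg
  have h2 : ∀ i, ∃ a : 𝒪[L], B.coord i (ρV g t - t) = (ϖ : L) ^ j * a := by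
    intro i
    refine ⟨⟨B.coord i (ρV g t - t) / (ϖ : L) ^ j, ?_⟩, ?_⟩
    · rw [Valued.integer.mem_iff, norm_div, norm_pow]
      exact div_le_one_of_le₀ (hg i) (by positivity)
    · rw [mul_div_cancel₀ _ (pow_ne_zero j h0)]
  choose a ha using h2
  refine ⟨∑ i, a i • b i, Subtype.ext ?_⟩
  change ρV g t - t = ((ϖ ^ j • ∑ i, a i • b i : Θ) : V)
  rw [← B.sum_repr (ρV g t - t), Finset.smul_sum, AddSubmonoidClass.coe_finsetSum]
  refine Finset.sum_congr rfl fun i _ => ?_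
  rw [← B.coord_apply, ha, Module.Basis.extendOfIsLattice_apply, smul_smul]
  rfl

end Integers

end BreuilMezard

theorem theoremA (p : ℕ) [Fact p.Prime]
    -- `L` is a finite extension of `ℚ_p` with ring of integers `𝒪[L]` and uniformizer `ϖ`
    {L : Type u} [NontriviallyNormedField L] [IsUltrametricDist L] [NormedAlgebra ℚ_[p] L]
    [FiniteDimensional ℚ_[p] L] (ϖ : 𝒪[L]) (hϖ : Irreducible ϖ)
    -- `R` is a complete local noetherian `𝒪[L]`-algebra with residue field `k`
    {R : Type u} [CommRing R] [IsLocalRing R] [IsNoetherianRing R]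
    [IsAdicComplete (IsLocalRing.maximalIdeal R) R]
    [Algebra 𝒪[L] R] [IsLocalHom (algebraMap 𝒪[L] R)]
    (hk : Function.Bijective (IsLocalRing.ResidueField.map (algebraMap 𝒪[L] R)))
    -- `K` is a compact `p`-adic analytic group
    {K : Type u} [Group K] [TopologicalSpace K] [IsTopologicalGroup K] [CompactSpace K] [T2Space K]
    {r : ℕ} [ChartedSpace (Fin r → ℚ_[p]) K] [LieGroup 𝓘(ℚ_[p], Fin r → ℚ_[p]) ω K]
    -- `N` is a compact, finitely generated `R⟦K⟧`-module
    {N : Type u} [AddCommGroup N] [Module (CompletedGroupAlgebra R K) N]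
    [Module.Finite (CompletedGroupAlgebra R K) N]
    [Module R N] [IsScalarTower R (CompletedGroupAlgebra R K) N]
    [Module 𝒪[L] N] [IsScalarTower 𝒪[L] R N]
    [TopologicalSpace N] [IsTopologicalAddGroup N] [CompactSpace N] [T2Space N]
    [ContinuousSMul (CompletedGroupAlgebra R K) N]
    -- `V` is a continuous finite dimensional representation of `K` over `L`
    {V : Type u} [AddCommGroup V] [Module L V] [FiniteDimensional L V]
    [TopologicalSpace V] [IsTopologicalAddGroup V] [ContinuousSMul L V] [T2Space V]
    (ρV : Representation L K V) (hρV : Continuous fun z : K × V => ρV z.1 z.2)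
    -- `Θ` is a `K`-invariant lattice in `V`
    (Θ : Submodule 𝒪[L] V) [Submodule.IsLattice L Θ] (hΘ : ∀ g, ∀ x ∈ Θ, ρV g x ∈ Θ)
    -- `𝔞` is the annihilator of `M(Θ)` and `d` is the dimension of `M(Θ)`
    (𝔞 : Ideal R) (h𝔞 : 𝔞 = Module.annihilator R (MLattice 𝒪[L] R K N (latticeRep ρV Θ hΘ)))
    (d : WithBot ℕ∞)
    (hd : d = Module.supportDim R (MLattice 𝒪[L] R K N (latticeRep ρV Θ hΘ)))
    -- `N` is projective in the category of compact `𝒪[L]⟦K⟧`-modules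
    (ha : IsProjectivePro 𝒪[L] R K N)
    -- `R/𝔞` is equidimensional and its associated primes are minimal
    (hb : IsEquidimensional (R ⧸ 𝔞))
    (hb' : associatedPrimes (R ⧸ 𝔞) (R ⧸ 𝔞) ⊆ minimalPrimes (R ⧸ 𝔞))
    -- `S` is a set of maximal ideals of `R[1/p]`, dense in the support of `M(Θ)`
    (S : Set (MaximalSpectrum (Localization.Away (p : R))))
    (hS : (fun n => PrimeSpectrum.comap (algebraMap R (Localization.Away (p : R)))
      n.toPrimeSpectrum) '' S ⊆ Module.support R (MLattice 𝒪[L] R K N (latticeRep ρV Θ hΘ)))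
    (hS' : Module.support R (MLattice 𝒪[L] R K N (latticeRep ρV Θ hΘ)) ⊆
      closure ((fun n => PrimeSpectrum.comap (algebraMap R (Localization.Away (p : R)))
        n.toPrimeSpectrum) '' S))
    -- `dim Hom_K(V, Π(κ(n))) = 1` for all `n` in `S`
    (hc : ∀ n ∈ S, Module.rank (Kappa n) (HomBanach 𝒪[L] R K N L (Kappa n) ρV) = 1)
    -- `dim Hom_K(V, Π(R_n/n²)) ≤ d` for all `n` in `S`, where `κ(n)` acts through the unique
    -- section `s` of `R_n/n² → κ(n)` that is a homomorphism of `𝒪[L]`-algebras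
    (hc' : ∀ n ∈ S, ∀ s : Kappa n →ₐ[𝒪[L]] ModSq n, (∀ x, modSqToKappa n (s x) = x) →
      (dimAlong (HomBanach 𝒪[L] R K N L (ModSq n) ρV) (s : Kappa n →+* ModSq n) : WithBot ℕ∞) ≤ d) :
    IsReduced (R ⧸ 𝔞) ∧ ringKrullDim (R ⧸ 𝔞) = d ∧
    -- with `e = d - 1`, the cycles below are cycles of finitely generated modules of dimension at
    -- most `e`, and they satisfy the stated identity
    ∃ e : WithBot ℕ∞, e + 1 = d ∧
      Module.supportDim R (R ⧸ (Ideal.span {algebraMap 𝒪[L] R ϖ} ⊔ 𝔞)) ≤ e ∧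
      {c : IrrepClass (IsLocalRing.ResidueField 𝒪[L]) K |
        jhMultiplicity (reduction (latticeRep ρV Θ hΘ) ϖ) (c.out.restrict 𝒪[L]) ≠ 0}.Finite ∧
      (∀ c : IrrepClass (IsLocalRing.ResidueField 𝒪[L]) K,
        jhMultiplicity (reduction (latticeRep ρV Θ hΘ) ϖ) (c.out.restrict 𝒪[L]) ≠ 0 →
          Module.Finite R (MSmooth 𝒪[L] R K N L (c.out.restrict 𝒪[L])) ∧
          Module.supportDim R (MSmooth 𝒪[L] R K N L (c.out.restrict 𝒪[L])) ≤ e) ∧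
      cycle e (R ⧸ (Ideal.span {algebraMap 𝒪[L] R ϖ} ⊔ 𝔞)) =
        ∑ᶠ c : IrrepClass (IsLocalRing.ResidueField 𝒪[L]) K,
          jhMultiplicity (reduction (latticeRep ρV Θ hΘ) ϖ) (c.out.restrict 𝒪[L]) •
            cycle (R := R) e (MSmooth 𝒪[L] R K N L (c.out.restrict 𝒪[L])) := by
  have : ProperSpace L := FiniteDimensional.proper ℚ_[p] L
  have : CharZero L := charZero_of_injective_algebraMap (algebraMap ℚ_[p] L).injective
  have := isDiscreteValuationRing_integer hϖ
  have := discreteTopology_modInt (L := L)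
  have := finite_integer_quotient hϖ
  have := isTorsionFree_lattice Θ
  have := finite_lattice_quotient Θ hϖ
  have hϖR : algebraMap 𝒪[L] R ϖ ∈ IsLocalRing.maximalIdeal R :=
    (IsLocalRing.mem_maximalIdeal _).2 fun h => hϖ.not_isUnit (isUnit_of_map_unit _ _ h)
  have hk' : Function.Surjective ((IsLocalRing.residue R).comp (algebraMap 𝒪[L] R)) := by
    rw [← IsLocalRing.ResidueField.map_comp_residue]
    exact hk.2.comp IsLocalRing.residue_surjective
  have hp₀ : (p : 𝒪[L]) ≠ 0 := fun h =>
    (Nat.cast_ne_zero (R := L)).2 (Fact.out : p.Prime).ne_zero (by simpa using congrArg Subtype.val h)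
  have hpu : ¬ IsUnit (p : 𝒪[L]) := by
    rw [Valued.integer.isUnit_iff_norm_eq_one]
    have h : ‖(p : L)‖ = ‖(p : ℚ_[p])‖ := by
      rw [← norm_algebraMap' L (p : ℚ_[p]), map_natCast]
    change ‖(p : L)‖ ≠ 1
    rw [h]
    exact Padic.norm_p_lt_one.ne
  exact isReduced_and_cycle_eq hϖ hϖR hk' (hasBasis_nhds_zero_integer hϖ) continuous_subtype_val
    hp₀ hpu (map_natCast _ p) (eventually_latticeRep_sub_mem Θ hρV hΘ hϖ) 𝔞 h𝔞 d hd ha hb hb' S hS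
    hS' hc hc'
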